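/- Let $Q:\mathbb C\to\mathbb R\cup\{+\infty\}$ be a lower semicontinuous, radially symmetric external potential with $\liminf_{z\to\infty}Q(z)/\log|z|>2$. Write $\Delta=\frac14(\partial_{xx}+\partial_{yy})$ and $dA=\frac1\pi\,dx\,dy$. Let $\sigma$ be the equilibrium measure, i.e. the minimizer of $I_Q[\mu]=\iint\log\frac1{|z-w|}\,d\mu(z)\,d\mu(w)+\int Q\,d\mu$ over compactly supported Borel probability measures $\mu$ on $\mathbb C$, let $S=\operatorname{supp}\sigma$ be the droplet, let $\check Q$ be the pointwise supremum of all subharmonic functions $s$ on $\mathbb C$ with $s\le Q$ and $s(w)\le 2\log|w|+O(1)$ as $w\to\infty$, and let $S^*=\{Q=\check Q\}$ be the coincidence set. Suppose that, for some $0\le a<b<t$, $$S=\{a\le|z|\le b\},\qquad S^*=S\cup\{|z|=t\},$$ and that $Q$ is (finite and) $C^6$-smooth with $\Delta Q>0$ in a neighbourhood of $S^*$. Let $\{z_j\}_1^n$ be a random sample from the Coulomb gas, i.e. from the probability measure $$d\mathbb P_n(z)=\frac1{Z_n}\prod_{j>k}|z_j-z_k|^2\,e^{-n\sum_{j=1}^nQ(z_j)}\,dA(z_1)\cdots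 dA(z_n)$$ on $\mathbb C^n$, where $Z_n$ is the normalizing constant. Let $h:\mathbb C\to\mathbb R$ be a bounded, continuous, radially symmetric function that equals $0$ in a neighbourhood of $S$ and $1$ in a neighbourhood of $\{|z|=t\}$, and let $$N_n=\sum_{j=1}^nh(z_j)-n\int h\,d\sigma .$$ Then $N_n=\sum_{j=1}^nh(z_j)$ (the number of particles found in the vicinity of the outpost $\{|z|=t\}$), and as $n\to\infty$ the random variables $N_n$ converge in distribution to the Heine distribution $\mathrm{He}(\theta\rho,\rho^2)$ with $$\rho=\frac bt,\qquad \theta=\sqrt{\frac{\Delta Q(b)}{\Delta Q(t)}} .$$ Here, for $\vartheta>0$ and $0<q<1$, $\mathrm{He}(\vartheta,q)$ is the probability distribution on $\{0,1,2,\dots\}$ with $$\mathbb P(X=k)=\frac1{(-\vartheta;q)_\infty}\,\frac{q^{k(k-1)/2}\,\vartheta^k}{(q;q)_k},\qquad (z;q)_k=\prod_{i=0}^{k-1}(1-zq^i),\quad (z;q)_\infty=\prod_{i=0}^\infty(1-zq^i).$$ -/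

import Mathlib

open MeasureTheory Filter Topology
open scoped ENNReal NNReal

noncomputable section

namespace CoulombGas

/-- The integral of an extended-real function, as the integral of the positive part minus the
integral of the negative part (it is only used where one of the two is finite). -/
def erealIntegral {X : Type*} [MeasurableSpace X] (μ : Measure X) (f : X → EReal) : EReal :=
  ((∫⁻ x, (f x).toENNReal ∂μ : ℝ≥0∞) : EReal) - ((∫⁻ x, (-f x).toENNReal ∂μ : ℝ≥0∞) : EReal)

/-- An external potential `Q : ℂ → ℝ ∪ {+∞}`: radially symmetric, lower semicontinuous and
confining. -/
structure IsExternalPotential (Q : ℂ → EReal) : Prop where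
  ne_bot : ∀ z, Q z ≠ ⊥
  radial : ∀ z, Q z = Q (‖z‖ : ℂ)
  lsc : LowerSemicontinuous Q
  confining : (2 : EReal) <
    liminf (fun z : ℂ => Q z / ((Real.log ‖z‖ : ℝ) : EReal)) (Bornology.cobounded ℂ)

/-- The weighted logarithmic energy
`I_Q[μ] = ∫∫ log (1 / |z - w|) dμ(z) dμ(w) + ∫ Q dμ`; the kernel is `+∞` on the diagonal. -/
def energy (Q : ℂ → EReal) (μ : Measure ℂ) : EReal :=
  erealIntegral (μ.prod μ) (fun p => -ENNReal.log ‖p.1 - p.2‖ₑ) + erealIntegral μ Q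

/-- `σ` minimizes the weighted logarithmic energy over all compactly supported Borel probability
measures. -/
structure IsEquilibriumMeasure (Q : ℂ → EReal) (σ : Measure ℂ) : Prop where
  isProbabilityMeasure : IsProbabilityMeasure σ
  isCompact_support : IsCompact σ.support
  energy_le : ∀ μ : Measure ℂ, IsProbabilityMeasure μ → IsCompact μ.support →
    energy Q σ ≤ energy Q μ

/-- Subharmonic functions `s : ℂ → [-∞, ∞)` on the whole plane: upper semicontinuous, with the
sub-mean value property on every circle. -/
structure IsSubharmonic (s : ℂ → EReal) : Prop where
  ne_top : ∀ z, s z ≠ ⊤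
  usc : UpperSemicontinuous s
  le_circleMean : ∀ z : ℂ, ∀ r : ℝ, 0 < r →
    s z ≤ erealIntegral
      (ENNReal.ofReal (2 * Real.pi)⁻¹ • volume.restrict (Set.Ioc 0 (2 * Real.pi)))
      (fun φ : ℝ => s (circleMap z r φ))

/-- Competitors in the obstacle problem: subharmonic `s ≤ Q` with `s(w) ≤ 2 log |w| + O(1)` as
`w → ∞`. -/
def obstacleClass (Q : ℂ → EReal) : Set (ℂ → EReal) :=
  {s | IsSubharmonic s ∧ (∀ z, s z ≤ Q z) ∧
    ∃ C : ℝ, ∀ᶠ w in Bornology.cobounded ℂ, s w ≤ ((2 * Real.log ‖w‖ + C : ℝ) : EReal)}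

/-- The obstacle function `Q̌`. -/
def obstacleFunction (Q : ℂ → EReal) (z : ℂ) : EReal :=
  ⨆ s ∈ obstacleClass Q, s z

/-- The coincidence set `S* = {Q = Q̌}`. -/
def coincidenceSet (Q : ℂ → EReal) : Set ℂ :=
  {z | Q z = obstacleFunction Q z}

/-- `ΔQ = (1/4) (∂ₓₓ + ∂ᵧᵧ) Q`. -/
def quarterLaplacian (Q : ℂ → EReal) (z : ℂ) : ℝ :=
  (1 / 4 : ℝ) * Laplacian.laplacian (fun w : ℂ => (Q w).toReal) z

/-- In a neighbourhood of `K` the potential is finite, `C⁶`-smooth and strictly subharmonic. -/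
def IsRegularNear (Q : ℂ → EReal) (K : Set ℂ) : Prop :=
  ∃ U : Set ℂ, IsOpen U ∧ K ⊆ U ∧ (∀ z ∈ U, Q z ≠ ⊤) ∧
    ContDiffOn ℝ 6 (fun z => (Q z).toReal) U ∧ ∀ z ∈ U, 0 < quarterLaplacian Q z

/-- The closed annulus `A(a, b) = {a ≤ |z| ≤ b}`, a closed disk if `a = 0`. -/
def closedAnnulus (a b : ℝ) : Set ℂ :=
  {z | a ≤ ‖z‖ ∧ ‖z‖ ≤ b}

/-- Normalized Lebesgue measure `dA = dx dy / π`. -/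
def areaMeasure : Measure ℂ :=
  NNReal.pi⁻¹ • volume

/-- The unnormalized Gibbs weight `∏_{j > k} |z_j - z_k|² · exp (-n ∑_j Q(z_j))`. -/
def gibbsWeight (Q : ℂ → EReal) (n : ℕ) (z : Fin n → ℂ) : ℝ≥0∞ :=
  ‖∏ k : Fin n, ∏ j ∈ Finset.Ioi k, (z j - z k)‖ₑ ^ 2 *
    ∏ j : Fin n, EReal.exp (-((n : EReal) * Q (z j)))

/-- The partition function `Z_n` (at inverse temperature `β = 2`). -/
def partitionFunction (Q : ℂ → EReal) (n : ℕ) : ℝ≥0∞ :=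
  ∫⁻ z, gibbsWeight Q n z ∂(Measure.pi fun _ : Fin n => areaMeasure)

/-- The law `ℙ_n` of the Coulomb gas `(z_1, …, z_n)` in the potential `Q` at `β = 2`. -/
def gibbsMeasure (Q : ℂ → EReal) (n : ℕ) : Measure (Fin n → ℂ) :=
  (partitionFunction Q n)⁻¹ •
    (Measure.pi fun _ : Fin n => areaMeasure).withDensity (gibbsWeight Q n)

/-- The fluctuation `fluct_n h = ∑ h(z_j) - n ∫ h dσ`. -/
def fluct (σ : Measure ℂ) (h : ℂ → ℝ) {n : ℕ} (z : Fin n → ℂ) : ℝ :=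
  ∑ j, h (z j) - n * ∫ w, h w ∂σ

/-- The `q`-shifted factorial `(z; q)_k`. -/
def qShifted (z q : ℝ) (k : ℕ) : ℝ :=
  ∏ i ∈ Finset.range k, (1 - z * q ^ i)

/-- The limiting `q`-shifted factorial `(z; q)_∞`. -/
def qShiftedInf (z q : ℝ) : ℝ :=
  ∏' i : ℕ, (1 - z * q ^ i)

/-- The Heine distribution `He(θ, q)` on `{0, 1, 2, …}`, for `θ > 0` and `0 < q < 1`. -/
def heine (θ q : ℝ) : Measure ℕ :=
  Measure.sum fun k : ℕ =>
    ENNReal.ofReal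
        ((qShiftedInf (-θ) q)⁻¹ * (q ^ (k * (k - 1) / 2) * θ ^ k / qShifted q q k)) •
      Measure.dirac k

end CoulombGas

end

/-!
Write `φ = exp (i s h)` on the positive half-line and `w = e^{-Q}`. Because `Q` is radial, the
monomials `z^j` are orthogonal in `L²(e^{-nQ} dA)`, so expanding the squared Vandermonde determinant
turns the characteristic function of `∑ h(z_j)` into a product over `j < n` of the ratios of radial
moments `∫ φ(r) r^{2j+1} w(r)^n dr / ∫ r^{2j+1} w(r)^n dr` (`charFun_linearStatistic`): the
statistic is distributed as a sum of independent variables, one for each degree. Counting degrees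
from the top, `j = n - 1 - i`, the density of the `i`-th variable is proportional to
`r^{-(2i+1)} u(r)^n` with `u(r) = e^m r² w(r)` (`relativeWeight`).

The obstacle problem determines the shape of `u`. For each slope `α < 2`, a potential `Q` lies above
some `c + α log⁺ (|z| / r)` and touches it (`exists_touching`); such a function is an admissible
competitor, so the point of contact belongs to the coincidence set. Letting `α` increase to `2`, and
using that `Q` is differentiable at radius `t`, gives a constant `m` with `Q(z) ≥ m + 2 log |z|` and
equality for `|z| = b` and `|z| = t` (`exists_log_minorant`). An equality at a smaller radius would
propagate outwards along the droplet up to `b`, contradicting `ΔQ > 0`. The upper bounds on the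
obstacle function that this needs come from the comparison principle
`IsSubharmonic.le_log_of_le_circle`. In the hole, `Q` exceeds its value on the inner circle
(`lt_of_norm_lt_inner`). Since `log |z|` is harmonic and `Q` is radial, the second radial derivative
of `Q - 2 log |z|` at a point of contact is `4 ΔQ`, so `u` has Gaussian peaks at `b` and `t`, of
curvatures `4 ΔQ(b)` and `4 ΔQ(t)` (`exists_isTwoPeaked`).

Laplace's method at the two peaks (`IsTwoPeaked.tendsto_peakMoment`) shows that the `i`-th factor
tends to the characteristic function of a Bernoulli variable with odds `θ (b / t)^{2i+1}`. Since `φ`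
differs from `1` only away from the droplet, the `i`-th factor differs from `1` by a geometrically
small amount, uniformly in `n` (`IsTwoPeaked.exists_peakMass_outer_le` outside the droplet,
`exists_peakMass_inner_le` in the hole, where the low degrees live). By dominated convergence the
products converge to the infinite product of the Bernoulli characteristic functions
(`tendsto_prod_of_dominated`), which Euler's identity `∏ (1 + x q^i) = ∑ q^{k(k-1)/2} x^k / (q; q)_k`
identifies with the characteristic function of the Heine distribution
(`tendsto_prod_charFun_heine`). Lévy's continuity theorem concludes.
-/

noncomputable section

namespace CoulombGas

/-! ### Euler's identity and the Heine distribution -/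

lemma qShifted_succ (z q : ℝ) (k : ℕ) :
    qShifted z q (k + 1) = qShifted z q k * (1 - z * q ^ k) :=
  Finset.prod_range_succ _ _

lemma qShifted_self_pos {q : ℝ} (hq0 : 0 < q) (hq1 : q < 1) (k : ℕ) : 0 < qShifted q q k := by
  refine Finset.prod_pos fun i _ => ?_
  have : q ^ (i + 1) < 1 := pow_lt_one₀ hq0.le hq1 (by simp)
  rw [pow_succ'] at this
  linarith

/-- The coefficients `q^{k(k-1)/2} / (q;q)_k` of Euler's power series for `(-x;q)_∞`. -/
def eulerCoeff (q : ℝ) (k : ℕ) : ℝ := q ^ (k * (k - 1) / 2) / qShifted q q k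

lemma eulerCoeff_zero (q : ℝ) : eulerCoeff q 0 = 1 := by simp [eulerCoeff, qShifted]

lemma eulerCoeff_pos {q : ℝ} (hq0 : 0 < q) (hq1 : q < 1) (k : ℕ) : 0 < eulerCoeff q k :=
  div_pos (pow_pos hq0 _) (qShifted_self_pos hq0 hq1 k)

lemma eulerCoeff_succ {q : ℝ} (hq0 : 0 < q) (hq1 : q < 1) (k : ℕ) :
    eulerCoeff q (k + 1) * (1 - q ^ (k + 1)) = eulerCoeff q k * q ^ k := by
  have h1 : (0 : ℝ) < 1 - q ^ (k + 1) := by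
    have : q ^ (k + 1) < 1 := pow_lt_one₀ hq0.le hq1 (by simp)
    linarith
  have h2 := (qShifted_self_pos hq0 hq1 k).ne'
  have h3 : (k + 1) * (k + 1 - 1) / 2 = k * (k - 1) / 2 + k := Nat.triangle_succ k
  rw [eulerCoeff, eulerCoeff, h3, qShifted_succ, pow_add, ← pow_succ']
  field_simp

lemma summable_eulerCoeff {q : ℝ} (hq0 : 0 < q) (hq1 : q < 1) (x : ℂ) :
    Summable fun k => (eulerCoeff q k : ℂ) * x ^ k := by
  have hlim : Tendsto (fun k : ℕ => q ^ k * ‖x‖ / (1 - q ^ (k + 1))) atTop (𝓝 0) := by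
    have h0 := tendsto_pow_atTop_nhds_zero_of_lt_one hq0.le hq1
    have h1 := (h0.mul_const ‖x‖).div
      (tendsto_const_nhds.sub (h0.comp (tendsto_add_atTop_nat 1)) : Tendsto _ _ (𝓝 (1 - 0 : ℝ)))
      (by norm_num)
    simpa [Pi.div_def] using h1
  refine summable_of_ratio_norm_eventually_le (r := 1 / 2) (by norm_num) ?_
  filter_upwards [hlim.eventually (gt_mem_nhds (show (0 : ℝ) < 1 / 2 by norm_num))] with k hk
  have h1 : (0 : ℝ) < 1 - q ^ (k + 1) := by
    have : q ^ (k + 1) < 1 := pow_lt_one₀ hq0.le hq1 (by simp)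
    linarith
  have h2 : eulerCoeff q (k + 1) = eulerCoeff q k * q ^ k / (1 - q ^ (k + 1)) := by
    rw [← eulerCoeff_succ hq0 hq1, mul_div_cancel_right₀ _ h1.ne']
  have hp := eulerCoeff_pos hq0 hq1 k
  have hp1 := eulerCoeff_pos hq0 hq1 (k + 1)
  rw [norm_mul, norm_mul, norm_pow, norm_pow, Complex.norm_real, Complex.norm_real,
    Real.norm_of_nonneg hp.le, Real.norm_of_nonneg hp1.le, h2, pow_succ ‖x‖]
  have : eulerCoeff q k * q ^ k / (1 - q ^ (k + 1)) * (‖x‖ ^ k * ‖x‖)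
      = (q ^ k * ‖x‖ / (1 - q ^ (k + 1))) * (eulerCoeff q k * ‖x‖ ^ k) := by ring
  rw [this]
  exact mul_le_mul_of_nonneg_right hk.le (by positivity)

/-- Euler's power series for `(-x;q)_∞`. -/
def eulerSeries (q : ℝ) (x : ℂ) : ℂ := ∑' k, (eulerCoeff q k : ℂ) * x ^ k

lemma eulerSeries_eq_mul {q : ℝ} (hq0 : 0 < q) (hq1 : q < 1) (x : ℂ) :
    eulerSeries q x = (1 + x) * eulerSeries q (q * x) := by
  have hs := summable_eulerCoeff hq0 hq1 x
  have hs' := summable_eulerCoeff hq0 hq1 (q * x)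
  rw [add_mul, one_mul, eulerSeries, eulerSeries]
  nth_rw 1 [hs.tsum_eq_zero_add]
  nth_rw 1 [hs'.tsum_eq_zero_add]
  rw [← tsum_mul_left, add_assoc,
    ← ((summable_nat_add_iff 1).2 hs').tsum_add (hs'.mul_left x)]
  congr 1
  refine tsum_congr fun k => ?_
  have := congrArg (fun r : ℝ => (r : ℂ)) (eulerCoeff_succ hq0 hq1 k)
  push_cast at this
  linear_combination (x ^ (k + 1)) * this

lemma prod_mul_eulerSeries {q : ℝ} (hq0 : 0 < q) (hq1 : q < 1) (x : ℂ) (N : ℕ) :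
    (∏ i ∈ Finset.range N, (1 + x * (q : ℂ) ^ i)) * eulerSeries q ((q : ℂ) ^ N * x)
      = eulerSeries q x := by
  induction N with
  | zero => simp
  | succ N ih =>
    rw [Finset.prod_range_succ, ← ih, eulerSeries_eq_mul hq0 hq1 ((q : ℂ) ^ N * x)]
    ring_nf

/-- Euler's identity `∏ (1 + x q^i) = ∑ q^{k(k-1)/2} x^k / (q;q)_k`: both sides solve the
functional equation `F(x) = (1 + x) F(qx)` with `F(0) = 1`. -/
lemma tendsto_prod_eulerSeries {q : ℝ} (hq0 : 0 < q) (hq1 : q < 1) (x : ℂ) :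
    Tendsto (fun N => ∏ i ∈ Finset.range N, (1 + x * (q : ℂ) ^ i)) atTop
      (𝓝 (eulerSeries q x)) := by
  have h1 : Tendsto (fun N : ℕ => eulerSeries q ((q : ℂ) ^ N * x)) atTop (𝓝 1) := by
    have hz : ∑' k, (eulerCoeff q k : ℂ) * (0 : ℂ) ^ k = 1 := by
      rw [tsum_eq_single 0]
      · simp [eulerCoeff_zero]
      · intro k hk; simp [hk]
    rw [← hz]
    have h0 : Tendsto (fun N : ℕ => (q : ℂ) ^ N * x) atTop (𝓝 0) := by
      have := (tendsto_pow_atTop_nhds_zero_of_norm_lt_one (x := (q : ℂ))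
        (by rwa [Complex.norm_real, Real.norm_of_nonneg hq0.le])).mul_const x
      simpa using this
    refine tendsto_tsum_of_dominated_convergence (summable_eulerCoeff hq0 hq1 x).norm
      (fun k => (h0.pow k).const_mul _) (Eventually.of_forall fun N k => ?_)
    rw [norm_mul, norm_mul, norm_pow, norm_pow, norm_mul, norm_pow, Complex.norm_real q,
      Real.norm_of_nonneg hq0.le]
    gcongr
    exact mul_le_of_le_one_left (norm_nonneg _) (pow_le_one₀ hq0.le hq1.le)
  have h2 : ∀ᶠ N : ℕ in atTop, eulerSeries q ((q : ℂ) ^ N * x) ≠ 0 :=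
    h1.eventually_ne one_ne_zero
  have h3 : Tendsto (fun N : ℕ => eulerSeries q x / eulerSeries q ((q : ℂ) ^ N * x)) atTop
      (𝓝 (eulerSeries q x / 1)) := tendsto_const_nhds.div h1 one_ne_zero
  rw [div_one] at h3
  refine h3.congr' ?_
  filter_upwards [h2] with N hN
  rw [← prod_mul_eulerSeries hq0 hq1 x N, mul_div_cancel_right₀ _ hN]

lemma qShiftedInf_neg_eq {ϑ q : ℝ} (hq0 : 0 < q) (hq1 : q < 1) :
    (qShiftedInf (-ϑ) q : ℂ) = eulerSeries q ϑ := by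
  have hm : Multipliable fun i : ℕ => (1 - -ϑ * q ^ i) := by
    have : Summable fun i : ℕ => ϑ * q ^ i :=
      (summable_geometric_of_lt_one hq0.le hq1).mul_left ϑ
    simpa using Real.multipliable_one_add_of_summable this
  have h1 := (Complex.continuous_ofReal.tendsto _).comp hm.hasProd.tendsto_prod_nat
  refine tendsto_nhds_unique h1 ((tendsto_prod_eulerSeries hq0 hq1 (ϑ : ℂ)).congr fun N => ?_)
  simp

lemma hasSum_eulerCoeff_real {ϑ q : ℝ} (hq0 : 0 < q) (hq1 : q < 1) :
    HasSum (fun k => eulerCoeff q k * ϑ ^ k) (qShiftedInf (-ϑ) q) := by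
  have h := (summable_eulerCoeff hq0 hq1 (ϑ : ℂ)).hasSum
  rw [← eulerSeries, ← qShiftedInf_neg_eq hq0 hq1] at h
  exact_mod_cast h

lemma qShiftedInf_neg_pos {ϑ q : ℝ} (hϑ : 0 < ϑ) (hq0 : 0 < q) (hq1 : q < 1) :
    0 < qShiftedInf (-ϑ) q := by
  have h := hasSum_eulerCoeff_real (ϑ := ϑ) hq0 hq1
  refine lt_of_lt_of_le (by simp [eulerCoeff_zero]) (h.summable.tsum_eq_zero_add.symm.trans
    h.tsum_eq ▸ le_add_of_nonneg_right (tsum_nonneg fun k => ?_) :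
      eulerCoeff q 0 * ϑ ^ 0 ≤ _)
  exact mul_nonneg (eulerCoeff_pos hq0 hq1 _).le (by positivity)

lemma heine_eq (ϑ q : ℝ) : heine ϑ q = Measure.sum fun k : ℕ =>
    ENNReal.ofReal ((qShiftedInf (-ϑ) q)⁻¹ * (eulerCoeff q k * ϑ ^ k)) • Measure.dirac k := by
  unfold heine eulerCoeff
  congr 1
  ext1 k
  rw [mul_div_right_comm]

lemma isProbabilityMeasure_heine {ϑ q : ℝ} (hϑ : 0 < ϑ) (hq0 : 0 < q) (hq1 : q < 1) :
    IsProbabilityMeasure (heine ϑ q) := by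
  have hp := qShiftedInf_neg_pos hϑ hq0 hq1
  have h := (hasSum_eulerCoeff_real (ϑ := ϑ) hq0 hq1).mul_left (qShiftedInf (-ϑ) q)⁻¹
  rw [inv_mul_cancel₀ hp.ne'] at h
  constructor
  rw [heine_eq, Measure.sum_apply _ MeasurableSet.univ]
  simp only [Measure.smul_apply, measure_univ, smul_eq_mul, mul_one]
  rw [← ENNReal.ofReal_tsum_of_nonneg _ h.summable, h.tsum_eq, ENNReal.ofReal_one]
  intro k
  have := eulerCoeff_pos hq0 hq1 k
  positivity

/-- The Heine distribution is the law of a sum of independent Bernoulli variables with odds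
`ϑ q^i`, `i ≥ 0`; this is the corresponding formula for the characteristic function. -/
lemma tendsto_prod_charFun_heine {ϑ q : ℝ} (hϑ : 0 < ϑ) (hq0 : 0 < q) (hq1 : q < 1) (s : ℝ) :
    Tendsto (fun N => ∏ i ∈ Finset.range N,
        (1 + (ϑ * q ^ i / (1 + ϑ * q ^ i) : ℝ) * (Complex.exp (s * Complex.I) - 1))) atTop
      (𝓝 (charFun ((heine ϑ q).map (fun k : ℕ => (k : ℝ))) s)) := by
  have hp := qShiftedInf_neg_pos hϑ hq0 hq1
  have := isProbabilityMeasure_heine hϑ hq0 hq1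
  have hc : charFun ((heine ϑ q).map (fun k : ℕ => (k : ℝ))) s =
      eulerSeries q (ϑ * Complex.exp (s * Complex.I)) / eulerSeries q ϑ := by
    rw [charFun_apply_real, integral_map (by fun_prop) (by fun_prop)]
    have hint : Integrable (fun k : ℕ => Complex.exp (s * (k : ℝ) * Complex.I)) (heine ϑ q) := by
      refine Integrable.of_bound (by fun_prop) 1 (Eventually.of_forall fun k => ?_)
      rw [← Complex.ofReal_mul, Complex.norm_exp_ofReal_mul_I]
    rw [heine_eq] at hint ⊢
    have h := hasSum_integral_measure hint
    rw [← h.tsum_eq, ← qShiftedInf_neg_eq hq0 hq1, eulerSeries, div_eq_inv_mul, ← tsum_mul_left]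
    refine tsum_congr fun k => ?_
    have hk := eulerCoeff_pos hq0 hq1 k
    rw [integral_smul_measure, integral_dirac, ENNReal.toReal_ofReal (by positivity),
      Complex.real_smul]
    push_cast
    rw [mul_pow, ← Complex.exp_nat_mul]
    ring_nf
  have h0 : eulerSeries q ϑ ≠ 0 := by
    rw [← qShiftedInf_neg_eq hq0 hq1]; exact_mod_cast hp.ne'
  rw [hc]
  refine ((tendsto_prod_eulerSeries hq0 hq1 (ϑ * Complex.exp (s * Complex.I))).div
    (tendsto_prod_eulerSeries hq0 hq1 (ϑ : ℂ)) h0).congr fun N => ?_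
  rw [Pi.div_apply, ← Finset.prod_div_distrib]
  refine Finset.prod_congr rfl fun i _ => ?_
  have : (1 + (ϑ : ℂ) * q ^ i) ≠ 0 := by
    have : (0 : ℝ) < 1 + ϑ * q ^ i := by positivity
    exact_mod_cast this.ne'
  push_cast
  field_simp
  ring

/-! ### Integrals of radial product functions against a squared Vandermonde determinant -/

instance sigmaFinite_areaMeasure : SigmaFinite areaMeasure := by
  unfold areaMeasure; infer_instance

lemma measurePreserving_rotation_areaMeasure (c : Circle) :
    MeasurePreserving (rotation c) areaMeasure areaMeasure := by
  have h := (rotation c).measurePreserving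
  refine ⟨h.measurable, ?_⟩
  rw [areaMeasure, Measure.map_smul, h.map_eq]

/-- Monomials are orthogonal with respect to a radial weight. -/
lemma integral_pow_mul_conj_pow_eq_zero {W : ℂ → ℂ} (hW : ∀ z, W z = W (‖z‖ : ℂ)) {p q : ℕ}
    (hpq : p ≠ q) :
    ∫ z, z ^ p * (starRingEnd ℂ z) ^ q * W z ∂areaMeasure = 0 := by
  obtain ⟨c, hc⟩ : ∃ c : Circle, (c : ℂ) ^ p * (starRingEnd ℂ (c : ℂ)) ^ q ≠ 1 := by
    by_contra! hall
    have h1 : ∀ c : Circle, c ^ p = c ^ q := fun c => by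
      have h2 : (c : ℂ) ^ q * (starRingEnd ℂ (c : ℂ)) ^ q = 1 := by
        rw [← mul_pow, Complex.mul_conj, Circle.normSq_coe]; simp
      have h3 : (starRingEnd ℂ (c : ℂ)) ^ q ≠ 0 := right_ne_zero_of_mul_eq_one h2
      have h4 := mul_right_cancel₀ h3 ((hall c).trans h2.symm)
      ext; push_cast; exact h4
    have h5 := h1 (Circle.exp 1)
    rw [← Circle.exp_natCast_mul, ← Circle.exp_natCast_mul, Circle.exp_eq_exp] at h5
    obtain ⟨m, hm⟩ := h5
    -- `p - q = 2πm` forces `m = 0` because `π` is irrational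
    have hirr := irrational_pi
    rcases eq_or_ne m 0 with rfl | hm0
    · apply hpq; simpa using hm
    · apply hirr
      refine ⟨((p : ℚ) - q) / (2 * m), ?_⟩
      have : (m : ℝ) ≠ 0 := by exact_mod_cast hm0
      push_cast
      field_simp
      linarith
  have h := (measurePreserving_rotation_areaMeasure c).integral_comp
    (rotation c).toHomeomorph.measurableEmbedding
    (fun z : ℂ => z ^ p * (starRingEnd ℂ z) ^ q * W z)
  have h' : ∀ z : ℂ, (rotation c z) ^ p * (starRingEnd ℂ (rotation c z)) ^ q * W (rotation c z)
      = ((c : ℂ) ^ p * (starRingEnd ℂ (c : ℂ)) ^ q) *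
        (z ^ p * (starRingEnd ℂ z) ^ q * W z) := fun z => by
    rw [hW (rotation c z), LinearIsometryEquiv.norm_map, ← hW z, rotation_apply, map_mul]
    ring
  simp only [h'] at h
  rw [integral_const_mul] at h
  by_contra h0
  exact hc (mul_right_cancel₀ h0 (h.trans (one_mul _).symm))

lemma integrable_pow_mul_conj_pow {W : ℂ → ℂ} {p q : ℕ}
    (hm : AEStronglyMeasurable W areaMeasure)
    (hp : Integrable (fun z : ℂ => (‖z‖ : ℂ) ^ (2 * p) * W z) areaMeasure)
    (hq : Integrable (fun z : ℂ => (‖z‖ : ℂ) ^ (2 * q) * W z) areaMeasure) :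
    Integrable (fun z : ℂ => z ^ p * (starRingEnd ℂ z) ^ q * W z) areaMeasure := by
  refine Integrable.mono (hp.norm.add hq.norm)
    (AEStronglyMeasurable.mul (by fun_prop) hm) (Eventually.of_forall fun z => ?_)
  simp only [Pi.add_apply, norm_mul, norm_pow, RCLike.norm_conj, Complex.norm_real, norm_norm]
  rw [Real.norm_of_nonneg (by positivity), ← add_mul]
  refine mul_le_mul_of_nonneg_right ?_ (norm_nonneg _)
  rw [pow_mul', pow_mul']
  nlinarith [sq_nonneg (‖z‖ ^ p - ‖z‖ ^ q), sq_nonneg (‖z‖ ^ p), sq_nonneg (‖z‖ ^ q)]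

lemma ofReal_norm_vandermonde_sq {n : ℕ} (z : Fin n → ℂ) :
    ((‖∏ k : Fin n, ∏ j ∈ Finset.Ioi k, (z j - z k)‖ ^ 2 : ℝ) : ℂ) =
      ∑ σ : Equiv.Perm (Fin n), ∑ τ : Equiv.Perm (Fin n),
        ((Equiv.Perm.sign σ : ℤ) : ℂ) * ((Equiv.Perm.sign τ : ℤ) : ℂ) *
          ∏ j, (z j ^ (σ j : ℕ) * (starRingEnd ℂ (z j)) ^ (τ j : ℕ)) := by
  rw [← Matrix.det_vandermonde, Complex.ofReal_pow, ← Complex.mul_conj', ← Matrix.det_transpose,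
    Matrix.det_apply', map_sum, Finset.sum_mul_sum]
  refine Finset.sum_congr rfl fun σ _ => Finset.sum_congr rfl fun τ _ => ?_
  rw [Finset.prod_mul_distrib]
  simp only [Matrix.transpose_apply, Matrix.vandermonde_apply, map_mul, map_prod, map_pow,
    map_intCast]
  ring

section Andreief

variable {n : ℕ} {W : ℂ → ℂ} (hW : ∀ z, W z = W (‖z‖ : ℂ))
  (hm : AEStronglyMeasurable W areaMeasure)
  (hint : ∀ j < n, Integrable (fun z : ℂ => (‖z‖ : ℂ) ^ (2 * j) * W z) areaMeasure)

include hm hint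

lemma integrable_vandermonde_term (σ τ : Equiv.Perm (Fin n)) :
    Integrable (fun z : Fin n → ℂ =>
        ∏ j, (z j ^ (σ j : ℕ) * (starRingEnd ℂ (z j)) ^ (τ j : ℕ) * W (z j)))
      (Measure.pi fun _ => areaMeasure) :=
  Integrable.fintype_prod
    (f := fun j z => z ^ (σ j : ℕ) * (starRingEnd ℂ z) ^ (τ j : ℕ) * W z) fun j =>
    integrable_pow_mul_conj_pow hm (hint _ (σ j).2) (hint _ (τ j).2)

omit hm hint in
lemma vandermonde_sq_mul_prod (z : Fin n → ℂ) :
    ((‖∏ k : Fin n, ∏ j ∈ Finset.Ioi k, (z j - z k)‖ ^ 2 : ℝ) : ℂ) * ∏ j, W (z j) =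
      ∑ σ : Equiv.Perm (Fin n), ∑ τ : Equiv.Perm (Fin n),
        ((Equiv.Perm.sign σ : ℤ) : ℂ) * ((Equiv.Perm.sign τ : ℤ) : ℂ) *
          ∏ j, (z j ^ (σ j : ℕ) * (starRingEnd ℂ (z j)) ^ (τ j : ℕ) * W (z j)) := by
  rw [ofReal_norm_vandermonde_sq, Finset.sum_mul]
  refine Finset.sum_congr rfl fun σ _ => ?_
  rw [Finset.sum_mul]
  refine Finset.sum_congr rfl fun τ _ => ?_
  rw [mul_assoc, ← Finset.prod_mul_distrib]

lemma integrable_vandermonde_sq_mul_prod :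
    Integrable (fun z : Fin n → ℂ =>
        ((‖∏ k : Fin n, ∏ j ∈ Finset.Ioi k, (z j - z k)‖ ^ 2 : ℝ) : ℂ) * ∏ j, W (z j))
      (Measure.pi fun _ => areaMeasure) := by
  simp only [vandermonde_sq_mul_prod]
  exact integrable_finsetSum _ fun σ _ => integrable_finsetSum _ fun τ _ =>
    (integrable_vandermonde_term hm hint σ τ).const_mul _

include hW

/-- For a radial weight the Andréief identity diagonalizes: the moments of the moduli factorize. -/
lemma integral_vandermonde_sq_mul_prod :
    ∫ z : Fin n → ℂ, ((‖∏ k : Fin n, ∏ j ∈ Finset.Ioi k, (z j - z k)‖ ^ 2 : ℝ) : ℂ) *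
        ∏ j, W (z j) ∂(Measure.pi fun _ => areaMeasure) =
      (n.factorial : ℂ) *
        ∏ j ∈ Finset.range n, ∫ z, (‖z‖ : ℂ) ^ (2 * j) * W z ∂areaMeasure := by
  simp only [vandermonde_sq_mul_prod]
  have hi := integrable_vandermonde_term hm hint
  rw [integral_finsetSum _ fun σ _ => integrable_finsetSum _ fun τ _ => (hi σ τ).const_mul _]
  have key : ∀ σ : Equiv.Perm (Fin n), ∫ z : Fin n → ℂ, ∑ τ : Equiv.Perm (Fin n),
        ((Equiv.Perm.sign σ : ℤ) : ℂ) * ((Equiv.Perm.sign τ : ℤ) : ℂ) *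
          ∏ j, (z j ^ (σ j : ℕ) * (starRingEnd ℂ (z j)) ^ (τ j : ℕ) * W (z j))
          ∂(Measure.pi fun _ => areaMeasure)
      = ∏ j ∈ Finset.range n, ∫ z, (‖z‖ : ℂ) ^ (2 * j) * W z ∂areaMeasure := by
    intro σ
    rw [integral_finsetSum _ fun τ _ => (hi σ τ).const_mul _, Finset.sum_eq_single σ]
    · rw [integral_const_mul, integral_fintype_prod_eq_prod
        (f := fun j z => z ^ (σ j : ℕ) * (starRingEnd ℂ z) ^ (σ j : ℕ) * W z)]
      have hs : ((Equiv.Perm.sign σ : ℤ) : ℂ) * ((Equiv.Perm.sign σ : ℤ) : ℂ) = 1 := by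
        rw [← Int.cast_mul, ← Units.val_mul, Int.units_mul_self]; simp
      rw [hs, one_mul, ← Fin.prod_univ_eq_prod_range
        (fun j => ∫ z, (‖z‖ : ℂ) ^ (2 * j) * W z ∂areaMeasure) n,
        ← Equiv.prod_comp σ (fun j : Fin n => ∫ z, (‖z‖ : ℂ) ^ (2 * (j : ℕ)) * W z ∂areaMeasure)]
      refine Finset.prod_congr rfl fun j _ => integral_congr_ae (Eventually.of_forall fun z => ?_)
      simp only
      rw [← mul_pow, Complex.mul_conj', pow_mul]
    · intro τ _ hτ
      rw [integral_const_mul, integral_fintype_prod_eq_prod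
        (f := fun j z => z ^ (σ j : ℕ) * (starRingEnd ℂ z) ^ (τ j : ℕ) * W z)]
      obtain ⟨j, hj⟩ : ∃ j, σ j ≠ τ j := by
        by_contra! hall
        exact hτ (Equiv.ext fun j => (hall j).symm)
      rw [Finset.prod_eq_zero (Finset.mem_univ j), mul_zero]
      exact integral_pow_mul_conj_pow_eq_zero hW fun h => hj (Fin.ext h)
    · simp
  rw [Finset.sum_congr rfl fun σ _ => key σ, Finset.sum_const, Finset.card_univ,
    Fintype.card_perm, Fintype.card_fin, nsmul_eq_mul]

end Andreief

/-! ### Passage to the radial variable -/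

lemma areaMeasure_eq_smul : areaMeasure = (ENNReal.ofReal Real.pi⁻¹) • (volume : Measure ℂ) := by
  rw [areaMeasure]
  ext s hs
  simp only [Measure.smul_apply, smul_eq_mul]
  rw [ENNReal.smul_def, smul_eq_mul]
  congr 1
  rw [ENNReal.ofReal]
  congr 1
  ext
  simp [Real.pi_pos.le]

lemma integrable_radial_areaMeasure {f : ℝ → ℂ} :
    Integrable (fun z : ℂ => f ‖z‖) areaMeasure ↔
      IntegrableOn (fun r : ℝ => (r : ℂ) * f r) (Set.Ioi 0) := by
  rw [areaMeasure_eq_smul, integrable_smul_measure (by simp [Real.pi_pos]) (by simp),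
    integrable_fun_norm_addHaar]
  simp [Complex.finrank_real_complex]

lemma integral_radial_areaMeasure (f : ℝ → ℂ) :
    ∫ z : ℂ, f ‖z‖ ∂areaMeasure = 2 * ∫ r in Set.Ioi (0 : ℝ), (r : ℂ) * f r := by
  rw [areaMeasure_eq_smul, integral_smul_measure, integral_fun_norm_addHaar]
  have : (volume : Measure ℂ).real (Metric.ball 0 1) = Real.pi := by
    simp [measureReal_def, Complex.volume_ball]
  rw [this, Complex.finrank_real_complex, ENNReal.toReal_ofReal (by positivity)]
  have hpi : (Real.pi : ℂ) ≠ 0 := by exact_mod_cast Real.pi_ne_zero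
  simp only [Complex.real_smul, nsmul_eq_mul, Complex.ofReal_inv, Nat.add_one_sub_one, pow_one]
  push_cast
  field_simp

/-! ### Linear statistics of radial functions -/

/-- The real-valued weight `e^{-Q}`, equal to `0` where `Q = +∞`. -/
def weight (Q : ℂ → EReal) (z : ℂ) : ℝ := (EReal.exp (-Q z)).toReal

lemma weight_nonneg (Q : ℂ → EReal) (z : ℂ) : 0 ≤ weight Q z := ENNReal.toReal_nonneg

lemma exp_neg_nat_mul {Q : ℂ → EReal} (hQ : ∀ z, Q z ≠ ⊥) (n : ℕ) (z : ℂ) :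
    EReal.exp (-((n : EReal) * Q z)) = ENNReal.ofReal (weight Q z ^ n) := by
  rw [← mul_neg, EReal.exp_nmul, weight, ENNReal.ofReal_pow ENNReal.toReal_nonneg,
    ENNReal.ofReal_toReal]
  simpa using hQ z

lemma gibbsWeight_eq {Q : ℂ → EReal} (hQ : ∀ z, Q z ≠ ⊥) (n : ℕ) (z : Fin n → ℂ) :
    gibbsWeight Q n z = ENNReal.ofReal
      (‖∏ k : Fin n, ∏ j ∈ Finset.Ioi k, (z j - z k)‖ ^ 2 * ∏ j, weight Q (z j) ^ n) := by
  rw [gibbsWeight, ENNReal.ofReal_mul (by positivity),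
    ENNReal.ofReal_prod_of_nonneg fun j _ => pow_nonneg (weight_nonneg Q _) n,
    ENNReal.ofReal_pow (norm_nonneg _), ofReal_norm]
  simp only [exp_neg_nat_mul hQ]

/-- `∫ φ(r) r^{2j+1} w(r)^n dr` over `r > 0`. For `w = e^{-Q}` this is half the integral of
`φ(|z|) |z|^{2j} e^{-nQ(z)}` against `dA`. -/
def radialMoment (w : ℝ → ℝ) (n j : ℕ) (φ : ℝ → ℂ) : ℂ :=
  ∫ r in Set.Ioi (0 : ℝ), φ r * ((r ^ (2 * j + 1) * w r ^ n : ℝ) : ℂ)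

section RadialGas

variable {Q : ℂ → EReal} (hbot : ∀ z, Q z ≠ ⊥) {w : ℝ → ℝ} (hw : Measurable w)
  (hQw : ∀ z, weight Q z = w ‖z‖) {n : ℕ}
  (hint : ∀ j < n, IntegrableOn (fun r : ℝ => r ^ (2 * j + 1) * w r ^ n) (Set.Ioi 0))

include hw hQw hint

/-- The expectation of a product over the particles, before normalization. -/
lemma integral_prod_gibbs {φ : ℝ → ℂ} (hφ : Measurable φ) {C : ℝ} (hC : ∀ r, ‖φ r‖ ≤ C) :
    Integrable (fun z : Fin n → ℂ => (∏ j, φ ‖z j‖) *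
        ((‖∏ k : Fin n, ∏ j ∈ Finset.Ioi k, (z j - z k)‖ ^ 2 * ∏ j, weight Q (z j) ^ n : ℝ) : ℂ))
      (Measure.pi fun _ => areaMeasure) ∧
    ∫ z : Fin n → ℂ, (∏ j, φ ‖z j‖) *
        ((‖∏ k : Fin n, ∏ j ∈ Finset.Ioi k, (z j - z k)‖ ^ 2 * ∏ j, weight Q (z j) ^ n : ℝ) : ℂ)
        ∂(Measure.pi fun _ => areaMeasure) =
      (n.factorial : ℂ) * ∏ j ∈ Finset.range n, (2 * radialMoment w n j φ) := by
  set W : ℂ → ℂ := fun z => φ ‖z‖ * ((w ‖z‖ ^ n : ℝ) : ℂ) with hWdef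
  have hW : ∀ z, W z = W (‖z‖ : ℂ) := fun z => by simp [hWdef]
  have hWm : Measurable W := by fun_prop
  have hrad : ∀ j, (fun z : ℂ => (‖z‖ : ℂ) ^ (2 * j) * W z) =
      fun z : ℂ => (fun r : ℝ => (r : ℂ) ^ (2 * j) * (φ r * ((w r ^ n : ℝ) : ℂ))) ‖z‖ := fun j => rfl
  have hpt : ∀ j, ∀ r : ℝ, (r : ℂ) * ((r : ℂ) ^ (2 * j) * (φ r * ((w r ^ n : ℝ) : ℂ))) =
      φ r * ((r ^ (2 * j + 1) * w r ^ n : ℝ) : ℂ) := fun j r => by push_cast; ring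
  have hWint : ∀ j < n, Integrable (fun z : ℂ => (‖z‖ : ℂ) ^ (2 * j) * W z) areaMeasure := by
    intro j hj
    rw [hrad, integrable_radial_areaMeasure
      (f := fun r : ℝ => (r : ℂ) ^ (2 * j) * (φ r * ((w r ^ n : ℝ) : ℂ)))]
    simp only [hpt]
    exact (hint j hj).ofReal.bdd_mul hφ.aestronglyMeasurable (Eventually.of_forall hC)
  have hprod : ∀ z : Fin n → ℂ, (∏ j, φ ‖z j‖) *
        ((‖∏ k : Fin n, ∏ j ∈ Finset.Ioi k, (z j - z k)‖ ^ 2 * ∏ j, weight Q (z j) ^ n : ℝ) : ℂ)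
      = ((‖∏ k : Fin n, ∏ j ∈ Finset.Ioi k, (z j - z k)‖ ^ 2 : ℝ) : ℂ) * ∏ j, W (z j) := by
    intro z
    simp only [hWdef, hQw, Finset.prod_mul_distrib]
    push_cast
    ring
  simp only [hprod]
  refine ⟨integrable_vandermonde_sq_mul_prod hWm.aestronglyMeasurable hWint, ?_⟩
  rw [integral_vandermonde_sq_mul_prod hW hWm.aestronglyMeasurable hWint]
  congr 1
  refine Finset.prod_congr rfl fun j _ => ?_
  rw [hrad, integral_radial_areaMeasure
    fun r : ℝ => (r : ℂ) ^ (2 * j) * (φ r * ((w r ^ n : ℝ) : ℂ))]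
  simp only [hpt]
  rfl

include hbot

variable (hpos : ∀ j < n, radialMoment w n j (fun _ => 1) ≠ 0)

include hpos

lemma partitionFunction_eq : partitionFunction Q n ≠ 0 ∧ partitionFunction Q n ≠ ∞ ∧
    ((partitionFunction Q n).toReal : ℂ) =
      (n.factorial : ℂ) * ∏ j ∈ Finset.range n, (2 * radialMoment w n j (fun _ => 1)) := by
  obtain ⟨hi, he⟩ := integral_prod_gibbs hw hQw hint (φ := fun _ => 1) measurable_const (C := 1)
    (by simp)
  simp only [Finset.prod_const_one, one_mul] at hi he
  have hi' := hi.re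
  simp only [RCLike.re_eq_complex_re, Complex.ofReal_re] at hi'
  have hnn : ∀ z : Fin n → ℂ, 0 ≤ ‖∏ k : Fin n, ∏ j ∈ Finset.Ioi k, (z j - z k)‖ ^ 2 *
      ∏ j, weight Q (z j) ^ n := fun z =>
    mul_nonneg (by positivity) (Finset.prod_nonneg fun j _ => pow_nonneg (weight_nonneg Q _) n)
  have hZ : partitionFunction Q n = ENNReal.ofReal (∫ z : Fin n → ℂ,
      (‖∏ k : Fin n, ∏ j ∈ Finset.Ioi k, (z j - z k)‖ ^ 2 * ∏ j, weight Q (z j) ^ n)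
        ∂(Measure.pi fun _ => areaMeasure)) := by
    rw [partitionFunction, ofReal_integral_eq_lintegral_ofReal hi' (Eventually.of_forall hnn)]
    simp only [gibbsWeight_eq hbot]
  rw [integral_complex_ofReal] at he
  have hR : ((partitionFunction Q n).toReal : ℂ) =
      (n.factorial : ℂ) * ∏ j ∈ Finset.range n, (2 * radialMoment w n j (fun _ => 1)) := by
    rw [hZ, ENNReal.toReal_ofReal (integral_nonneg hnn), he]
  refine ⟨fun h0 => ?_, hZ ▸ ENNReal.ofReal_ne_top, hR⟩
  rw [h0, ENNReal.toReal_zero, Complex.ofReal_zero, eq_comm, mul_eq_zero] at hR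
  rcases hR with h | h
  · exact (Nat.cast_ne_zero.2 (Nat.factorial_ne_zero n)) h
  · obtain ⟨j, hj, h⟩ := Finset.prod_eq_zero_iff.1 h
    exact hpos j (Finset.mem_range.1 hj) (by simpa using h)

lemma isProbabilityMeasure_gibbsMeasure : IsProbabilityMeasure (gibbsMeasure Q n) := by
  obtain ⟨h0, h1, -⟩ := partitionFunction_eq hbot hw hQw hint hpos
  constructor
  rw [gibbsMeasure, Measure.smul_apply, withDensity_apply _ MeasurableSet.univ,
    Measure.restrict_univ, ← partitionFunction, smul_eq_mul, ENNReal.inv_mul_cancel h0 h1]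

/-- In a radial potential, a linear statistic of a radial function has the law of a sum of
independent variables, one for each degree `j < n`. -/
lemma charFun_linearStatistic {h : ℂ → ℝ} (hh : Measurable h) (hrad : ∀ z, h z = h (‖z‖ : ℂ))
    (s : ℝ) :
    charFun ((gibbsMeasure Q n).map fun z => ∑ j, h (z j)) s =
      ∏ j ∈ Finset.range n,
        (radialMoment w n j (fun r => Complex.exp (s * h (r : ℂ) * Complex.I)) /
          radialMoment w n j (fun _ => 1)) := by
  obtain ⟨h0, h1, hZ⟩ := partitionFunction_eq hbot hw hQw hint hpos
  have hwm : Measurable (weight Q) := by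
    rw [funext hQw]; fun_prop
  have hgm : Measurable (gibbsWeight Q n) := by
    rw [funext (gibbsWeight_eq hbot n)]
    fun_prop
  have hsum : Measurable fun z : Fin n → ℂ => ∑ j, h (z j) :=
    Finset.measurable_fun_sum _ fun j _ => hh.comp (measurable_pi_apply j)
  rw [charFun_apply_real, integral_map hsum.aemeasurable (by fun_prop), gibbsMeasure,
    integral_smul_measure, integral_withDensity_eq_integral_toReal_smul hgm
      (Eventually.of_forall fun z => by rw [gibbsWeight_eq hbot]; exact ENNReal.ofReal_lt_top)]
  have hnn : ∀ z : Fin n → ℂ, 0 ≤ ‖∏ k : Fin n, ∏ j ∈ Finset.Ioi k, (z j - z k)‖ ^ 2 *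
      ∏ j, weight Q (z j) ^ n := fun z =>
    mul_nonneg (by positivity) (Finset.prod_nonneg fun j _ => pow_nonneg (weight_nonneg Q _) n)
  have hpt : ∀ z : Fin n → ℂ, (gibbsWeight Q n z).toReal •
      Complex.exp (s * ((∑ j, h (z j) : ℝ) : ℂ) * Complex.I) =
      (∏ j, (fun r : ℝ => Complex.exp (s * h (r : ℂ) * Complex.I)) ‖z j‖) *
        ((‖∏ k : Fin n, ∏ j ∈ Finset.Ioi k, (z j - z k)‖ ^ 2 *
          ∏ j, weight Q (z j) ^ n : ℝ) : ℂ) := fun z => by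
    rw [gibbsWeight_eq hbot, ENNReal.toReal_ofReal (hnn z), Complex.real_smul, mul_comm]
    congr 1
    rw [← Complex.exp_sum]
    congr 1
    push_cast
    rw [Finset.mul_sum, Finset.sum_mul]
    exact Finset.sum_congr rfl fun j _ => by rw [hrad]
  simp only [hpt]
  rw [(integral_prod_gibbs hw hQw hint (φ := fun r => Complex.exp (s * h (r : ℂ) * Complex.I))
    (by fun_prop) (C := 1) fun r => by
      rw [← Complex.ofReal_mul, Complex.norm_exp_ofReal_mul_I]).2,
    ENNReal.toReal_inv, Complex.real_smul, Complex.ofReal_inv, hZ, Finset.prod_div_distrib,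
    Finset.prod_mul_distrib, Finset.prod_mul_distrib]
  have hp : ∏ j ∈ Finset.range n, radialMoment w n j (fun _ => 1) ≠ 0 :=
    Finset.prod_ne_zero_iff.2 fun j hj => hpos j (Finset.mem_range.1 hj)
  have hf : (n.factorial : ℂ) ≠ 0 := Nat.cast_ne_zero.2 (Nat.factorial_ne_zero n)
  have h2 : ∏ j ∈ Finset.range n, (2 : ℂ) ≠ 0 := by simp
  rw [mul_inv, mul_inv]
  generalize (∏ j ∈ Finset.range n, radialMoment w n j (fun _ => 1)) = A at hp ⊢
  generalize (∏ j ∈ Finset.range n, (2 : ℂ)) = B at h2 ⊢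
  rw [show ∀ X : ℂ, (n.factorial : ℂ)⁻¹ * (B⁻¹ * A⁻¹) * (n.factorial * (B * X)) = X / A from
    fun X => by field_simp]

end RadialGas

/-! ### Laplace's method with two Gaussian peaks -/

/-- `u` has a Gaussian peak of height `1` and curvature `κ` at `c`:
`u(c + x) = exp(-κ x²/2 + o(x²))`. -/
def HasGaussianPeak (u : ℝ → ℝ) (c κ : ℝ) : Prop :=
  0 < κ ∧ ∃ G : ℝ → ℝ, (∀ᶠ x in 𝓝 0, u (c + x) = Real.exp (-G x)) ∧
    Tendsto (fun x => G x / x ^ 2) (𝓝[≠] 0) (𝓝 (κ / 2))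

lemma HasGaussianPeak.exists_radius {u : ℝ → ℝ} {c κ : ℝ} (h : HasGaussianPeak u c κ) :
    ∃ G : ℝ → ℝ, ∃ δ₀ > 0, (∀ x, |x| < δ₀ → u (c + x) = Real.exp (-G x)) ∧
      (∀ x, |x| < δ₀ → x ≠ 0 → κ / 4 * x ^ 2 ≤ G x) ∧
      Tendsto (fun x => G x / x ^ 2) (𝓝[≠] 0) (𝓝 (κ / 2)) := by
  obtain ⟨hκ, G, h1, h2⟩ := h
  have h3 : ∀ᶠ x in 𝓝[≠] (0 : ℝ), κ / 4 < G x / x ^ 2 :=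
    h2.eventually (lt_mem_nhds (by linarith))
  rw [eventually_nhdsWithin_iff] at h3
  obtain ⟨δ₀, hδ, hall⟩ := Metric.eventually_nhds_iff.1 (h1.and h3)
  refine ⟨G, δ₀, hδ, fun x hx => (hall (by simpa using hx)).1, fun x hx h0 => ?_, h2⟩
  have := (hall (y := x) (by simpa using hx)).2 h0
  rw [lt_div_iff₀ (by positivity)] at this
  exact this.le

/-- Laplace's method at a single peak: substitute `r = c + v / √n` and use dominated convergence. -/
lemma tendsto_laplace_local {u : ℝ → ℝ} (hu : Measurable u) {c κ : ℝ} (hκ : 0 < κ) {G : ℝ → ℝ}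
    {δ : ℝ} (hδ : 0 < δ) (h1 : ∀ x, |x| < δ → u (c + x) = Real.exp (-G x))
    (h2 : ∀ x, |x| < δ → x ≠ 0 → κ / 4 * x ^ 2 ≤ G x)
    (h3 : Tendsto (fun x => G x / x ^ 2) (𝓝[≠] 0) (𝓝 (κ / 2)))
    {F : ℝ → ℂ} (hF : Measurable F) (hFc : ContinuousAt F c) {C : ℝ}
    (hC : ∀ r, |r - c| < δ → ‖F r‖ ≤ C) :
    Tendsto (fun n : ℕ => (√(n : ℝ) : ℂ) *
        ∫ r in {r | |r - c| < δ}, F r * ((u r ^ n : ℝ) : ℂ)) atTop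
      (𝓝 (F c * (√(2 * Real.pi / κ) : ℝ))) := by
  have hmeas : MeasurableSet {r : ℝ | |r - c| < δ} :=
    measurableSet_lt (by fun_prop) measurable_const
  set f : ℕ → ℝ → ℂ := fun n => {r | |r - c| < δ}.indicator fun r => F r * ((u r ^ n : ℝ) : ℂ)
    with hf
  have hfm : ∀ n, Measurable (f n) := fun n => by
    refine Measurable.indicator ?_ hmeas
    fun_prop
  have hsub : ∀ n : ℕ, 0 < n → (√(n : ℝ) : ℂ) *
      ∫ r in {r | |r - c| < δ}, F r * ((u r ^ n : ℝ) : ℂ) = ∫ v, f n (c + v / √(n : ℝ)) := by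
    intro n hn
    have := Measure.integral_comp_div (fun v => f n (c + v)) √(n : ℝ)
    rw [this, integral_add_left_eq_self, abs_of_nonneg (Real.sqrt_nonneg _), Complex.real_smul,
      hf, integral_indicator hmeas]
  have hlim : Tendsto (fun n : ℕ => ∫ v, f n (c + v / √(n : ℝ))) atTop
      (𝓝 (∫ v : ℝ, F c * ((Real.exp (-(κ / 2) * v ^ 2) : ℝ) : ℂ))) := by
    refine tendsto_integral_filter_of_dominated_convergence
      (fun v => C * Real.exp (-(κ / 4) * v ^ 2)) (Eventually.of_forall fun n => ?_) ?_
      ((integrable_exp_neg_mul_sq (by linarith)).const_mul C) ?_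
    · exact ((hfm n).comp (by fun_prop)).aestronglyMeasurable
    · filter_upwards [eventually_gt_atTop 0] with n hn
      have : ∀ᵐ v : ℝ, v ≠ 0 := by simp [ae_iff]
      filter_upwards [this] with v hv
      have hC0 : 0 ≤ C := (norm_nonneg _).trans (hC c (by simpa using hδ))
      by_cases hm : c + v / √(n : ℝ) ∈ {r | |r - c| < δ}
      · simp only [hf]
        rw [Set.indicator_of_mem hm, norm_mul, Complex.norm_real, Real.norm_eq_abs]
        have hm' : |v / √(n : ℝ)| < δ := by simpa using hm
        rw [h1 _ hm', ← Real.exp_nat_mul, abs_of_pos (Real.exp_pos _)]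
        refine mul_le_mul (hC _ hm) (Real.exp_le_exp.2 ?_) (Real.exp_pos _).le hC0
        have hn' : (0 : ℝ) < n := by exact_mod_cast hn
        have h5 := h2 _ hm' (div_ne_zero hv (Real.sqrt_pos.2 hn').ne')
        rw [div_pow, Real.sq_sqrt hn'.le] at h5
        have h6 : κ / 4 * v ^ 2 ≤ n * G (v / √(n : ℝ)) := by
          calc κ / 4 * v ^ 2 = n * (κ / 4 * (v ^ 2 / n)) := by field_simp
            _ ≤ _ := mul_le_mul_of_nonneg_left h5 hn'.le
        linarith
      · simp only [hf]
        rw [Set.indicator_of_notMem hm, norm_zero]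
        positivity
    · have : ∀ᵐ v : ℝ, v ≠ 0 := by simp [ae_iff]
      filter_upwards [this] with v hv
      have hx : Tendsto (fun n : ℕ => v / √(n : ℝ)) atTop (𝓝 0) :=
        tendsto_const_nhds.div_atTop
          (Real.tendsto_sqrt_atTop.comp tendsto_natCast_atTop_atTop)
      have hx' : Tendsto (fun n : ℕ => v / √(n : ℝ)) atTop (𝓝[≠] 0) := by
        refine tendsto_nhdsWithin_iff.2 ⟨hx, ?_⟩
        filter_upwards [eventually_gt_atTop 0] with n hn
        exact div_ne_zero hv (Real.sqrt_pos.2 (by exact_mod_cast hn)).ne'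
      have hFl : Tendsto (fun n : ℕ => F (c + v / √(n : ℝ))) atTop (𝓝 (F c)) := by
        refine hFc.tendsto.comp ?_
        simpa using hx.const_add c
      have hG := (h3.comp hx').mul_const (v ^ 2)
      have hE : Tendsto (fun n : ℕ =>
          ((Real.exp (-(G (v / √(n : ℝ)) / (v / √(n : ℝ)) ^ 2 * v ^ 2)) : ℝ) : ℂ)) atTop
          (𝓝 ((Real.exp (-(κ / 2) * v ^ 2) : ℝ) : ℂ)) := by
        rw [neg_mul]
        exact (Complex.continuous_ofReal.tendsto _).comp
          ((Real.continuous_exp.tendsto _).comp hG.neg)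
      refine (hFl.mul hE).congr' ?_
      have hsmall : ∀ᶠ n : ℕ in atTop, |v / √(n : ℝ)| < δ := by
        have := hx.abs
        rw [abs_zero] at this
        exact this.eventually (gt_mem_nhds hδ)
      filter_upwards [hsmall, eventually_gt_atTop 0] with n hn hn0
      have hm : c + v / √(n : ℝ) ∈ {r | |r - c| < δ} := by simpa using hn
      have hn' : (0 : ℝ) < n := by exact_mod_cast hn0
      simp only [hf]
      rw [Set.indicator_of_mem hm, h1 _ hn, ← Real.exp_nat_mul]
      congr 3
      rw [div_pow, Real.sq_sqrt hn'.le]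
      field_simp
  have hg : ∫ v : ℝ, F c * ((Real.exp (-(κ / 2) * v ^ 2) : ℝ) : ℂ)
      = F c * (√(2 * Real.pi / κ) : ℝ) := by
    rw [integral_const_mul, integral_complex_ofReal, integral_gaussian]
    congr 3
    field_simp
  rw [← hg]
  refine hlim.congr' ?_
  filter_upwards [eventually_gt_atTop 0] with n hn using (hsub n hn).symm

/-- The moment `∫ φ(r) r^{-(2i+1)} u(r)^n dr` on the half-line. -/
def peakMoment (u : ℝ → ℝ) (n i : ℕ) (φ : ℝ → ℂ) : ℂ :=
  ∫ r in Set.Ioi (0 : ℝ), φ r * (((r ^ (2 * i + 1))⁻¹ * u r ^ n : ℝ) : ℂ)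

/-- The hypotheses on `u = e^{m} r² e^{-Q}` under which Laplace's method localizes to `b`, `t`. -/
structure IsTwoPeaked (u : ℝ → ℝ) (b t κb κt : ℝ) : Prop where
  measurable : Measurable u
  nonneg : ∀ r, 0 ≤ u r
  le_one : ∀ r, 0 < r → u r ≤ 1
  b_pos : 0 < b
  b_lt_t : b < t
  peak_b : HasGaussianPeak u b κb
  peak_t : HasGaussianPeak u t κt
  away : ∀ δ > 0, ∃ η, 0 ≤ η ∧ η < 1 ∧ ∀ r, 0 < r → δ ≤ |r - b| → δ ≤ |r - t| → u r ≤ η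
  integrable : ∀ i : ℕ,
    IntegrableOn (fun r : ℝ => (r ^ (2 * i + 1))⁻¹ * u r ^ (i + 1)) (Set.Ioi 0)

namespace IsTwoPeaked

variable {u : ℝ → ℝ} {b t κb κt : ℝ} (H : IsTwoPeaked u b t κb κt)
include H

lemma integrableOn {n i : ℕ} (hi : i < n) :
    IntegrableOn (fun r : ℝ => (r ^ (2 * i + 1))⁻¹ * u r ^ n) (Set.Ioi 0) := by
  have := H.measurable
  refine (H.integrable i).mono' (by fun_prop) ?_
  filter_upwards [ae_restrict_mem measurableSet_Ioi] with r hr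
  have hr' : (0 : ℝ) < r := hr
  have h0 := H.nonneg r
  rw [Real.norm_of_nonneg (by positivity)]
  exact mul_le_mul_of_nonneg_left (pow_le_pow_of_le_one h0 (H.le_one r hr) hi) (by positivity)

lemma integrableOn_mul {n i : ℕ} (hi : i < n) {φ : ℝ → ℂ} (hφ : Measurable φ) {C : ℝ}
    (hC : ∀ r, ‖φ r‖ ≤ C) :
    IntegrableOn (fun r : ℝ => φ r * (((r ^ (2 * i + 1))⁻¹ * u r ^ n : ℝ) : ℂ)) (Set.Ioi 0) :=
  (H.integrableOn hi).ofReal.bdd_mul hφ.aestronglyMeasurable (Eventually.of_forall hC)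

/-- The two-peak Laplace asymptotics of the moments. -/
lemma tendsto_peakMoment (i : ℕ) {φ : ℝ → ℂ} (hφ : Measurable φ) {C : ℝ} (hC : ∀ r, ‖φ r‖ ≤ C)
    (hφb : ContinuousAt φ b) (hφt : ContinuousAt φ t) :
    Tendsto (fun n : ℕ => (√(n : ℝ) : ℂ) * peakMoment u n i φ) atTop
      (𝓝 (φ b * (((b ^ (2 * i + 1))⁻¹ * √(2 * Real.pi / κb) : ℝ) : ℂ) +
        φ t * (((t ^ (2 * i + 1))⁻¹ * √(2 * Real.pi / κt) : ℝ) : ℂ))) := by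
  have hum := H.measurable
  have hb := H.b_pos
  have hbt := H.b_lt_t
  have hC0 : 0 ≤ C := (norm_nonneg _).trans (hC 0)
  obtain ⟨Gb, δb, hδb, hb1, hb2, hb3⟩ := H.peak_b.exists_radius
  obtain ⟨Gt, δt, hδt, ht1, ht2, ht3⟩ := H.peak_t.exists_radius
  obtain ⟨δ, hδ, hδ1, hδ2, hδ3, hδ4⟩ : ∃ δ > 0, δ ≤ δb ∧ δ ≤ δt ∧ δ ≤ b / 2 ∧ δ ≤ (t - b) / 2 :=
    ⟨min (min δb δt) (min (b / 2) ((t - b) / 2)), by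
      simp only [gt_iff_lt, lt_min_iff]; refine ⟨⟨hδb, hδt⟩, by linarith, by linarith⟩,
      (min_le_left _ _).trans (min_le_left _ _), (min_le_left _ _).trans (min_le_right _ _),
      (min_le_right _ _).trans (min_le_left _ _), (min_le_right _ _).trans (min_le_right _ _)⟩
  set F : ℝ → ℂ := fun r => φ r * (((r ^ (2 * i + 1))⁻¹ : ℝ) : ℂ) with hFdef
  have hF : Measurable F := by fun_prop
  have hFcont : ∀ c, 0 < c → ContinuousAt φ c → ContinuousAt F c := fun c hc h =>
    h.mul (Complex.continuous_ofReal.continuousAt.comp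
      ((continuousAt_id.pow _).inv₀ (by simpa using hc.ne')))
  have hFC : ∀ c, b ≤ c → ∀ r, |r - c| < δ → ‖F r‖ ≤ C * ((b / 2) ^ (2 * i + 1))⁻¹ := by
    intro c hc r hr
    have : b / 2 ≤ r := by linarith [(abs_lt.1 hr).1]
    have hr0 : 0 < r := by linarith
    rw [hFdef, norm_mul, Complex.norm_real, Real.norm_of_nonneg (by positivity)]
    refine mul_le_mul (hC r) ?_ (by positivity) hC0
    gcongr
  have Lb := tendsto_laplace_local hum H.peak_b.1 hδ (fun x hx => hb1 x (hx.trans_le hδ1))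
    (fun x hx => hb2 x (hx.trans_le hδ1)) hb3 hF (hFcont b hb hφb) (hFC b le_rfl)
  have Lt := tendsto_laplace_local hum H.peak_t.1 hδ (fun x hx => ht1 x (hx.trans_le hδ2))
    (fun x hx => ht2 x (hx.trans_le hδ2)) ht3 hF (hFcont t (hb.trans hbt) hφt) (hFC t hbt.le)
  set Ib : Set ℝ := {r | |r - b| < δ} with hIb
  set It : Set ℝ := {r | |r - t| < δ} with hIt
  have mIb : MeasurableSet Ib := measurableSet_lt (by fun_prop) measurable_const
  have mIt : MeasurableSet It := measurableSet_lt (by fun_prop) measurable_const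
  set R : Set ℝ := Set.Ioi 0 \ (Ib ∪ It) with hR
  have mR : MeasurableSet R := measurableSet_Ioi.diff (mIb.union mIt)
  obtain ⟨η, hη0, hη1, hη⟩ := H.away δ hδ
  -- the contribution of the complement of the two peaks decays exponentially
  have Lr : Tendsto (fun n : ℕ => (√(n : ℝ) : ℂ) * ∫ r in R, F r * ((u r ^ n : ℝ) : ℂ)) atTop
      (𝓝 0) := by
    set K := ∫ r in Set.Ioi (0 : ℝ), (r ^ (2 * i + 1))⁻¹ * u r ^ (i + 1) with hK
    have hlim : Tendsto (fun n : ℕ => (√((n + (i + 1) : ℕ) : ℝ) * η ^ n) * (C * K)) atTop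
        (𝓝 0) := by
      have h1 : Tendsto (fun n : ℕ => ((n : ℝ) * η ^ n + (i + 1 : ℝ) * η ^ n)) atTop (𝓝 0) := by
        have := (tendsto_self_mul_const_pow_of_lt_one hη0 hη1).add
          ((tendsto_pow_atTop_nhds_zero_of_lt_one hη0 hη1).const_mul (i + 1 : ℝ))
        simpa using this
      have h2 : Tendsto (fun n : ℕ => √((n + (i + 1) : ℕ) : ℝ) * η ^ n) atTop (𝓝 0) := by
        refine squeeze_zero (fun n => by positivity) (fun n => ?_) h1
        rw [← add_mul]
        refine mul_le_mul_of_nonneg_right ?_ (by positivity)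
        rw [Real.sqrt_le_left (by positivity)]
        push_cast
        nlinarith [Nat.cast_nonneg (α := ℝ) n, Nat.cast_nonneg (α := ℝ) i]
      simpa using h2.mul_const (C * K)
    rw [← tendsto_add_atTop_iff_nat (i + 1)]
    refine squeeze_zero_norm (fun n => ?_) hlim
    rw [norm_mul, Complex.norm_real, Real.norm_of_nonneg (Real.sqrt_nonneg _), mul_assoc]
    refine mul_le_mul_of_nonneg_left ?_ (Real.sqrt_nonneg _)
    calc ‖∫ r in R, F r * ((u r ^ (n + (i + 1)) : ℝ) : ℂ)‖
        ≤ ∫ r in R, η ^ n * (C * ((r ^ (2 * i + 1))⁻¹ * u r ^ (i + 1))) := by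
          refine norm_integral_le_of_norm_le ((((H.integrable i).mono_set
            Set.sdiff_subset).const_mul C).const_mul _) ?_
          filter_upwards [ae_restrict_mem mR] with r hr
          have hr0 : (0 : ℝ) < r := hr.1
          have hr1 : u r ≤ η := hη r hr0 (not_lt.1 fun h => hr.2 (Or.inl h))
            (not_lt.1 fun h => hr.2 (Or.inr h))
          have h0 := H.nonneg r
          rw [hFdef, norm_mul, norm_mul, Complex.norm_real, Complex.norm_real,
            Real.norm_of_nonneg (by positivity), Real.norm_of_nonneg (by positivity), pow_add (u r)]
          calc ‖φ r‖ * (r ^ (2 * i + 1))⁻¹ * (u r ^ n * u r ^ (i + 1))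
              ≤ C * (r ^ (2 * i + 1))⁻¹ * (η ^ n * u r ^ (i + 1)) := by
                gcongr; exact hC r
            _ = _ := by ring
      _ ≤ ∫ r in Set.Ioi (0 : ℝ), η ^ n * (C * ((r ^ (2 * i + 1))⁻¹ * u r ^ (i + 1))) := by
          refine setIntegral_mono_set (((H.integrable i).const_mul C).const_mul _) ?_
            Set.sdiff_subset.eventuallyLE
          filter_upwards [ae_restrict_mem measurableSet_Ioi] with r hr
          have hr0 : (0 : ℝ) < r := hr
          have h0 := H.nonneg r
          simp only [Pi.zero_apply]
          positivity
      _ = η ^ n * (C * K) := by rw [integral_const_mul, integral_const_mul]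
  have hsplit : ∀ᶠ n : ℕ in atTop,
      (√(n : ℝ) : ℂ) * (∫ r in Ib, F r * ((u r ^ n : ℝ) : ℂ)) +
      (√(n : ℝ) : ℂ) * (∫ r in It, F r * ((u r ^ n : ℝ) : ℂ)) +
      (√(n : ℝ) : ℂ) * (∫ r in R, F r * ((u r ^ n : ℝ) : ℂ)) =
      (√(n : ℝ) : ℂ) * peakMoment u n i φ := by
    filter_upwards [eventually_gt_atTop i] with n hn
    have hint : IntegrableOn (fun r => F r * ((u r ^ n : ℝ) : ℂ)) (Set.Ioi 0) := by
      refine (H.integrableOn_mul hn hφ hC).congr_fun (fun r _ => ?_) measurableSet_Ioi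
      simp only [hFdef]; push_cast; ring
    have hM : peakMoment u n i φ = ∫ r in Set.Ioi (0 : ℝ), F r * ((u r ^ n : ℝ) : ℂ) := by
      refine setIntegral_congr_fun measurableSet_Ioi fun r _ => ?_
      simp only [hFdef]; push_cast; ring
    have sIb : Ib ⊆ Set.Ioi 0 := fun r hr => by
      have := (abs_lt.1 (show |r - b| < δ from hr)).1
      show 0 < r
      linarith
    have sIt : It ⊆ Set.Ioi 0 := fun r hr => by
      have := (abs_lt.1 (show |r - t| < δ from hr)).1
      show 0 < r
      linarith
    have hdisj : Disjoint Ib It := Set.disjoint_left.2 fun r h1 h2 => by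
      have h1' := (abs_lt.1 (show |r - b| < δ from h1)).2
      have h2' := (abs_lt.1 (show |r - t| < δ from h2)).1
      linarith
    have hU : Set.Ioi (0 : ℝ) = (Ib ∪ It) ∪ R := by
      rw [hR, Set.union_sdiff_cancel (Set.union_subset sIb sIt)]
    rw [← mul_add, ← mul_add, hM, hU,
      setIntegral_union Set.disjoint_sdiff_right mR
        (hint.mono_set (Set.union_subset sIb sIt)) (hint.mono_set Set.sdiff_subset),
      setIntegral_union hdisj mIt (hint.mono_set sIb) (hint.mono_set sIt)]
  have := ((Lb.add Lt).add Lr).congr' hsplit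
  simp only [add_zero, hFdef] at this
  convert this using 2
  push_cast
  ring

end IsTwoPeaked

/-! ### Subharmonic functions: competitors and the comparison principle -/

lemma erealIntegral_mono {X : Type*} [MeasurableSpace X] {μ : Measure X} {f g : X → EReal}
    (h : ∀ x, f x ≤ g x) : erealIntegral μ f ≤ erealIntegral μ g := by
  refine EReal.sub_le_sub ?_ ?_
  · exact_mod_cast lintegral_mono fun x => EReal.toENNReal_le_toENNReal (h x)
  · exact_mod_cast lintegral_mono fun x =>
      EReal.toENNReal_le_toENNReal (EReal.neg_le_neg_iff.2 (h x))

lemma erealIntegral_coe {X : Type*} [MeasurableSpace X] {μ : Measure X} {f : X → ℝ}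
    (hf : Integrable f μ) :
    erealIntegral μ (fun x => (f x : EReal)) = ((∫ x, f x ∂μ : ℝ) : EReal) := by
  have h1 : ∫⁻ x, ENNReal.ofReal (f x) ∂μ ≠ ∞ := hf.lintegral_lt_top.ne
  have h2 : ∫⁻ x, ENNReal.ofReal (-f x) ∂μ ≠ ∞ := hf.neg.lintegral_lt_top.ne
  rw [integral_eq_lintegral_pos_part_sub_lintegral_neg_part hf, erealIntegral]
  simp only [← EReal.coe_neg, EReal.real_coe_toENNReal]
  rw [EReal.coe_sub, EReal.coe_ennreal_toReal h1, EReal.coe_ennreal_toReal h2]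

lemma erealIntegral_circleMap {v : ℂ → ℝ} {z : ℂ} {r : ℝ} (hv : CircleIntegrable v z r) :
    erealIntegral (ENNReal.ofReal (2 * Real.pi)⁻¹ •
        volume.restrict (Set.Ioc 0 (2 * Real.pi))) (fun φ : ℝ => (v (circleMap z r φ) : EReal)) =
      ((Real.circleAverage v z r : ℝ) : EReal) := by
  have hi : IntegrableOn (fun φ => v (circleMap z r φ)) (Set.Ioc 0 (2 * Real.pi)) :=
    (intervalIntegrable_iff_integrableOn_Ioc_of_le Real.two_pi_pos.le).1 hv
  rw [erealIntegral_coe (hi.smul_measure ENNReal.ofReal_ne_top), integral_smul_measure,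
    Real.circleAverage_def, intervalIntegral.integral_of_le Real.two_pi_pos.le,
    ENNReal.toReal_ofReal (by positivity)]

/-- The competitors `c + α log⁺(|z| / r)`, truncations of `α log |z|` away from the origin. -/
def logCompetitor (α c r : ℝ) (z : ℂ) : ℝ := c + α * Real.posLog (‖z‖ / r)

lemma continuous_logCompetitor (α c r : ℝ) : Continuous (logCompetitor α c r) := by
  unfold logCompetitor; fun_prop

lemma log_div_le_logCompetitor {α c r : ℝ} (hα : 0 ≤ α) (z : ℂ) :
    c + α * Real.log (‖z‖ / r) ≤ logCompetitor α c r z := by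
  unfold logCompetitor
  gcongr
  exact le_max_right _ _

lemma logCompetitor_of_le {α c r : ℝ} (hr : 0 < r) {z : ℂ} (hz : r ≤ ‖z‖) :
    logCompetitor α c r z = c + α * Real.log (‖z‖ / r) := by
  rw [logCompetitor, Real.posLog_eq_log]
  rw [abs_of_nonneg (by positivity), one_le_div hr]
  exact hz

lemma logCompetitor_of_ge {α c r : ℝ} (hr : 0 < r) {z : ℂ} (hz : ‖z‖ ≤ r) :
    logCompetitor α c r z = c := by
  rw [logCompetitor, (Real.posLog_eq_zero_iff _).2, mul_zero, add_zero]
  rw [abs_of_nonneg (by positivity), div_le_one hr]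
  exact hz

lemma circleAverage_log_norm {z : ℂ} {ρ : ℝ} (hρ : 0 < ρ) :
    Real.circleAverage (fun w : ℂ => Real.log ‖w‖) z ρ =
      Real.log ρ + Real.posLog (ρ⁻¹ * ‖z‖) := by
  have := circleAverage_log_norm_sub_const_eq_log_radius_add_posLog (a := 0) (c := z) hρ.ne'
  simpa using this

lemma circleIntegrable_log_norm (z : ℂ) (ρ : ℝ) :
    CircleIntegrable (fun w : ℂ => Real.log ‖w‖) z ρ := by
  simpa using circleIntegrable_log_norm_sub_const (a := 0) (c := z) ρ

lemma logCompetitor_le_circleAverage {α c r : ℝ} (hα : 0 ≤ α) (hr : 0 < r) (z : ℂ) {ρ : ℝ}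
    (hρ : 0 < ρ) : logCompetitor α c r z ≤ Real.circleAverage (logCompetitor α c r) z ρ := by
  have hci : CircleIntegrable (logCompetitor α c r) z ρ :=
    (continuous_logCompetitor α c r).continuousOn.circleIntegrable hρ.le
  rcases le_total ‖z‖ r with hz | hz
  · calc logCompetitor α c r z = Real.circleAverage (fun _ => c) z ρ := by
          rw [logCompetitor_of_ge hr hz, Real.circleAverage_const]
      _ ≤ _ := Real.circleAverage_mono (circleIntegrable_const c z ρ) hci fun w _ =>
          le_add_of_nonneg_right (mul_nonneg hα Real.posLog_nonneg)
  · have hz0 : 0 < ‖z‖ := hr.trans_le hz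
    have hlog : (fun w : ℂ => Real.log (‖w‖ / r)) = fun w : ℂ => Real.log ‖w / (r : ℂ)‖ := by
      ext w
      rw [norm_div, Complex.norm_real, Real.norm_of_nonneg hr.le]
    have hli : CircleIntegrable (fun w : ℂ => Real.log (‖w‖ / r)) z ρ := by
      rw [hlog]
      exact MeromorphicOn.circleIntegrable_log_norm fun w _ => by fun_prop
    -- `log (|w| / r) = log |w| - log r` fails at the origin only, where `log 0 = 0`
    have hav : Real.circleAverage (fun w : ℂ => Real.log (‖w‖ / r)) z ρ =
        Real.log ρ + Real.posLog (ρ⁻¹ * ‖z‖) - Real.log r := by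
      rw [← circleAverage_log_norm hρ, ← Real.circleAverage_const (Real.log r) z ρ,
        ← Real.circleAverage_fun_sub (circleIntegrable_log_norm z ρ)
          (circleIntegrable_const _ z ρ)]
      refine Real.circleAverage_congr_codiscreteWithin ?_ hρ.ne'
      refine Filter.Eventually.filter_mono (codiscreteWithin_mono (Set.subset_univ _)) ?_
      filter_upwards [(Set.finite_singleton (0 : ℂ)).compl_mem_codiscrete] with w hw
      exact Real.log_div (norm_ne_zero_iff.2 hw) hr.ne'
    have h1 : logCompetitor α c r z ≤ Real.circleAverage
        (fun w : ℂ => c + α • Real.log (‖w‖ / r)) z ρ := by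
      rw [Real.circleAverage_fun_add (circleIntegrable_const _ z ρ) hli.const_fun_smul,
        Real.circleAverage_const, Real.circleAverage_fun_smul, hav, logCompetitor_of_le hr hz,
        Real.log_div hz0.ne' hr.ne', smul_eq_mul]
      have h2 : Real.log (ρ⁻¹ * ‖z‖) ≤ Real.posLog (ρ⁻¹ * ‖z‖) := le_max_right _ _
      rw [Real.log_mul (inv_ne_zero hρ.ne') hz0.ne', Real.log_inv] at h2
      nlinarith
    refine h1.trans (Real.circleAverage_mono ?_ hci fun w _ => log_div_le_logCompetitor hα w)
    exact (circleIntegrable_const _ z ρ).add hli.const_fun_smul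

lemma isSubharmonic_logCompetitor {α c r : ℝ} (hα : 0 ≤ α) (hr : 0 < r) :
    IsSubharmonic fun z => (logCompetitor α c r z : EReal) where
  ne_top _ := EReal.coe_ne_top _
  usc := (continuous_coe_real_ereal.comp (continuous_logCompetitor α c r)).upperSemicontinuous
  le_circleMean z ρ hρ := by
    rw [erealIntegral_circleMap ((continuous_logCompetitor α c r).continuousOn.circleIntegrable
      hρ.le)]
    exact_mod_cast logCompetitor_le_circleAverage hα hr z hρ

lemma logCompetitor_mem_obstacleClass {Q : ℂ → EReal} {α c r : ℝ} (hα : 0 ≤ α) (hα2 : α ≤ 2)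
    (hr : 0 < r) (hle : ∀ z, (logCompetitor α c r z : EReal) ≤ Q z) :
    (fun z => (logCompetitor α c r z : EReal)) ∈ obstacleClass Q := by
  refine ⟨isSubharmonic_logCompetitor hα hr, hle, c - α * Real.log r, ?_⟩
  filter_upwards [eventually_cobounded_le_norm (max 1 r)] with w hw
  have h1 : 1 ≤ ‖w‖ := (le_max_left _ _).trans hw
  have h2 : r ≤ ‖w‖ := (le_max_right _ _).trans hw
  rw [logCompetitor_of_le hr h2, Real.log_div (by positivity) hr.ne']
  have := Real.log_nonneg h1
  exact_mod_cast (by nlinarith)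

/-- A competitor which touches the potential does so on the coincidence set. -/
lemma mem_coincidenceSet_of_logCompetitor {Q : ℂ → EReal} {α c r : ℝ} (hα : 0 ≤ α) (hα2 : α ≤ 2)
    (hr : 0 < r) (hle : ∀ z, (logCompetitor α c r z : EReal) ≤ Q z) {z : ℂ}
    (hz : Q z = (logCompetitor α c r z : EReal)) : z ∈ coincidenceSet Q := by
  refine le_antisymm ?_ (iSup₂_le fun s hs => hs.2.1 z)
  rw [hz]
  exact le_iSup₂_of_le _ (logCompetitor_mem_obstacleClass hα hα2 hr hle) le_rfl

/-- Comparison principle: a subharmonic function on a compact set stays below a function which is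
strictly superharmonic at the points where the inequality is not assumed. -/
lemma IsSubharmonic.le_of_compact {s : ℂ → EReal} (hs : IsSubharmonic s) {K : Set ℂ}
    (hK : IsCompact K) {v : ℂ → ℝ} (hv : ContinuousOn v K)
    (h : ∀ z ∈ K, s z ≤ v z ∨ ∃ ρ > 0, Metric.sphere z ρ ⊆ K ∧ Real.circleAverage v z ρ < v z) :
    ∀ z ∈ K, s z ≤ v z := by
  by_contra! hne
  obtain ⟨z₀, hz₀, hlt⟩ := hne
  have husc : UpperSemicontinuousOn (fun z => s z + ((-v z : ℝ) : EReal)) K := by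
    refine UpperSemicontinuousOn.add' (hs.usc.upperSemicontinuousOn K)
      (ContinuousOn.upperSemicontinuousOn (continuous_coe_real_ereal.comp_continuousOn hv.neg))
      fun z _ => EReal.continuousAt_add (Or.inr (EReal.coe_ne_bot _)) (Or.inr (EReal.coe_ne_top _))
  obtain ⟨z₁, hz₁, hmax⟩ := husc.exists_isMaxOn ⟨z₀, hz₀⟩ hK
  have hreal : ∀ z, v z < s z → ∃ x : ℝ, s z = x := fun z hz => by
    induction hsz : s z with
    | bot => rw [hsz] at hz; exact absurd hz not_lt_bot
    | top => exact absurd hsz (hs.ne_top z)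
    | coe x => exact ⟨x, rfl⟩
  obtain ⟨x₀, hx₀⟩ := hreal z₀ hlt
  have hlt' : v z₀ < x₀ := by rw [hx₀] at hlt; exact_mod_cast hlt
  have hmax0 := hmax hz₀
  simp only [Set.mem_ofPred_eq] at hmax0
  have hlt1 : (v z₁ : EReal) < s z₁ := by
    by_contra hle
    rw [not_lt] at hle
    have : s z₁ + ((-v z₁ : ℝ) : EReal) ≤ 0 := by
      calc s z₁ + ((-v z₁ : ℝ) : EReal) ≤ v z₁ + ((-v z₁ : ℝ) : EReal) := by gcongr
        _ = 0 := by rw [← EReal.coe_add]; simp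
    have h0 := hmax0.trans this
    rw [hx₀, ← EReal.coe_add] at h0
    have : x₀ + -v z₀ ≤ 0 := by exact_mod_cast h0
    linarith
  obtain ⟨x₁, hx₁⟩ := hreal z₁ hlt1
  rcases h z₁ hz₁ with hle | ⟨ρ, hρ, hsub, hav⟩
  · exact absurd hlt1 (not_lt.2 hle)
  set M : ℝ := x₁ - v z₁ with hM
  have hle : ∀ z ∈ K, s z ≤ ((v z + M : ℝ) : EReal) := fun z hz => by
    have hmz := hmax hz
    simp only [Set.mem_ofPred_eq] at hmz
    rw [hx₁, ← EReal.coe_add] at hmz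
    induction hsz : s z with
    | bot => exact bot_le
    | top => exact absurd hsz (hs.ne_top z)
    | coe x =>
      rw [hsz, ← EReal.coe_add] at hmz
      have : x + -v z ≤ x₁ + -v z₁ := by exact_mod_cast hmz
      exact_mod_cast (by rw [hM]; linarith)
  have hcv : CircleIntegrable v z₁ ρ := (hv.mono hsub).circleIntegrable hρ.le
  have hmean := (hs.le_circleMean z₁ ρ hρ).trans (erealIntegral_mono fun φ =>
    hle _ (hsub (circleMap_mem_sphere z₁ hρ.le φ)))
  rw [erealIntegral_circleMap (v := fun z => v z + M) (hcv.add (circleIntegrable_const M z₁ ρ)),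
    Real.circleAverage_fun_add hcv (circleIntegrable_const M z₁ ρ), Real.circleAverage_const,
    hx₁] at hmean
  have : x₁ ≤ Real.circleAverage v z₁ ρ + M := by exact_mod_cast hmean
  linarith

lemma circleAverage_norm_sq (z : ℂ) (ρ : ℝ) :
    Real.circleAverage (fun w : ℂ => ‖w‖ ^ 2) z ρ = ‖z‖ ^ 2 + ρ ^ 2 := by
  have h : ∀ φ : ℝ, ‖circleMap z ρ φ‖ ^ 2 =
      (‖z‖ ^ 2 + ρ ^ 2) + (2 * ρ * z.re * Real.cos φ + 2 * ρ * z.im * Real.sin φ) := fun φ => by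
    have h1 : (circleMap z ρ φ).re = z.re + ρ * Real.cos φ := by
      simp [circleMap, Complex.exp_re]
    have h2 : (circleMap z ρ φ).im = z.im + ρ * Real.sin φ := by
      simp [circleMap, Complex.exp_im]
    rw [Complex.sq_norm, Complex.sq_norm, Complex.normSq_apply, Complex.normSq_apply, h1, h2]
    linear_combination ρ ^ 2 * Real.sin_sq_add_cos_sq φ
  rw [Real.circleAverage_def]
  simp only [h]
  rw [intervalIntegral.integral_add (by simp) (by apply Continuous.intervalIntegrable; fun_prop),
    intervalIntegral.integral_add (by apply Continuous.intervalIntegrable; fun_prop)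
      (by apply Continuous.intervalIntegrable; fun_prop)]
  simp
  field_simp

/-- The strictly superharmonic comparison function `A + α log |z| - δ |z|²`. -/
lemma circleAverage_comparison_lt {A α δ : ℝ} (hδ : 0 < δ) {z : ℂ} {ρ : ℝ} (hρ : 0 < ρ)
    (h : α = 0 ∨ ρ ≤ ‖z‖) :
    Real.circleAverage (fun w : ℂ => A + (α • Real.log ‖w‖ + (-δ) • ‖w‖ ^ 2)) z ρ <
      A + (α • Real.log ‖z‖ + (-δ) • ‖z‖ ^ 2) := by
  have hi2 : CircleIntegrable (fun w : ℂ => (-δ) • ‖w‖ ^ 2) z ρ := by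
    refine ContinuousOn.circleIntegrable hρ.le ?_
    fun_prop
  have hi1 : CircleIntegrable (fun w : ℂ => α • Real.log ‖w‖) z ρ :=
    (circleIntegrable_log_norm z ρ).const_fun_smul
  rw [Real.circleAverage_fun_add (circleIntegrable_const _ z ρ)
      (f₂ := fun w : ℂ => α • Real.log ‖w‖ + (-δ) • ‖w‖ ^ 2) (hi1.add hi2),
    Real.circleAverage_fun_add hi1 hi2, Real.circleAverage_const, Real.circleAverage_fun_smul,
    Real.circleAverage_fun_smul, circleAverage_norm_sq, circleAverage_log_norm hρ]
  have hl : α • (Real.log ρ + Real.posLog (ρ⁻¹ * ‖z‖)) = α • Real.log ‖z‖ := by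
    rcases h with rfl | h
    · simp
    · have hz : 0 < ‖z‖ := hρ.trans_le h
      rw [Real.posLog_eq_log, Real.log_mul (inv_ne_zero hρ.ne') hz.ne', Real.log_inv]
      · simp
      · rw [abs_of_nonneg (by positivity), inv_mul_eq_div, one_le_div hρ]; exact h
  rw [hl, smul_eq_mul (-δ), smul_eq_mul (-δ)]
  have : 0 < δ * ρ ^ 2 := by positivity
  linarith

/-- Maximum principle inside a disk. -/
lemma IsSubharmonic.le_of_le_circle {s : ℂ → EReal} (hs : IsSubharmonic s) {r B : ℝ} (hr : 0 < r)
    (hB : ∀ z : ℂ, ‖z‖ = r → s z ≤ (B : EReal)) {z : ℂ} (hz : ‖z‖ ≤ r) : s z ≤ (B : EReal) := by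
  refine EReal.le_of_forall_lt_iff_le.1 fun x hx => ?_
  have hx' : B < x := by exact_mod_cast hx
  set ε := x - B with hε
  have hε0 : 0 < ε := by linarith
  have key := hs.le_of_compact (K := Metric.closedBall 0 r) (isCompact_closedBall 0 r)
    (v := fun w : ℂ => (B + ε) + ((0 : ℝ) • Real.log ‖w‖ + (-(ε / r ^ 2)) • ‖w‖ ^ 2))
    (by simp only [zero_smul]; fun_prop) (fun w hw => ?_) z (by simpa using hz)
  · refine key.trans ?_
    have : 0 ≤ ε / r ^ 2 * ‖z‖ ^ 2 := by positivity
    have h2 : (B + ε) + ((0 : ℝ) • Real.log ‖z‖ + (-(ε / r ^ 2)) • ‖z‖ ^ 2) ≤ x := by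
      simp only [smul_eq_mul]; linarith
    exact_mod_cast h2
  · have hw' : ‖w‖ ≤ r := by simpa using hw
    rcases hw'.eq_or_lt with hw1 | hw1
    · left
      refine (hB w hw1).trans ?_
      have : B ≤ (B + ε) + ((0 : ℝ) • Real.log ‖w‖ + (-(ε / r ^ 2)) • ‖w‖ ^ 2) := by
        rw [hw1, zero_smul, smul_eq_mul]
        have : ε / r ^ 2 * r ^ 2 = ε := by field_simp
        linarith
      exact_mod_cast this
    · right
      refine ⟨r - ‖w‖, by linarith, fun y hy => ?_,
        circleAverage_comparison_lt (by positivity) (by linarith) (Or.inl rfl)⟩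
      rw [mem_sphere_iff_norm] at hy
      rw [mem_closedBall_zero_iff]
      calc ‖y‖ = ‖(y - w) + w‖ := by simp
        _ ≤ ‖y - w‖ + ‖w‖ := norm_add_le _ _
        _ = r := by rw [hy]; ring

/-- Maximum principle outside a disk, for functions of growth `2 log |z| + O(1)`. -/
lemma IsSubharmonic.le_log_of_le_circle {s : ℂ → EReal} (hs : IsSubharmonic s) {r B C : ℝ}
    (hr : 0 < r) (hB : ∀ z : ℂ, ‖z‖ = r → s z ≤ (B : EReal))
    (hC : ∀ᶠ w in Bornology.cobounded ℂ, s w ≤ ((2 * Real.log ‖w‖ + C : ℝ) : EReal))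
    {z : ℂ} (hz : r ≤ ‖z‖) : s z ≤ ((B + 2 * Real.log (‖z‖ / r) : ℝ) : EReal) := by
  refine EReal.le_of_forall_lt_iff_le.1 fun x hx => ?_
  have hx' : B + 2 * Real.log (‖z‖ / r) < x := by exact_mod_cast hx
  have hlz : 0 ≤ Real.log (‖z‖ / r) := Real.log_nonneg ((one_le_div hr).2 hz)
  set ε := (x - (B + 2 * Real.log (‖z‖ / r))) / (1 + Real.log (‖z‖ / r)) with hε
  have hε0 : 0 < ε := div_pos (by linarith) (by linarith)
  have hεx : ε * (1 + Real.log (‖z‖ / r)) = x - (B + 2 * Real.log (‖z‖ / r)) :=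
    div_mul_cancel₀ _ (by linarith)
  obtain ⟨R₀, -, hR₀⟩ := (hasBasis_cobounded_norm (E := ℂ)).eventually_iff.1 hC
  have hR₁ : ∀ᶠ R : ℝ in atTop, 2 * Real.log R + C ≤
      B + (2 + ε) * (Real.log R - Real.log r) := by
    have := (Real.tendsto_log_atTop.const_mul_atTop hε0).eventually_ge_atTop
      (C - B + (2 + ε) * Real.log r)
    filter_upwards [this] with R hR
    nlinarith
  obtain ⟨R, hR1, hR2, hR3, hR4⟩ := (hR₁.and ((eventually_ge_atTop R₀).and
    ((eventually_ge_atTop ‖z‖).and (eventually_gt_atTop r)))).exists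
  have hR0 : 0 < R := hr.trans hR4
  have hK : IsCompact (Metric.closedBall (0 : ℂ) R ∩ {w : ℂ | r ≤ ‖w‖}) :=
    (isCompact_closedBall 0 R).inter_right (isClosed_le continuous_const continuous_norm)
  have key := hs.le_of_compact hK
    (v := fun w : ℂ => (B + ε - (2 + ε) * Real.log r) +
      ((2 + ε) • Real.log ‖w‖ + (-(ε / R ^ 2)) • ‖w‖ ^ 2)) ?_ (fun w hw => ?_) z
    ⟨by simpa using hR3, hz⟩
  · refine key.trans ?_
    have h1 : 0 ≤ ε / R ^ 2 * ‖z‖ ^ 2 := by positivity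
    have h2 : (B + ε - (2 + ε) * Real.log r) +
        ((2 + ε) • Real.log ‖z‖ + (-(ε / R ^ 2)) • ‖z‖ ^ 2) ≤ x := by
      simp only [smul_eq_mul]
      rw [Real.log_div (hr.trans_le hz).ne' hr.ne'] at hεx
      nlinarith
    exact_mod_cast h2
  · refine ContinuousOn.add continuousOn_const (ContinuousOn.add ?_ (by fun_prop))
    refine ContinuousOn.const_smul ?_ (2 + ε)
    exact ContinuousOn.log (by fun_prop) fun w hw => (hr.trans_le hw.2).ne'
  · have hw1 : ‖w‖ ≤ R := by simpa using hw.1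
    have hw2 : r ≤ ‖w‖ := hw.2
    have hw0 : 0 < ‖w‖ := hr.trans_le hw2
    have hq : ε / R ^ 2 * ‖w‖ ^ 2 ≤ ε := by
      rw [div_mul_eq_mul_div, div_le_iff₀ (by positivity)]
      gcongr
    rcases hw2.eq_or_lt with hw3 | hw3
    · left
      refine (hB w hw3.symm).trans ?_
      have : B ≤ (B + ε - (2 + ε) * Real.log r) +
          ((2 + ε) • Real.log ‖w‖ + (-(ε / R ^ 2)) • ‖w‖ ^ 2) := by
        simp only [smul_eq_mul]
        rw [hw3]
        linarith
      exact_mod_cast this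
    rcases hw1.eq_or_lt with hw4 | hw4
    · left
      refine (hR₀ (show R₀ ≤ ‖w‖ by rw [hw4]; exact hR2)).trans ?_
      have : 2 * Real.log ‖w‖ + C ≤ (B + ε - (2 + ε) * Real.log r) +
          ((2 + ε) • Real.log ‖w‖ + (-(ε / R ^ 2)) • ‖w‖ ^ 2) := by
        simp only [smul_eq_mul]
        rw [hw4] at hq ⊢
        linarith
      exact_mod_cast this
    · right
      refine ⟨min (R - ‖w‖) (‖w‖ - r), lt_min (by linarith) (by linarith), fun y hy => ?_,
        circleAverage_comparison_lt (by positivity) (lt_min (by linarith) (by linarith))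
          (Or.inr ((min_le_right _ _).trans (by linarith)))⟩
      rw [mem_sphere_iff_norm] at hy
      have h1 : ‖y - w‖ ≤ R - ‖w‖ := hy ▸ min_le_left _ _
      have h2 : ‖y - w‖ ≤ ‖w‖ - r := hy ▸ min_le_right _ _
      have h3 : ‖y‖ ≤ ‖y - w‖ + ‖w‖ := by simpa using norm_add_le (y - w) w
      have h4 : ‖w‖ ≤ ‖y - w‖ + ‖y‖ := by
        have := norm_sub_le y (y - w)
        simp only [sub_sub_cancel] at this
        linarith
      refine ⟨?_, ?_⟩
      · rw [mem_closedBall_zero_iff]; linarith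
      · show r ≤ ‖y‖
        linarith

/-! ### The quadratic behaviour of a radial function at a minimum -/

lemma tendsto_div_sq_of_fderiv_eq_zero {f : ℂ → ℝ} {x : ℂ} (hf : ContDiffAt ℝ 2 f x)
    (h0 : f x = 0) (h1 : fderiv ℝ f x = 0) (e : ℂ) :
    Tendsto (fun u : ℝ => f (x + u * e) / u ^ 2) (𝓝[≠] 0)
      (𝓝 (iteratedFDeriv ℝ 2 f x ![e, e] / 2)) := by
  have hline : ∀ u : ℝ, HasDerivAt (fun u : ℝ => x + u * e) e u := fun u => by
    have := ((hasDerivAt_id u).ofReal_comp.mul_const e).const_add x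
    simpa using this
  have hcont : Tendsto (fun u : ℝ => x + u * e) (𝓝 0) (𝓝 x) := by
    have := (hline 0).continuousAt.tendsto
    simpa using this
  have hdiff : ∀ᶠ y in 𝓝 x, DifferentiableAt ℝ f y := by
    filter_upwards [hf.eventually (by simp)] with y hy using hy.differentiableAt (by simp)
  have hder : ∀ᶠ u : ℝ in 𝓝 0,
      HasDerivAt (fun u : ℝ => f (x + u * e)) (fderiv ℝ f (x + u * e) e) u := by
    filter_upwards [hcont.eventually hdiff] with u hu
    exact hu.hasFDerivAt.comp_hasDerivAt u (hline u)
  have hf' : DifferentiableAt ℝ (fderiv ℝ f) x :=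
    (hf.fderiv_right (m := 1) (by norm_num)).differentiableAt (by simp)
  have hx : x = x + ((0 : ℝ) : ℂ) * e := by simp
  have hd2 : HasDerivAt (fun u : ℝ => fderiv ℝ f (x + u * e) e)
      (fderiv ℝ (fderiv ℝ f) x e e) 0 := by
    have h2 : HasFDerivAt (fderiv ℝ f) (fderiv ℝ (fderiv ℝ f) x) (x + ((0 : ℝ) : ℂ) * e) :=
      hx ▸ hf'.hasFDerivAt
    have h3 : HasDerivAt (fun u : ℝ => fderiv ℝ f (x + u * e)) (fderiv ℝ (fderiv ℝ f) x e) 0 :=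
      h2.comp_hasDerivAt (0 : ℝ) (hline 0)
    simpa using h3.clm_apply (hasDerivAt_const (0 : ℝ) e)
  rw [iteratedFDeriv_two_apply]
  refine HasDerivAt.lhopital_zero_nhdsNE (f' := fun u : ℝ => fderiv ℝ f (x + u * e) e)
    (g' := fun u : ℝ => 2 * u) (eventually_nhdsWithin_of_eventually_nhds hder)
    (Eventually.of_forall fun u => by simpa using hasDerivAt_pow 2 u) ?_ ?_ ?_ ?_
  · filter_upwards [self_mem_nhdsWithin] with u hu
    exact mul_ne_zero two_ne_zero hu
  · have := (hf.continuousAt.tendsto.comp hcont).mono_left (nhdsWithin_le_nhds (s := {0}ᶜ))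
    rwa [h0] at this
  · have : Tendsto (fun u : ℝ => u ^ 2) (𝓝 0) (𝓝 (0 ^ 2)) := (continuous_pow 2).tendsto 0
    rw [zero_pow two_ne_zero] at this
    exact this.mono_left nhdsWithin_le_nhds
  · have h3 := (hasDerivAt_iff_tendsto_slope.1 hd2).div_const 2
    refine h3.congr' ?_
    filter_upwards [self_mem_nhdsWithin] with u hu
    have hu' : u ≠ 0 := hu
    rw [slope_def_field, ← hx, h1]
    simp only [zero_apply, sub_zero]
    field_simp

/-- At a zero minimum of a radial function the tangential second derivative vanishes, so that the
radial one is the full Laplacian. -/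
lemma tendsto_div_sq_of_radial {g : ℂ → ℝ} {c : ℝ} (hc : 0 < c) (hg : ContDiffAt ℝ 2 g (c : ℂ))
    (hrad : ∀ z, g z = g (‖z‖ : ℂ)) (h0 : g (c : ℂ) = 0) (hmin : ∀ᶠ z in 𝓝 (c : ℂ), 0 ≤ g z) :
    Tendsto (fun u : ℝ => g ((c + u : ℝ) : ℂ) / u ^ 2) (𝓝[≠] 0)
      (𝓝 (Laplacian.laplacian g (c : ℂ) / 2)) := by
  have h1 : fderiv ℝ g (c : ℂ) = 0 := IsLocalMin.fderiv_eq_zero (by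
    filter_upwards [hmin] with z hz
    rwa [h0])
  have hx := tendsto_div_sq_of_fderiv_eq_zero hg h0 h1 1
  have hy := tendsto_div_sq_of_fderiv_eq_zero hg h0 h1 Complex.I
  have hx' : Tendsto (fun u : ℝ => g ((c + u : ℝ) : ℂ) / u ^ 2) (𝓝[≠] 0)
      (𝓝 (iteratedFDeriv ℝ 2 g (c : ℂ) ![1, 1] / 2)) := by
    refine hx.congr fun u => ?_
    push_cast
    rw [mul_one]
  -- moving by `u` in the tangential direction changes the modulus by `ξ u = O(u²)`
  set ξ : ℝ → ℝ := fun u => √(c ^ 2 + u ^ 2) - c with hξ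
  have hξ0 : Tendsto ξ (𝓝 0) (𝓝 0) := by
    have : Continuous ξ := by fun_prop
    have h2 := this.tendsto 0
    have h3 : ξ 0 = 0 := by simp [hξ, Real.sqrt_sq hc.le]
    rwa [h3] at h2
  have hden : ∀ u, 0 < √(c ^ 2 + u ^ 2) + c := fun u => by positivity
  have hξmul : ∀ u, ξ u * (√(c ^ 2 + u ^ 2) + c) = u ^ 2 := fun u => by
    have := Real.sq_sqrt (show 0 ≤ c ^ 2 + u ^ 2 by positivity)
    simp only [hξ]
    linear_combination this
  have hξne : ∀ u, u ≠ 0 → ξ u ≠ 0 := fun u hu h => by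
    have h4 := hξmul u
    rw [h, zero_mul] at h4
    exact hu (pow_eq_zero_iff two_ne_zero |>.1 h4.symm)
  have hξ' : Tendsto ξ (𝓝[≠] 0) (𝓝[≠] 0) := by
    refine tendsto_nhdsWithin_iff.2 ⟨hξ0.mono_left nhdsWithin_le_nhds, ?_⟩
    filter_upwards [self_mem_nhdsWithin] with u hu using hξne u hu
  have hquot : Tendsto (fun u => ξ u ^ 2 / u ^ 2) (𝓝[≠] 0) (𝓝 0) := by
    have hq : Tendsto (fun u => ξ u / (√(c ^ 2 + u ^ 2) + c)) (𝓝[≠] 0) (𝓝 0) := by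
      have hcd : Tendsto (fun u : ℝ => √(c ^ 2 + u ^ 2) + c) (𝓝 0) (𝓝 (√(c ^ 2 + 0 ^ 2) + c)) :=
        Continuous.tendsto (by fun_prop) 0
      have := (hξ0.div hcd (hden 0).ne').mono_left (nhdsWithin_le_nhds (s := {0}ᶜ))
      simpa [Pi.div_def] using this
    refine hq.congr' ?_
    filter_upwards [self_mem_nhdsWithin] with u hu
    rw [div_eq_div_iff (hden u).ne' (pow_ne_zero 2 hu)]
    linear_combination -(ξ u) * hξmul u
  have hy' : Tendsto (fun u : ℝ => g ((c : ℂ) + u * Complex.I) / u ^ 2) (𝓝[≠] 0) (𝓝 0) := by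
    have hmul := (hx'.comp hξ').mul hquot
    rw [mul_zero] at hmul
    refine hmul.congr' ?_
    filter_upwards [self_mem_nhdsWithin] with u hu
    have hn : ‖(c : ℂ) + u * Complex.I‖ = c + ξ u := by
      rw [Complex.norm_add_mul_I, hξ]; ring
    have := hξne u hu
    rw [hrad ((c : ℂ) + u * Complex.I), hn]
    simp only [Function.comp_apply]
    field_simp
  have hI : iteratedFDeriv ℝ 2 g (c : ℂ) ![Complex.I, Complex.I] = 0 := by
    have := tendsto_nhds_unique hy hy'
    linarith
  rw [InnerProductSpace.laplacian_eq_iteratedFDeriv_complexPlane]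
  simp only [hI, add_zero]
  exact hx'

lemma contDiffAt_log_norm {z : ℂ} (hz : z ≠ 0) :
    ContDiffAt ℝ 2 (fun w : ℂ => Real.log ‖w‖) z :=
  ((analyticAt_id (𝕜 := ℂ)).harmonicAt_log_norm hz).1

lemma laplacian_log_norm {z : ℂ} (hz : z ≠ 0) :
    Laplacian.laplacian (fun w : ℂ => Real.log ‖w‖) z = 0 :=
  ((analyticAt_id (𝕜 := ℂ)).harmonicAt_log_norm hz).2.self_of_nhds

/-- `u(r) = e^m r² e^{-Q(r)}`, the weight relative to the obstacle `m + 2 log r`. -/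
def relativeWeight (Q : ℂ → EReal) (m : ℝ) (r : ℝ) : ℝ := Real.exp m * r ^ 2 * weight Q (r : ℂ)

lemma weight_of_eq_coe {Q : ℂ → EReal} {z : ℂ} {x : ℝ} (h : Q z = x) :
    weight Q z = Real.exp (-x) := by
  rw [weight, h, ← EReal.coe_neg, EReal.exp_coe, ENNReal.toReal_ofReal (Real.exp_pos _).le]

/-- A contact point of the smooth potential with `m + 2 log r` is a Gaussian peak of curvature
`4 ΔQ` of the relative weight. -/
lemma hasGaussianPeak_relativeWeight {Q : ℂ → EReal} (hrad : ∀ z, Q z = Q (‖z‖ : ℂ))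
    (hbot : ∀ z, Q z ≠ ⊥) {c m : ℝ} (hc : 0 < c)
    (htop : ∀ᶠ z in 𝓝 (c : ℂ), Q z ≠ ⊤)
    (hsm : ContDiffAt ℝ 2 (fun z => (Q z).toReal) (c : ℂ)) (hΔ : 0 < quarterLaplacian Q (c : ℂ))
    (hmin : ∀ z : ℂ, z ≠ 0 → ((m + 2 * Real.log ‖z‖ : ℝ) : EReal) ≤ Q z)
    (hcon : Q (c : ℂ) = ((m + 2 * Real.log c : ℝ) : EReal)) :
    HasGaussianPeak (relativeWeight Q m) c (4 * quarterLaplacian Q (c : ℂ)) := by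
  have hc0 : (c : ℂ) ≠ 0 := by exact_mod_cast hc.ne'
  set L : ℂ → ℝ := (2 : ℝ) • (fun w : ℂ => Real.log ‖w‖) with hL
  set M : ℂ → ℝ := fun _ => m with hM
  set g : ℂ → ℝ := (fun z => (Q z).toReal) - (L + M) with hg
  have hl : ContDiffAt ℝ 2 L (c : ℂ) := contDiffAt_const.smul (contDiffAt_log_norm hc0)
  have hM2 : ContDiffAt ℝ 2 M (c : ℂ) := contDiffAt_const
  have hgz : ∀ z, g z = (Q z).toReal - (2 * Real.log ‖z‖ + m) := fun z => rfl
  have hlap : Laplacian.laplacian g (c : ℂ) = 4 * quarterLaplacian Q (c : ℂ) := by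
    rw [hg, hsm.laplacian_sub (f₂ := L + M) (hl.add hM2), hl.laplacian_add hM2, hL, hM,
      InnerProductSpace.laplacian_smul _ (contDiffAt_log_norm hc0), laplacian_log_norm hc0,
      InnerProductSpace.laplacian_const, quarterLaplacian]
    simp
  have hgd : ContDiffAt ℝ 2 g (c : ℂ) := hsm.sub (hl.add hM2)
  have hgrad : ∀ z, g z = g (‖z‖ : ℂ) := fun z => by
    simp only [hgz, ← hrad, Complex.norm_real, norm_norm]
  have hg0 : g (c : ℂ) = 0 := by
    rw [hgz, hcon, EReal.toReal_coe, Complex.norm_real, Real.norm_of_nonneg hc.le]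
    ring
  have hgmin : ∀ᶠ z in 𝓝 (c : ℂ), 0 ≤ g z := by
    filter_upwards [htop, isOpen_ne.mem_nhds hc0] with z hz hz0
    have h1 := hmin z hz0
    rw [← EReal.coe_toReal hz (hbot z)] at h1
    have h2 : m + 2 * Real.log ‖z‖ ≤ (Q z).toReal := by exact_mod_cast h1
    rw [hgz]
    linarith
  refine ⟨by linarith, fun x => g ((c + x : ℝ) : ℂ), ?_, hlap ▸
    tendsto_div_sq_of_radial hc hgd hgrad hg0 hgmin⟩
  have hcx : Tendsto (fun x : ℝ => ((c + x : ℝ) : ℂ)) (𝓝 0) (𝓝 (c : ℂ)) := by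
    have : Continuous fun x : ℝ => ((c + x : ℝ) : ℂ) := by fun_prop
    simpa using this.tendsto 0
  filter_upwards [hcx.eventually htop, lt_mem_nhds (neg_lt_zero.2 hc)] with x hx hx0
  have hpos : 0 < c + x := by linarith
  have h1 : 2 * Real.log (c + x) = Real.log ((c + x) ^ 2) := by rw [Real.log_pow]; norm_num
  rw [relativeWeight, weight_of_eq_coe (EReal.coe_toReal hx (hbot _)).symm]
  rw [hgz, Complex.norm_real, Real.norm_of_nonneg hpos.le, h1, neg_sub, Real.exp_sub, Real.exp_add, Real.exp_log (by positivity), Real.exp_neg]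
  ring

/-! ### Lower bounds for external potentials -/

section Potential

variable {Q : ℂ → EReal} (hQ : IsExternalPotential Q)
include hQ

namespace IsExternalPotential

lemma exists_growth : ∃ β : ℝ, 2 < β ∧ ∃ R : ℝ, 1 ≤ R ∧
    ∀ z : ℂ, R ≤ ‖z‖ → ((β * Real.log ‖z‖ : ℝ) : EReal) ≤ Q z := by
  obtain ⟨β, hβ1, hβ2⟩ := EReal.lt_iff_exists_real_btwn.1 hQ.confining
  have h2 : (2 : ℝ) < β := EReal.coe_lt_coe_iff.1 (show ((2 : ℝ) : EReal) < β from hβ1)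
  obtain ⟨R, -, hR⟩ := (hasBasis_cobounded_norm (E := ℂ)).eventually_iff.1
    (eventually_lt_of_lt_liminf hβ2)
  refine ⟨β, h2, max R 2, le_max_of_le_right (by norm_num), fun z hz => ?_⟩
  have h3 := hR (show R ≤ ‖z‖ from (le_max_left _ _).trans hz)
  have hz2 : (2 : ℝ) ≤ ‖z‖ := (le_max_right _ _).trans hz
  have hlog : 0 < Real.log ‖z‖ := Real.log_pos (by linarith)
  rw [EReal.lt_div_iff (by exact_mod_cast hlog) (EReal.coe_ne_top _)] at h3
  rw [EReal.coe_mul]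
  exact h3.le

lemma exists_lower_bound : ∃ A : ℝ, ∀ z, (A : EReal) ≤ Q z := by
  obtain ⟨β, hβ, R, hR1, hR⟩ := hQ.exists_growth
  obtain ⟨z₀, -, hz₀⟩ := (hQ.lsc.lowerSemicontinuousOn _).exists_isMinOn
    (s := Metric.closedBall (0 : ℂ) R) ⟨0, by simpa using (by linarith : 0 ≤ R)⟩
    (isCompact_closedBall 0 R)
  obtain ⟨A, hA⟩ : ∃ A : ℝ, (A : EReal) ≤ Q z₀ :=
    (EReal.lt_iff_exists_real_btwn.1 (bot_lt_iff_ne_bot.2 (hQ.ne_bot z₀))).imp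
      fun A h => h.2.le
  refine ⟨min A 0, fun z => ?_⟩
  rcases le_total ‖z‖ R with hz | hz
  · have h1 : Q z₀ ≤ Q z := hz₀ (by simpa using hz)
    exact (EReal.coe_le_coe_iff.2 (min_le_left A 0)).trans (hA.trans h1)
  · refine le_trans (EReal.coe_le_coe_iff.2 ((min_le_right A 0).trans ?_)) (hR z hz)
    have := Real.log_nonneg (hR1.trans hz)
    positivity

/-- For every slope `α ≤ 2` the largest competitor `c + α log⁺(|z| / r)` below `Q` touches
`Q`. -/
lemma exists_touching {α r : ℝ} (hα2 : α ≤ 2) (hr : 0 < r) {w : ℂ} (hw : Q w ≠ ⊤) :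
    ∃ c : ℝ, ∃ z₀ : ℂ, (∀ z, (logCompetitor α c r z : EReal) ≤ Q z) ∧
      Q z₀ = (logCompetitor α c r z₀ : EReal) := by
  obtain ⟨β, hβ, R, hR1, hR⟩ := hQ.exists_growth
  set ℓ : ℂ → ℝ := fun z => α * Real.posLog (‖z‖ / r) with hℓ
  have hℓc : Continuous ℓ := by fun_prop
  set f : ℂ → EReal := fun z => Q z + ((-ℓ z : ℝ) : EReal) with hf
  have hflsc : LowerSemicontinuous f := hQ.lsc.add'
    (continuous_coe_real_ereal.comp hℓc.neg).lowerSemicontinuous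
    fun z => EReal.continuousAt_add (Or.inr (EReal.coe_ne_bot _)) (Or.inr (EReal.coe_ne_top _))
  set y : ℝ := (Q w).toReal - ℓ w with hy
  have hfw : f w = (y : EReal) := by
    rw [hf, hy]
    simp only
    rw [← EReal.coe_toReal hw (hQ.ne_bot w), ← EReal.coe_add, EReal.toReal_coe, sub_eq_add_neg]
  -- far away `f` exceeds its value at `w`
  have hfar : ∀ᶠ x : ℝ in atTop, y ≤ (β - 2) * Real.log x + 2 * min (Real.log r) 0 := by
    have := (Real.tendsto_log_atTop.const_mul_atTop (sub_pos.2 hβ)).eventually_ge_atTop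
      (y - 2 * min (Real.log r) 0)
    filter_upwards [this] with x hx
    linarith
  obtain ⟨R', hR'⟩ := eventually_atTop.1 hfar
  set ρ := max (max R' R) (max r ‖w‖) with hρ
  have hout : ∀ z : ℂ, ρ ≤ ‖z‖ → f w ≤ f z := fun z hz => by
    have h1 : R' ≤ ‖z‖ := (le_max_left _ _).trans ((le_max_left _ _).trans hz)
    have h2 : R ≤ ‖z‖ := (le_max_right _ _).trans ((le_max_left _ _).trans hz)
    have h3 : r ≤ ‖z‖ := (le_max_left _ _).trans ((le_max_right _ _).trans hz)
    have hz1 : 1 ≤ ‖z‖ := hR1.trans h2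
    have hlz : 0 ≤ Real.log ‖z‖ := Real.log_nonneg hz1
    have hlr : ℓ z ≤ 2 * Real.log ‖z‖ - 2 * min (Real.log r) 0 := by
      simp only [hℓ]
      rw [Real.posLog_eq_log (by
        rw [abs_of_nonneg (by positivity), one_le_div hr]; exact h3),
        Real.log_div (by linarith) hr.ne']
      have h4 := Real.log_le_log hr h3
      have h5 := min_le_left (Real.log r) 0
      nlinarith
    calc f w = (y : EReal) := hfw
      _ ≤ ((β * Real.log ‖z‖ : ℝ) : EReal) + ((-ℓ z : ℝ) : EReal) := by
          rw [← EReal.coe_add, EReal.coe_le_coe_iff]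
          have := hR' _ h1
          linarith
      _ ≤ f z := by
          simp only [hf]
          gcongr
          exact hR z h2
  have hwK : w ∈ Metric.closedBall (0 : ℂ) ρ := by
    rw [mem_closedBall_zero_iff]; exact (le_max_right _ _).trans (le_max_right _ _)
  obtain ⟨z₀, -, hz₀⟩ := (hflsc.lowerSemicontinuousOn _).exists_isMinOn ⟨w, hwK⟩
    (isCompact_closedBall (0 : ℂ) ρ)
  have hmin : ∀ z, f z₀ ≤ f z := fun z => by
    rcases le_total ‖z‖ ρ with h | h
    · exact hz₀ (by simpa using h)
    · exact (hz₀ hwK : f z₀ ≤ f w).trans (hout z h)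
  have hcancel : ∀ z (c : ℝ), ((c : EReal) ≤ f z ↔ ((c + ℓ z : ℝ) : EReal) ≤ Q z) := fun z c => by
    simp only [hf]
    induction hz : Q z with
    | bot => exact absurd hz (hQ.ne_bot z)
    | top => simp
    | coe x =>
      rw [← EReal.coe_add, EReal.coe_le_coe_iff, EReal.coe_le_coe_iff]
      constructor <;> intro h <;> linarith
  have hz₀top : Q z₀ ≠ ⊤ := fun htop => by
    have h1 := hmin w
    rw [hfw] at h1
    simp only [hf, htop] at h1
    rw [EReal.top_add_coe] at h1
    exact absurd h1 (by simp)
  obtain ⟨x, hx⟩ : ∃ x : ℝ, Q z₀ = x := ⟨_, (EReal.coe_toReal hz₀top (hQ.ne_bot z₀)).symm⟩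
  refine ⟨x - ℓ z₀, z₀, fun z => ?_, ?_⟩
  · have h1 := hmin z
    have h2 : f z₀ = ((x - ℓ z₀ : ℝ) : EReal) := by
      simp only [hf, hx]; rw [← EReal.coe_add, sub_eq_add_neg]
    rw [h2, hcancel] at h1
    exact h1
  · rw [hx]
    simp [logCompetitor, hℓ]

end IsExternalPotential

/-! ### The obstacle problem for a droplet with an outpost -/

/-- Outside a circle the obstacle function grows at most like `2 log |z|`. -/
lemma obstacleFunction_le_log {r q : ℝ} (hr : 0 < r) (hq : Q (r : ℂ) = (q : EReal)) {z : ℂ}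
    (hz : r ≤ ‖z‖) : obstacleFunction Q z ≤ ((q + 2 * Real.log (‖z‖ / r) : ℝ) : EReal) := by
  refine iSup₂_le fun s hs => ?_
  obtain ⟨hsub, hle, C, hC⟩ := hs
  refine hsub.le_log_of_le_circle hr (fun w hw => ?_) hC hz
  rw [← hq, ← hw, ← hQ.radial]
  exact hle w

/-- Inside a circle the obstacle function does not exceed the value of the potential on it. -/
lemma obstacleFunction_le_of_norm_le {r q : ℝ} (hr : 0 < r) (hq : Q (r : ℂ) = (q : EReal)) {z : ℂ}
    (hz : ‖z‖ ≤ r) : obstacleFunction Q z ≤ (q : EReal) := by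
  refine iSup₂_le fun s hs => ?_
  refine hs.1.le_of_le_circle hr (fun w hw => ?_) hz
  rw [← hq, ← hw, ← hQ.radial]
  exact hs.2.1 w

variable {a b t : ℝ} (ha : 0 ≤ a) (hab : a < b) (hbt : b < t)
  (hS : coincidenceSet Q = closedAnnulus a b ∪ {z : ℂ | ‖z‖ = t})
  (hreg : IsRegularNear Q (coincidenceSet Q))

include ha hab hbt hS hreg

/-- The obstacle function equals `m + 2 log |z|` outside the droplet, so the potential has the
global minorant `m + 2 log |z|`, with contact at `|z| = b` and `|z| = t`. Contact at `b` comes from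
letting the slope `α` of touching competitors increase to `2`: since `Q` is differentiable at `t`, a
competitor of slope `α < 2` cannot touch there, hence touches on the droplet. -/
lemma exists_log_minorant : ∃ m : ℝ,
    (∀ z : ℂ, z ≠ 0 → ((m + 2 * Real.log ‖z‖ : ℝ) : EReal) ≤ Q z) ∧
    Q (b : ℂ) = ((m + 2 * Real.log b : ℝ) : EReal) ∧
    Q (t : ℂ) = ((m + 2 * Real.log t : ℝ) : EReal) ∧
    ∀ z : ℂ, z ≠ 0 → Q z = ((m + 2 * Real.log ‖z‖ : ℝ) : EReal) → z ∈ coincidenceSet Q := by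
  have hb : 0 < b := ha.trans_lt hab
  have ht : 0 < t := hb.trans hbt
  obtain ⟨U, hUo, hSU, hUtop, hUsm, -⟩ := hreg
  have nb : ‖(b : ℂ)‖ = b := by simp [hb.le]
  have nt : ‖(t : ℂ)‖ = t := by simp [ht.le]
  have hbS : (b : ℂ) ∈ coincidenceSet Q := by
    rw [hS]; left; exact ⟨by rw [nb]; exact hab.le, nb.le⟩
  have htS : (t : ℂ) ∈ coincidenceSet Q := by rw [hS]; right; exact nt
  have hfin : ∀ z ∈ coincidenceSet Q, Q z = ((Q z).toReal : EReal) := fun z hz =>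
    (EReal.coe_toReal (hUtop z (hSU hz)) (hQ.ne_bot z)).symm
  obtain ⟨A, hA⟩ := hQ.exists_lower_bound
  set qb := (Q (b : ℂ)).toReal with hqb
  -- `r₁` is so small that competitors of slope at least `1` cannot touch in `|z| ≤ r₁`
  set r₁ : ℝ := b * Real.exp (-(|qb - A| + 1)) with hr₁
  have hr₁0 : 0 < r₁ := by positivity
  have hr₁b : r₁ < b := by
    refine mul_lt_of_lt_one_right hb ?_
    rw [Real.exp_lt_one_iff]
    have := abs_nonneg (qb - A)
    linarith
  have hlogb : Real.log (b / r₁) = |qb - A| + 1 := by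
    rw [hr₁, Real.log_div hb.ne' (by positivity), Real.log_mul hb.ne' (Real.exp_pos _).ne',
      Real.log_exp]
    ring
  have hcA : ∀ α c : ℝ, 1 ≤ α → (∀ z, (logCompetitor α c r₁ z : EReal) ≤ Q z) → c < A := by
    intro α c hα hle
    have h1 := hle b
    rw [hfin _ hbS, EReal.coe_le_coe_iff, logCompetitor_of_le hr₁0 (by rw [nb]; exact hr₁b.le),
      nb, hlogb] at h1
    have := le_abs_self (qb - A)
    have := abs_nonneg (qb - A)
    nlinarith
  have hbig : ∀ α c : ℝ, 1 ≤ α → (∀ z, (logCompetitor α c r₁ z : EReal) ≤ Q z) → ∀ z,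
      Q z = (logCompetitor α c r₁ z : EReal) → r₁ < ‖z‖ := by
    intro α c hα hle z hz
    by_contra hcon
    rw [not_lt] at hcon
    have h1 := hA z
    rw [hz, logCompetitor_of_ge hr₁0 hcon, EReal.coe_le_coe_iff] at h1
    exact absurd (hcA α c hα hle) (not_lt.2 h1)
  obtain ⟨c₂, z₂, hle₂, hz₂⟩ := hQ.exists_touching (α := 2) (r := r₁) le_rfl hr₁0
    (hUtop _ (hSU hbS))
  set m := c₂ - 2 * Real.log r₁ with hm
  have hz₂r := hbig 2 c₂ (by norm_num) hle₂ z₂ hz₂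
  have hlogm : ∀ x : ℝ, 0 < x → c₂ + 2 * Real.log (x / r₁) = m + 2 * Real.log x := fun x hx => by
    rw [Real.log_div hx.ne' hr₁0.ne', hm]; ring
  have hlow : ∀ z : ℂ, z ≠ 0 → ((m + 2 * Real.log ‖z‖ : ℝ) : EReal) ≤ Q z := fun z hz => by
    refine le_trans ?_ (hle₂ z)
    rw [EReal.coe_le_coe_iff, ← hlogm _ (norm_pos_iff.2 hz)]
    exact log_div_le_logCompetitor (by norm_num) z
  -- a point of contact propagates outwards through the coincidence set
  have hprop : ∀ r : ℝ, 0 < r → Q (r : ℂ) = ((m + 2 * Real.log r : ℝ) : EReal) → ∀ r' : ℝ, r ≤ r' →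
      (r' : ℂ) ∈ coincidenceSet Q → Q (r' : ℂ) = ((m + 2 * Real.log r' : ℝ) : EReal) := by
    intro r hr hqr r' hrr' hr'S
    have hr' : 0 < r' := hr.trans_le hrr'
    have nr' : ‖(r' : ℂ)‖ = r' := by simp [hr'.le]
    refine le_antisymm ?_ ?_
    · rw [show Q (r' : ℂ) = obstacleFunction Q (r' : ℂ) from hr'S]
      refine (obstacleFunction_le_log hQ hr hqr (by rw [nr']; exact hrr')).trans (le_of_eq ?_)
      rw [nr', Real.log_div hr'.ne' hr.ne']
      congr 1
      ring
    · have := hlow (r' : ℂ) (by exact_mod_cast hr'.ne')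
      rwa [nr'] at this
  have hcontact : ∀ z : ℂ, z ≠ 0 → Q z = ((m + 2 * Real.log ‖z‖ : ℝ) : EReal) →
      Q z = (logCompetitor 2 c₂ r₁ z : EReal) := fun z hz0 hz => by
    refine le_antisymm ?_ (hle₂ z)
    rw [hz, EReal.coe_le_coe_iff, ← hlogm _ (norm_pos_iff.2 hz0)]
    exact log_div_le_logCompetitor (by norm_num) z
  have hSm : ∀ z : ℂ, z ≠ 0 → Q z = ((m + 2 * Real.log ‖z‖ : ℝ) : EReal) →
      z ∈ coincidenceSet Q := fun z hz0 hz =>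
    mem_coincidenceSet_of_logCompetitor (by norm_num) le_rfl hr₁0 hle₂ (hcontact z hz0 hz)
  have hSnorm : ∀ z ∈ coincidenceSet Q, ‖z‖ ≤ b ∨ ‖z‖ = t := fun z hz => by
    rw [hS] at hz
    rcases hz with h | h
    · exact Or.inl h.2
    · exact Or.inr h
  have hz₂Q : Q (‖z₂‖ : ℂ) = ((m + 2 * Real.log ‖z₂‖ : ℝ) : EReal) := by
    rw [← hQ.radial, hz₂, logCompetitor_of_le hr₁0 hz₂r.le, hlogm _ (hr₁0.trans hz₂r)]
  have hz₂S := mem_coincidenceSet_of_logCompetitor (by norm_num) le_rfl hr₁0 hle₂ hz₂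
  have hQt : Q (t : ℂ) = ((m + 2 * Real.log t : ℝ) : EReal) :=
    hprop ‖z₂‖ (hr₁0.trans hz₂r) hz₂Q t
      ((hSnorm z₂ hz₂S).elim (fun h => h.trans hbt.le) fun h => h.le) htS
  refine ⟨m, hlow, ?_, hQt, hSm⟩
  -- it remains to find a point of contact in the droplet
  suffices hex : ∃ z ∈ closedAnnulus a b, z ≠ 0 ∧ Q z = ((m + 2 * Real.log ‖z‖ : ℝ) : EReal) by
    obtain ⟨z, hz, hz0, hzQ⟩ := hex
    exact hprop ‖z‖ (norm_pos_iff.2 hz0) (by rw [← hQ.radial]; exact hzQ) b hz.2 hbS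
  by_contra! hno
  have hdS : closedAnnulus a b ⊆ coincidenceSet Q := by rw [hS]; exact Set.subset_union_left
  have hKc : IsCompact (closedAnnulus a b) := by
    have : closedAnnulus a b = Metric.closedBall (0 : ℂ) b ∩ {z : ℂ | a ≤ ‖z‖} := by
      ext z; simp [closedAnnulus, and_comm]
    rw [this]
    exact (isCompact_closedBall 0 b).inter_right (isClosed_le continuous_const continuous_norm)
  have hfc : ContinuousOn (fun z => (Q z).toReal - 2 * Real.posLog (‖z‖ / r₁))
      (closedAnnulus a b) :=
    (hUsm.continuousOn.mono (hdS.trans hSU)).sub (by fun_prop)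
  obtain ⟨z₃, hz₃, hz₃min⟩ := hKc.exists_isMinOn ⟨(b : ℂ), by rw [closedAnnulus]; exact
    ⟨by rw [nb]; exact hab.le, nb.le⟩⟩ hfc
  set m₁ := (Q z₃).toReal - 2 * Real.posLog (‖z₃‖ / r₁) with hm₁
  have hgap : c₂ < m₁ := by
    have hx := hle₂ z₃
    rw [hfin _ (hdS hz₃), EReal.coe_le_coe_iff, logCompetitor] at hx
    refine lt_of_le_of_ne (by linarith) fun heq => ?_
    have hQ3 : Q z₃ = (logCompetitor 2 c₂ r₁ z₃ : EReal) := by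
      rw [hfin _ (hdS hz₃), logCompetitor, heq, hm₁]; congr 1; ring
    have hr3 := hbig 2 c₂ (by norm_num) hle₂ z₃ hQ3
    refine hno z₃ hz₃ (norm_pos_iff.1 (hr₁0.trans hr3)) ?_
    rw [hQ3, logCompetitor_of_le hr₁0 hr3.le, hlogm _ (hr₁0.trans hr3)]
  have hlt : 0 < Real.log (t / r₁) := Real.log_pos ((one_lt_div hr₁0).2 (hr₁b.trans hbt))
  obtain ⟨α, hα1, hα2, hαgap⟩ : ∃ α : ℝ, 1 ≤ α ∧ α < 2 ∧
      c₂ + (2 - α) * Real.log (t / r₁) < m₁ := by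
    set e := min 1 ((m₁ - c₂) / (2 * Real.log (t / r₁))) with he
    have he0 : 0 < e := lt_min one_pos (div_pos (by linarith) (by linarith))
    have he1 : e ≤ 1 := min_le_left _ _
    have he2 : e * (2 * Real.log (t / r₁)) ≤ m₁ - c₂ :=
      (le_div_iff₀ (by linarith)).1 (min_le_right _ _)
    refine ⟨2 - e, by linarith, by linarith, ?_⟩
    have : 0 < e * Real.log (t / r₁) := by positivity
    linarith
  obtain ⟨cα, zα, hleα, hzα⟩ := hQ.exists_touching (α := α) (r := r₁) hα2.le hr₁0
    (hUtop _ (hSU hbS))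
  have hzαS := mem_coincidenceSet_of_logCompetitor (by linarith) hα2.le hr₁0 hleα hzα
  have htr : r₁ ≤ ‖(t : ℂ)‖ := by rw [nt]; linarith
  have hqt : (Q (t : ℂ)).toReal = c₂ + 2 * Real.log (t / r₁) := by
    rw [hQt, EReal.toReal_coe, hlogm t ht]
  rw [hS] at hzαS
  rcases hzαS with hzα' | hzα'
  · -- touching on the droplet costs more than touching at `t`
    have h1 : m₁ ≤ (Q zα).toReal - 2 * Real.posLog (‖zα‖ / r₁) := hz₃min hzα'
    rw [hzα, EReal.toReal_coe, logCompetitor] at h1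
    have h2 := hleα (t : ℂ)
    rw [hfin _ htS, EReal.coe_le_coe_iff, hqt, logCompetitor_of_le hr₁0 htr, nt] at h2
    have h3 : 0 ≤ Real.posLog (‖zα‖ / r₁) := Real.posLog_nonneg
    nlinarith
  · -- touching at `t` with two different slopes contradicts differentiability
    have htouch : ∀ γ c : ℝ, (∀ z, (logCompetitor γ c r₁ z : EReal) ≤ Q z) →
        Q (t : ℂ) = (logCompetitor γ c r₁ (t : ℂ) : EReal) →
        deriv (fun x : ℝ => (Q (x : ℂ)).toReal) t = γ * t⁻¹ := by
      intro γ c hle heq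
      have hd : DifferentiableAt ℝ (fun x : ℝ => (Q (x : ℂ)).toReal) t := by
        have h1 : DifferentiableAt ℝ (fun z => (Q z).toReal) (t : ℂ) :=
          (hUsm.contDiffAt (hUo.mem_nhds (hSU htS))).differentiableAt (by simp)
        exact h1.comp t Complex.ofRealCLM.differentiableAt
      have hlogd : HasDerivAt (fun x : ℝ => γ * Real.log x) (γ * t⁻¹) t :=
        (Real.hasDerivAt_log ht.ne').const_mul γ
      have hmin : IsLocalMin (fun x : ℝ => (Q (x : ℂ)).toReal - γ * Real.log x) t := by
        have hcx : Tendsto (fun x : ℝ => (x : ℂ)) (𝓝 t) (𝓝 (t : ℂ)) :=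
          Complex.continuous_ofReal.tendsto t
        filter_upwards [hcx.eventually (hUo.mem_nhds (hSU htS)),
          lt_mem_nhds (hr₁b.trans hbt)] with x hxU hxr
        have hx0 : 0 < x := hr₁0.trans hxr
        have nx : ‖(x : ℂ)‖ = x := by simp [hx0.le]
        have h1 := hle (x : ℂ)
        rw [← EReal.coe_toReal (hUtop _ hxU) (hQ.ne_bot _), EReal.coe_le_coe_iff,
          logCompetitor_of_le hr₁0 (by rw [nx]; exact hxr.le), nx,
          Real.log_div hx0.ne' hr₁0.ne'] at h1
        rw [heq, EReal.toReal_coe, logCompetitor_of_le hr₁0 htr, nt,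
          Real.log_div ht.ne' hr₁0.ne']
        linarith
      have h2 := hmin.hasDerivAt_eq_zero (hd.hasDerivAt.sub hlogd)
      linarith
    have e1 := htouch α cα hleα (by
      have hn : ‖zα‖ = t := hzα'
      have : logCompetitor α cα r₁ zα = logCompetitor α cα r₁ (t : ℂ) := by
        rw [logCompetitor, logCompetitor, hn, nt]
      rw [← this, ← hzα, hQ.radial zα, hn])
    have e2 := htouch 2 c₂ hle₂ (by
      have := hcontact (t : ℂ) (by exact_mod_cast ht.ne') (by rw [nt]; exact hQt)
      exact this)
    have h5 : α * t⁻¹ = 2 * t⁻¹ := e1.symm.trans e2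
    have h6 := mul_right_cancel₀ (inv_ne_zero ht.ne') h5
    linarith

/-- Inside the hole of the droplet the potential exceeds its value on the inner boundary. -/
lemma lt_of_norm_lt_inner {z : ℂ} (hz : ‖z‖ < a) : Q (a : ℂ) < Q z := by
  have ha0 : 0 < a := (norm_nonneg z).trans_lt hz
  obtain ⟨U, -, hSU, hUtop, -, -⟩ := hreg
  have na : ‖(a : ℂ)‖ = a := by simp [ha]
  have haS : (a : ℂ) ∈ coincidenceSet Q := by
    rw [hS]; left; exact ⟨na.ge, by rw [na]; exact hab.le⟩
  obtain ⟨c, z₀, hle, hz₀⟩ := hQ.exists_touching (α := 0) (r := 1) (by norm_num) one_pos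
    (hUtop _ (hSU haS))
  have hlc : ∀ w, logCompetitor 0 c 1 w = c := fun w => by simp [logCompetitor]
  have hz₀S := mem_coincidenceSet_of_logCompetitor le_rfl (by norm_num) one_pos hle hz₀
  have hnorm : ∀ w ∈ coincidenceSet Q, a ≤ ‖w‖ := fun w hw => by
    rw [hS] at hw
    rcases hw with h | h
    · exact h.1
    · have : ‖w‖ = t := h
      linarith
  have hac : Q (a : ℂ) ≤ (c : EReal) := by
    rw [show Q (a : ℂ) = obstacleFunction Q (a : ℂ) from haS]
    refine obstacleFunction_le_of_norm_le hQ (ha0.trans_le (hnorm z₀ hz₀S)) ?_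
      (by rw [na]; exact hnorm z₀ hz₀S)
    rw [← hQ.radial, hz₀, hlc]
  refine lt_of_le_of_ne ?_ fun heq => ?_
  · have := hle z
    rw [hlc] at this
    exact hac.trans this
  · have h1 : Q z = (logCompetitor 0 c 1 z : EReal) :=
      le_antisymm (by rw [hlc, ← heq]; exact hac) (hle z)
    exact absurd (hnorm z (mem_coincidenceSet_of_logCompetitor le_rfl (by norm_num) one_pos hle h1))
      (not_le.2 hz)

end Potential

/-! ### The radial weight of a potential with an outpost -/

lemma weight_le_exp_neg {Q : ℂ → EReal} {z : ℂ} {x : ℝ} (h : (x : EReal) ≤ Q z) :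
    weight Q z ≤ Real.exp (-x) := by
  have h1 : EReal.exp (-Q z) ≤ EReal.exp ((-x : ℝ) : EReal) :=
    EReal.exp_monotone (by rw [EReal.coe_neg]; exact EReal.neg_le_neg_iff.2 h)
  rw [EReal.exp_coe] at h1
  exact ENNReal.toReal_le_of_le_ofReal (Real.exp_pos _).le h1

lemma relativeWeight_le_exp_neg {Q : ℂ → EReal} {m r x : ℝ} (hr : 0 < r)
    (h : ((m + 2 * Real.log r + x : ℝ) : EReal) ≤ Q (r : ℂ)) :
    relativeWeight Q m r ≤ Real.exp (-x) := by
  have h1 : 2 * Real.log r = Real.log (r ^ 2) := by rw [Real.log_pow]; norm_num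
  calc relativeWeight Q m r ≤ Real.exp m * r ^ 2 * Real.exp (-(m + 2 * Real.log r + x)) :=
        mul_le_mul_of_nonneg_left (weight_le_exp_neg h) (by positivity)
    _ = Real.exp m * Real.exp (2 * Real.log r) * Real.exp (-(m + 2 * Real.log r + x)) := by
        rw [h1, Real.exp_log (by positivity)]
    _ = Real.exp (-x) := by
        rw [← Real.exp_add, ← Real.exp_add]; congr 1; ring

lemma relativeWeight_nonneg (Q : ℂ → EReal) (m r : ℝ) : 0 ≤ relativeWeight Q m r :=
  mul_nonneg (by positivity) (weight_nonneg Q _)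

lemma IsExternalPotential.measurable_weight {Q : ℂ → EReal} (hQ : IsExternalPotential Q) :
    Measurable (weight Q) := by
  have := hQ.lsc.measurable
  unfold weight
  exact (EReal.measurable_exp.comp this.neg).ennreal_toReal

lemma IsExternalPotential.measurable_relativeWeight {Q : ℂ → EReal} (hQ : IsExternalPotential Q)
    (m : ℝ) : Measurable (relativeWeight Q m) := by
  have := hQ.measurable_weight
  unfold relativeWeight
  fun_prop

/-- The relative weight vanishes quadratically at the origin and decays like a negative power at
infinity. -/
lemma IsExternalPotential.relativeWeight_bounds {Q : ℂ → EReal} (hQ : IsExternalPotential Q)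
    (m : ℝ) : (∃ C : ℝ, 0 ≤ C ∧ ∀ r, relativeWeight Q m r ≤ C * r ^ 2) ∧
    ∃ γ R : ℝ, 0 < γ ∧ 1 ≤ R ∧
      ∀ r, R ≤ r → relativeWeight Q m r ≤ Real.exp m * r ^ (-γ) := by
  obtain ⟨A, hA⟩ := hQ.exists_lower_bound
  obtain ⟨β, hβ, R, hR1, hR⟩ := hQ.exists_growth
  refine ⟨⟨Real.exp m * Real.exp (-A), by positivity, fun r => ?_⟩,
    β - 2, R, by linarith, hR1, fun r hr => ?_⟩
  · have := weight_le_exp_neg (hA (r : ℂ))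
    calc relativeWeight Q m r ≤ Real.exp m * r ^ 2 * Real.exp (-A) :=
          mul_le_mul_of_nonneg_left this (by positivity)
      _ = _ := by ring
  · have hr0 : 0 < r := by linarith
    have hn : ‖(r : ℂ)‖ = r := by simp [hr0.le]
    have h1 := hR (r : ℂ) (by rw [hn]; exact hr)
    rw [hn] at h1
    have h2 := relativeWeight_le_exp_neg (Q := Q) (m := m) (r := r)
      (x := β * Real.log r - m - 2 * Real.log r) hr0 (le_trans (le_of_eq (by congr 1; ring)) h1)
    refine h2.trans (le_of_eq ?_)
    rw [Real.rpow_def_of_pos hr0, ← Real.exp_add]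
    congr 1
    ring

section Outpost

variable {Q : ℂ → EReal} (hQ : IsExternalPotential Q) {a b t : ℝ} (ha : 0 ≤ a) (hab : a < b)
  (hbt : b < t) (hS : coincidenceSet Q = closedAnnulus a b ∪ {z : ℂ | ‖z‖ = t})
  (hreg : IsRegularNear Q (coincidenceSet Q))

include hQ ha hab hbt hS hreg

/-- The relative weight has exactly two peaks, at the outer boundary of the droplet and at the
outpost. -/
lemma exists_isTwoPeaked : ∃ m : ℝ, IsTwoPeaked (relativeWeight Q m) b t
    (4 * quarterLaplacian Q (b : ℂ)) (4 * quarterLaplacian Q (t : ℂ)) := by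
  obtain ⟨m, hmin, hQb, hQt, hcon⟩ := exists_log_minorant hQ ha hab hbt hS hreg
  obtain ⟨U, hUo, hSU, hUtop, hUsm, hUΔ⟩ := hreg
  have hb : 0 < b := ha.trans_lt hab
  have ht : 0 < t := hb.trans hbt
  have nrm : ∀ r : ℝ, 0 < r → ‖(r : ℂ)‖ = r := fun r hr => by simp [hr.le]
  have hpeak : ∀ c : ℝ, 0 < c → Q (c : ℂ) = ((m + 2 * Real.log c : ℝ) : EReal) →
      HasGaussianPeak (relativeWeight Q m) c (4 * quarterLaplacian Q (c : ℂ)) := fun c hc hQc => by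
    have hcS : (c : ℂ) ∈ U := hSU (hcon c (by exact_mod_cast hc.ne') (by rw [nrm c hc]; exact hQc))
    exact hasGaussianPeak_relativeWeight hQ.radial hQ.ne_bot hc
      (by filter_upwards [hUo.mem_nhds hcS] with z hz using hUtop z hz)
      ((hUsm.contDiffAt (hUo.mem_nhds hcS)).of_le (by norm_num)) (hUΔ _ hcS) hmin hQc
  have hpb := hpeak b hb hQb
  -- contact at `r < b` would propagate up to `b` and flatten the peak there
  have hstrict : ∀ r : ℝ, 0 < r → r ≠ b → r ≠ t →
      ((m + 2 * Real.log r : ℝ) : EReal) < Q (r : ℂ) := by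
    intro r hr hrb hrt
    refine lt_of_le_of_ne (by have := hmin r (by exact_mod_cast hr.ne'); rwa [nrm r hr] at this)
      fun heq => ?_
    have hrS := hcon r (by exact_mod_cast hr.ne') (by rw [nrm r hr]; exact heq.symm)
    rw [hS] at hrS
    rcases hrS with hrS | hrS
    swap
    · exact hrt (by rw [← nrm r hr]; exact hrS)
    have har : a ≤ r := by have := hrS.1; rwa [nrm r hr] at this
    have hrb' : r < b := lt_of_le_of_ne (by have := hrS.2; rwa [nrm r hr] at this) hrb
    obtain ⟨G, δ, hδ, hG1, hG2, -⟩ := hpb.exists_radius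
    set x := min (b - r) (δ / 2) with hx
    have hx0 : 0 < x := lt_min (by linarith) (by linarith)
    have hx1 : x ≤ b - r := min_le_left _ _
    have hx2 : x ≤ δ / 2 := min_le_right _ _
    have habs : |(-x)| < δ := by rw [abs_neg, abs_of_pos hx0]; linarith
    have hs0 : 0 < b + -x := by linarith
    have hsS : ((b + -x : ℝ) : ℂ) ∈ coincidenceSet Q := by
      rw [hS]; left; exact ⟨by rw [nrm _ hs0]; linarith, by rw [nrm _ hs0]; linarith⟩
    have hsQ : Q ((b + -x : ℝ) : ℂ) = ((m + 2 * Real.log (b + -x) : ℝ) : EReal) := by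
      refine le_antisymm ?_ (by
        have := hmin ((b + -x : ℝ) : ℂ) (by exact_mod_cast hs0.ne'); rwa [nrm _ hs0] at this)
      rw [show Q ((b + -x : ℝ) : ℂ) = obstacleFunction Q ((b + -x : ℝ) : ℂ) from hsS]
      refine (obstacleFunction_le_log hQ hr heq.symm (by rw [nrm _ hs0]; linarith)).trans
        (le_of_eq ?_)
      rw [nrm _ hs0, Real.log_div hs0.ne' hr.ne']
      congr 1
      ring
    have h1 := hG1 (-x) habs
    have h2 := hG2 (-x) habs (by linarith)
    have h3 : relativeWeight Q m (b + -x) = 1 := by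
      have h4 : 2 * Real.log (b + -x) = Real.log ((b + -x) ^ 2) := by
        rw [Real.log_pow]; norm_num
      rw [relativeWeight, weight_of_eq_coe hsQ, neg_add, Real.exp_add, h4, Real.exp_neg,
        Real.exp_neg, Real.exp_log (by positivity)]
      field_simp
    rw [h3, eq_comm, Real.exp_eq_one_iff] at h1
    have h5 : 0 < 4 * quarterLaplacian Q (b : ℂ) / 4 * (-x) ^ 2 := by
      have := hpb.1
      rw [neg_sq]
      positivity
    linarith
  obtain ⟨⟨C, hC0, hC⟩, γ, R, hγ, hR1, hR⟩ := hQ.relativeWeight_bounds m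
  have hle1 : ∀ r, 0 < r → relativeWeight Q m r ≤ 1 := fun r hr => by
    have := hmin r (by exact_mod_cast hr.ne')
    rw [nrm r hr] at this
    simpa using relativeWeight_le_exp_neg (x := 0) hr (by simpa using this)
  refine ⟨m, hQ.measurable_relativeWeight m, relativeWeight_nonneg Q m, hle1, hb, hbt, hpb,
    hpeak t ht hQt, fun δ hδ => ?_, fun i => ?_⟩
  · obtain ⟨r₀, hr₀, hr₀C⟩ : ∃ r₀ : ℝ, 0 < r₀ ∧ C * r₀ ^ 2 ≤ 1 / 2 := by
      refine ⟨√(1 / (2 * (C + 1))), by positivity, ?_⟩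
      rw [Real.sq_sqrt (by positivity), mul_one_div, div_le_div_iff₀ (by positivity) (by norm_num)]
      linarith
    obtain ⟨R', hR'⟩ : ∃ R', ∀ r, R' ≤ r → Real.exp m * r ^ (-γ) ≤ 1 / 2 := by
      have := (tendsto_rpow_neg_atTop hγ).const_mul (Real.exp m)
      rw [mul_zero] at this
      exact eventually_atTop.1 (this.eventually (ge_mem_nhds (by norm_num)))
    set K : Set ℝ := Set.Icc r₀ (max R R') ∩ ({r | δ ≤ |r - b|} ∩ {r | δ ≤ |r - t|}) with hK
    have hKc : IsCompact K := isCompact_Icc.inter_right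
      ((isClosed_le continuous_const (by fun_prop)).inter
        (isClosed_le continuous_const (by fun_prop)))
    -- on the remaining compact set lower semicontinuity gives a uniform gap
    have hgap : ∃ e : ℝ, 0 < e ∧ ∀ r ∈ K, relativeWeight Q m r ≤ Real.exp (-e) := by
      rcases K.eq_empty_or_nonempty with hKe | hKne
      · exact ⟨1, one_pos, fun r hr => by rw [hKe] at hr; exact hr.elim⟩
      have hKpos : ∀ r ∈ K, 0 < r := fun r hr => hr₀.trans_le hr.1.1
      have hlsc : LowerSemicontinuousOn
          (fun r : ℝ => Q (r : ℂ) + ((-(m + 2 * Real.log r) : ℝ) : EReal)) K := by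
        refine LowerSemicontinuousOn.add'
          ((hQ.lsc.comp Complex.continuous_ofReal).lowerSemicontinuousOn K)
          (ContinuousOn.lowerSemicontinuousOn (continuous_coe_real_ereal.comp_continuousOn ?_))
          fun r _ => EReal.continuousAt_add (Or.inr (EReal.coe_ne_bot _))
            (Or.inr (EReal.coe_ne_top _))
        exact (continuousOn_const.add (continuousOn_const.mul
          (continuousOn_id.log fun r hr => (hKpos r hr).ne'))).neg
      obtain ⟨r₁, hr₁, hr₁min⟩ := hlsc.exists_isMinOn hKne hKc
      have hshift : ∀ r x : ℝ, (x : EReal) ≤ Q (r : ℂ) + ((-(m + 2 * Real.log r) : ℝ) : EReal) →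
          ((m + 2 * Real.log r + x : ℝ) : EReal) ≤ Q (r : ℂ) := fun r x hx => by
        induction hz : Q (r : ℂ) with
        | bot => exact absurd hz (hQ.ne_bot _)
        | top => exact le_top
        | coe y =>
          rw [hz, ← EReal.coe_add, EReal.coe_le_coe_iff] at hx
          rw [EReal.coe_le_coe_iff]
          linarith
      have hpos : (0 : EReal) < Q (r₁ : ℂ) + ((-(m + 2 * Real.log r₁) : ℝ) : EReal) := by
        have h1 := hstrict r₁ (hKpos r₁ hr₁)
          (fun h => by have := hr₁.2.1; simp [h] at this; linarith)
          (fun h => by have := hr₁.2.2; simp [h] at this; linarith)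
        induction hz : Q (r₁ : ℂ) with
        | bot => exact absurd hz (hQ.ne_bot _)
        | top => rw [EReal.top_add_coe]; exact EReal.zero_lt_top
        | coe y =>
          rw [hz, EReal.coe_lt_coe_iff] at h1
          rw [← EReal.coe_add]
          exact_mod_cast (by linarith)
      obtain ⟨e, he0, he1⟩ := EReal.lt_iff_exists_real_btwn.1 hpos
      refine ⟨e, by exact_mod_cast he0, fun r hr => ?_⟩
      exact relativeWeight_le_exp_neg (hKpos r hr) (hshift r e (he1.le.trans (hr₁min hr)))
    obtain ⟨e, he, hKe⟩ := hgap
    refine ⟨max (1 / 2) (Real.exp (-e)), by positivity, max_lt (by norm_num)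
      (Real.exp_lt_one_iff.2 (by linarith)), fun r hr h1 h2 => ?_⟩
    rcases le_total r r₀ with hrr | hrr
    · refine le_max_of_le_left ((hC r).trans (le_trans ?_ hr₀C))
      gcongr
    rcases le_total r (max R R') with hrR | hrR
    · exact le_max_of_le_right (hKe r ⟨⟨hrr, hrR⟩, h1, h2⟩)
    · exact le_max_of_le_left ((hR r ((le_max_left _ _).trans hrR)).trans
        (hR' r ((le_max_right _ _).trans hrR)))
  · have hmeas := hQ.measurable_relativeWeight m
    rw [← Set.Ioc_union_Ioi_eq_Ioi (show (0 : ℝ) ≤ R by linarith)]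
    refine IntegrableOn.union ?_ ?_
    · refine Measure.integrableOn_of_bounded (M := C ^ (i + 1) * R) (by simp)
        (by fun_prop) ?_
      filter_upwards [ae_restrict_mem measurableSet_Ioc] with r hr
      have hr0 : 0 < r := hr.1
      have h0 := relativeWeight_nonneg Q m r
      rw [Real.norm_of_nonneg (by positivity)]
      calc (r ^ (2 * i + 1))⁻¹ * relativeWeight Q m r ^ (i + 1)
          ≤ (r ^ (2 * i + 1))⁻¹ * (C * r ^ 2) ^ (i + 1) := by
            gcongr; exact hC r
        _ = C ^ (i + 1) * r := by
            rw [mul_pow, ← pow_mul, show 2 * (i + 1) = (2 * i + 1) + 1 by ring, pow_succ r]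
            field_simp
            ring
        _ ≤ C ^ (i + 1) * R := by gcongr; exact hr.2
    · have hint : IntegrableOn (fun r : ℝ => Real.exp m * r ^ (-1 - γ)) (Set.Ioi R) :=
        (integrableOn_Ioi_rpow_of_lt (by linarith) (by linarith)).const_mul _
      refine hint.mono' (by fun_prop) ?_
      filter_upwards [ae_restrict_mem measurableSet_Ioi] with r hr
      have hrR : R < r := hr
      have hr0 : 0 < r := by linarith
      have h0 := relativeWeight_nonneg Q m r
      rw [Real.norm_of_nonneg (by positivity)]
      calc (r ^ (2 * i + 1))⁻¹ * relativeWeight Q m r ^ (i + 1)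
          ≤ (r ^ 1)⁻¹ * relativeWeight Q m r ^ 1 := by
            refine mul_le_mul ?_ (pow_le_pow_of_le_one h0 (hle1 r hr0) (by lia)) (by positivity)
              (by positivity)
            have := pow_le_pow_right₀ (show 1 ≤ r by linarith) (show 1 ≤ 2 * i + 1 by lia)
            gcongr
        _ ≤ r⁻¹ * (Real.exp m * r ^ (-γ)) := by
            rw [pow_one, pow_one]
            gcongr
            exact hR r hrR.le
        _ = Real.exp m * r ^ (-1 - γ) := by
            rw [sub_eq_add_neg, Real.rpow_add hr0, Real.rpow_neg_one]; ring

/-- Inside the hole of the droplet the weight is uniformly smaller than near the inner boundary. -/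
lemma exists_weight_le_mul_weight {ε : ℝ} (hε : 0 < ε) (hεa : ε < a) : ∃ η δ : ℝ, 0 ≤ η ∧ η < 1 ∧
    0 < δ ∧ δ ≤ ε ∧ ∀ r r' : ℝ, 0 < r → r ≤ a - ε → a - δ < r' → r' < a →
      weight Q (r : ℂ) ≤ η * weight Q (r' : ℂ) := by
  have hin := fun z : ℂ => lt_of_norm_lt_inner hQ ha hab hbt hS hreg (z := z)
  obtain ⟨U, hUo, hSU, hUtop, hUsm, -⟩ := hreg
  have na : ‖(a : ℂ)‖ = a := by simp [ha]
  have haU : (a : ℂ) ∈ U := hSU (by rw [hS]; left; exact ⟨na.ge, by rw [na]; exact hab.le⟩)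
  obtain ⟨z₀, hz₀, hz₀min⟩ := (hQ.lsc.lowerSemicontinuousOn _).exists_isMinOn
    ⟨0, by simpa using (by linarith : 0 ≤ a - ε)⟩ (isCompact_closedBall (0 : ℂ) (a - ε))
  set qa := (Q (a : ℂ)).toReal with hqa
  have hQa : Q (a : ℂ) = (qa : EReal) := (EReal.coe_toReal (hUtop _ haU) (hQ.ne_bot _)).symm
  have h0 := hin z₀ (by have : ‖z₀‖ ≤ a - ε := by simpa using hz₀
                        linarith)
  rw [hQa] at h0
  obtain ⟨y, hy1, hy2⟩ := EReal.lt_iff_exists_real_btwn.1 h0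
  have hy : qa < y := by exact_mod_cast hy1
  have hcont : ContinuousAt (fun x : ℝ => (Q (x : ℂ)).toReal) a :=
    ContinuousAt.comp (g := fun z => (Q z).toReal) (f := fun x : ℝ => (x : ℂ))
      (hUsm.continuousOn.continuousAt (hUo.mem_nhds haU)) Complex.continuous_ofReal.continuousAt
  have hev : ∀ᶠ x : ℝ in 𝓝 a, (Q (x : ℂ)).toReal < (qa + y) / 2 ∧ (x : ℂ) ∈ U :=
    (hcont.eventually (gt_mem_nhds (show (Q (a : ℂ)).toReal < (qa + y) / 2 by
      rw [← hqa]; linarith))).and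
      (Complex.continuous_ofReal.continuousAt.eventually (hUo.mem_nhds haU))
  obtain ⟨δ, hδ, hδev⟩ := Metric.eventually_nhds_iff.1 hev
  refine ⟨Real.exp (-((y - qa) / 2)), min δ ε, (Real.exp_pos _).le,
    Real.exp_lt_one_iff.2 (by linarith), lt_min hδ hε, min_le_right _ _, fun r r' hr hra hr'1 hr'2 => ?_⟩
  have hr' : dist r' a < δ := by
    rw [Real.dist_eq, abs_lt]
    constructor <;> linarith [min_le_left δ ε]
  obtain ⟨h1, h2⟩ := hδev hr'
  have h3 : weight Q (r : ℂ) ≤ Real.exp (-y) := weight_le_exp_neg (hy2.le.trans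
    (hz₀min (by simpa [abs_of_pos hr] using hra)))
  rw [weight_of_eq_coe (EReal.coe_toReal (hUtop _ h2) (hQ.ne_bot _)).symm, ← Real.exp_add]
  exact h3.trans (Real.exp_le_exp.2 (by linarith))

end Outpost

/-! ### Convergence of the products of moment ratios -/

lemma norm_prod_sub_prod_le_sum {f g : ℕ → ℂ} {n : ℕ} (hf : ∀ i < n, ‖f i‖ ≤ 1)
    (hg : ∀ i < n, ‖g i‖ ≤ 1) :
    ‖∏ i ∈ Finset.range n, f i - ∏ i ∈ Finset.range n, g i‖ ≤
      ∑ i ∈ Finset.range n, ‖f i - g i‖ := by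
  induction n with
  | zero => simp
  | succ n ih =>
    have ih' := ih (fun i hi => hf i (by lia)) fun i hi => hg i (by lia)
    rw [Finset.prod_range_succ, Finset.prod_range_succ, Finset.sum_range_succ]
    have hP : ‖∏ i ∈ Finset.range n, g i‖ ≤ 1 := by
      rw [norm_prod]
      exact Finset.prod_le_one (fun _ _ => norm_nonneg _)
        fun i hi => hg i (by have := Finset.mem_range.1 hi; lia)
    set F := ∏ i ∈ Finset.range n, f i
    set G := ∏ i ∈ Finset.range n, g i
    calc ‖F * f n - G * g n‖ = ‖(F - G) * f n + G * (f n - g n)‖ := by congr 1; ring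
      _ ≤ ‖F - G‖ * ‖f n‖ + ‖G‖ * ‖f n - g n‖ := by
          refine (norm_add_le _ _).trans ?_
          rw [norm_mul, norm_mul]
      _ ≤ ‖F - G‖ * 1 + 1 * ‖f n - g n‖ := by
          gcongr
          exact hf n (by lia)
      _ ≤ _ := by rw [mul_one, one_mul]; gcongr

/-- A triangular array of factors in the unit disk, converging entrywise with summable domination,
has convergent row products. -/
lemma tendsto_prod_of_dominated {f : ℕ → ℕ → ℂ} {y : ℕ → ℂ} {B : ℕ → ℝ} {L : ℂ}
    (hB : Summable B) (hf : ∀ n, ∀ i < n, ‖f n i‖ ≤ 1) (hy : ∀ i, ‖y i‖ ≤ 1)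
    (hlim : ∀ i, Tendsto (fun n => f n i) atTop (𝓝 (y i)))
    (hdom : ∀ᶠ n in atTop, ∀ i < n, ‖f n i - 1‖ ≤ B i)
    (hL : Tendsto (fun n => ∏ i ∈ Finset.range n, y i) atTop (𝓝 L)) :
    Tendsto (fun n => ∏ i ∈ Finset.range n, f n i) atTop (𝓝 L) := by
  have hyB : ∀ i, ‖y i - 1‖ ≤ B i := fun i => by
    refine le_of_tendsto ((hlim i).sub_const 1).norm ?_
    filter_upwards [hdom, eventually_gt_atTop i] with n hn hi using hn i hi
  set d : ℕ → ℕ → ℝ := fun n i => if i < n then ‖f n i - y i‖ else 0 with hd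
  have hsum : Tendsto (fun n => ∑' i, d n i) atTop (𝓝 (∑' _ : ℕ, (0 : ℝ))) := by
    refine tendsto_tsum_of_dominated_convergence (hB.mul_left 2) (fun i => ?_) ?_
    · have h1 : Tendsto (fun n => ‖f n i - y i‖) atTop (𝓝 0) := by
        simpa using ((hlim i).sub_const (y i)).norm
      refine h1.congr' ?_
      filter_upwards [eventually_gt_atTop i] with n hn
      simp [hd, hn]
    · filter_upwards [hdom] with n hn i
      have hB0 : 0 ≤ B i := (norm_nonneg _).trans (hyB i)
      simp only [hd]
      split_ifs with hi
      · rw [norm_norm]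
        calc ‖f n i - y i‖ = ‖(f n i - 1) - (y i - 1)‖ := by congr 1; ring
          _ ≤ ‖f n i - 1‖ + ‖y i - 1‖ := norm_sub_le _ _
          _ ≤ 2 * B i := by linarith [hn i hi, hyB i]
      · simpa using hB0
  rw [tsum_zero] at hsum
  have hdiff : Tendsto (fun n => ∏ i ∈ Finset.range n, f n i - ∏ i ∈ Finset.range n, y i) atTop
      (𝓝 0) := by
    refine squeeze_zero_norm (fun n => ?_) hsum
    refine (norm_prod_sub_prod_le_sum (hf n) fun i _ => hy i).trans (le_of_eq ?_)
    rw [tsum_eq_sum (s := Finset.range n)]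
    · refine Finset.sum_congr rfl fun i hi => ?_
      simp [hd, Finset.mem_range.1 hi]
    · intro i hi
      simp [hd, Finset.mem_range.not.1 hi]
  simpa using hdiff.add hL

/-- The mass `∫_A r^{-(2i+1)} u(r)^n dr`. -/
def peakMass (u : ℝ → ℝ) (n i : ℕ) (A : Set ℝ) : ℝ :=
  ∫ r in A, (r ^ (2 * i + 1))⁻¹ * u r ^ n

namespace IsTwoPeaked

variable {u : ℝ → ℝ} {b t κb κt : ℝ} (H : IsTwoPeaked u b t κb κt)

lemma peakMoment_one (n i : ℕ) :
    peakMoment u n i (fun _ => 1) = (peakMass u n i (Set.Ioi 0) : ℂ) := by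
  rw [peakMoment, peakMass, ← integral_complex_ofReal]
  simp only [one_mul]

lemma peakMoment_indicator (n i : ℕ) {c : ℝ} :
    peakMoment u n i ((Set.Iio c).indicator fun _ => 1) =
      (peakMass u n i (Set.Ioo 0 c) : ℂ) := by
  rw [peakMoment, peakMass, ← integral_complex_ofReal, ← Set.Ioi_inter_Iio,
    ← setIntegral_indicator measurableSet_Iio]
  congr 1
  ext r
  by_cases h : r ∈ Set.Iio c <;> simp [h]

include H

lemma integrand_nonneg {n i : ℕ} {r : ℝ} (hr : 0 < r) : 0 ≤ (r ^ (2 * i + 1))⁻¹ * u r ^ n := by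
  have := H.nonneg r
  positivity

lemma peakMass_mono {n i : ℕ} (hi : i < n) {A B : Set ℝ} (hAB : A ⊆ B) (hB : MeasurableSet B)
    (hB0 : B ⊆ Set.Ioi 0) : peakMass u n i A ≤ peakMass u n i B := by
  refine setIntegral_mono_set ((H.integrableOn hi).mono_set hB0) ?_ hAB.eventuallyLE
  filter_upwards [ae_restrict_mem hB] with r hr using H.integrand_nonneg (hB0 hr)

lemma peakMass_pos {n i : ℕ} (hi : i < n) : 0 < peakMass u n i (Set.Ioi 0) := by
  rw [peakMass, setIntegral_pos_iff_support_of_nonneg_ae ?_ (H.integrableOn hi)]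
  · obtain ⟨G, δ, hδ, hG, -, -⟩ := H.peak_b.exists_radius
    have hb := H.b_pos
    refine lt_of_lt_of_le ?_ (measure_mono (s := Set.Ioo b (b + δ)) fun r hr => ?_)
    · simp [hδ]
    · have hr0 : 0 < r := hb.trans hr.1
      have h1 := hG (r - b) (by rw [abs_of_pos (by linarith [hr.1])]; linarith [hr.2])
      rw [add_sub_cancel] at h1
      refine ⟨?_, hr0⟩
      rw [Function.mem_support, h1]
      positivity
  · filter_upwards [ae_restrict_mem measurableSet_Ioi] with r hr using H.integrand_nonneg hr

/-- Far outside the droplet the moments are dominated geometrically in the index `i`. -/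
lemma exists_peakMass_outer_le {ε : ℝ} (hε : 0 < ε) : ∃ C κ : ℝ, 0 ≤ C ∧ 0 ≤ κ ∧ κ < 1 ∧
    ∀ᶠ n : ℕ in atTop, ∀ i < n,
      peakMass u n i (Set.Ioi (b + ε)) ≤ C * κ ^ i * peakMass u n i (Set.Ioi 0) := by
  have hb := H.b_pos
  have hbt := H.b_lt_t
  obtain ⟨δ, hδ0, hδε, hδt⟩ : ∃ δ > 0, δ < ε ∧ b + δ < t :=
    ⟨min ε (t - b) / 2, by have := lt_min hε (sub_pos.2 hbt); positivity,
      by linarith [min_le_left ε (t - b)], by linarith [min_le_right ε (t - b)]⟩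
  -- the index `0` masses of the half-line and of its part near the droplet are comparable
  set φ : ℝ → ℂ := (Set.Iio (b + δ)).indicator fun _ => 1 with hφ
  have hφm : Measurable φ := measurable_const.indicator measurableSet_Iio
  have hφb : φ =ᶠ[𝓝 b] fun _ => 1 := by
    filter_upwards [Iio_mem_nhds (show b < b + δ by linarith)] with r hr
    exact Set.indicator_of_mem hr _
  have hφt : φ =ᶠ[𝓝 t] fun _ => 0 := by
    filter_upwards [lt_mem_nhds hδt] with r hr
    exact Set.indicator_of_notMem (by simpa using hr.le) _
  have hlim1 := H.tendsto_peakMoment 0 (φ := fun _ => 1) measurable_const (C := 1) (by simp)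
    continuousAt_const continuousAt_const
  have hlim2 := H.tendsto_peakMoment 0 (φ := φ) hφm (C := 1)
    (fun r => by by_cases h : r ∈ Set.Iio (b + δ) <;> simp [hφ, h])
    (continuousAt_const.congr hφb.symm) (continuousAt_const.congr hφt.symm)
  rw [hφb.self_of_nhds, hφt.self_of_nhds] at hlim2
  simp only [hφ, peakMoment_indicator] at hlim2
  simp only [peakMoment_one] at hlim1
  set β₁ := (b ^ (2 * 0 + 1))⁻¹ * √(2 * Real.pi / κb)
  set β₂ := (t ^ (2 * 0 + 1))⁻¹ * √(2 * Real.pi / κt)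
  have hβ₁ : 0 < β₁ := by
    have := H.peak_b.1
    positivity
  have hβ₂ : 0 ≤ β₂ := by
    have := hb.trans hbt
    positivity
  have hl1 : Tendsto (fun n : ℕ => √(n : ℝ) * peakMass u n 0 (Set.Ioi 0)) atTop
      (𝓝 (β₁ + β₂)) := by
    have h := (Complex.continuous_re.tendsto _).comp hlim1
    refine (h.congr fun n => ?_).trans (le_of_eq ?_)
    · simp
    · simp
  have hl2 : Tendsto (fun n : ℕ => √(n : ℝ) * peakMass u n 0 (Set.Ioo 0 (b + δ))) atTop
      (𝓝 β₁) := by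
    have h := (Complex.continuous_re.tendsto _).comp hlim2
    refine (h.congr fun n => ?_).trans (le_of_eq ?_)
    · simp
    · simp
  set C := 2 * (β₁ + β₂ + 1) / β₁ with hC
  have hcmp : ∀ᶠ n : ℕ in atTop,
      peakMass u n 0 (Set.Ioi 0) ≤ C * peakMass u n 0 (Set.Ioo 0 (b + δ)) := by
    filter_upwards [hl1.eventually (gt_mem_nhds (lt_add_one _)),
      hl2.eventually (lt_mem_nhds (half_lt_self hβ₁)), eventually_gt_atTop 0] with n h1 h2 hn
    have hs : 0 < √(n : ℝ) := Real.sqrt_pos.2 (by exact_mod_cast hn)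
    refine le_of_mul_le_mul_left ?_ hs
    calc √(n : ℝ) * peakMass u n 0 (Set.Ioi 0) ≤ C * (β₁ / 2) := by
          rw [hC]; field_simp; linarith
      _ ≤ C * (√(n : ℝ) * peakMass u n 0 (Set.Ioo 0 (b + δ))) := by
          have : 0 ≤ C := by positivity
          gcongr
      _ = _ := by ring
  refine ⟨C, ((b + δ) / (b + ε)) ^ 2, by positivity, by positivity, ?_, ?_⟩
  · refine pow_lt_one₀ (by positivity) ?_ two_ne_zero
    rw [div_lt_one (by positivity)]; linarith
  filter_upwards [hcmp] with n hn i hi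
  have hn0 : 0 < n := by lia
  have hsplit : ∀ r : ℝ, 0 < r → (r ^ (2 * i + 1))⁻¹ * u r ^ n =
      (r ^ (2 * i))⁻¹ * ((r ^ (2 * 0 + 1))⁻¹ * u r ^ n) := fun r _ => by
    rw [pow_succ r (2 * i)]
    simp only [mul_zero, zero_add, pow_one, mul_inv]
    ring
  have hsub : Set.Ioi (b + ε) ⊆ Set.Ioi (0 : ℝ) := Set.Ioi_subset_Ioi (by linarith)
  have h1 : peakMass u n i (Set.Ioi (b + ε)) ≤
      ((b + ε) ^ (2 * i))⁻¹ * peakMass u n 0 (Set.Ioi (b + ε)) := by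
    rw [peakMass, peakMass, ← integral_const_mul]
    refine setIntegral_mono_on ((H.integrableOn hi).mono_set hsub)
      (((H.integrableOn hn0).mono_set hsub).const_mul _) measurableSet_Ioi fun r hr => ?_
    have hr' : b + ε < r := hr
    have hr0 : 0 < r := by linarith
    rw [hsplit r hr0]
    refine mul_le_mul_of_nonneg_right ?_ (H.integrand_nonneg hr0)
    gcongr
  have h2 : ((b + δ) ^ (2 * i))⁻¹ * peakMass u n 0 (Set.Ioo 0 (b + δ)) ≤
      peakMass u n i (Set.Ioo 0 (b + δ)) := by
    rw [peakMass, peakMass, ← integral_const_mul]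
    have hsub2 : Set.Ioo 0 (b + δ) ⊆ Set.Ioi (0 : ℝ) := Set.Ioo_subset_Ioi_self
    refine setIntegral_mono_on (((H.integrableOn hn0).mono_set hsub2).const_mul _)
      ((H.integrableOn hi).mono_set hsub2) measurableSet_Ioo fun r hr => ?_
    have hr0 : 0 < r := hr.1
    rw [hsplit r hr0]
    refine mul_le_mul_of_nonneg_right ?_ (H.integrand_nonneg hr0)
    have := hr.2
    gcongr
  have h3 := H.peakMass_mono hn0 hsub measurableSet_Ioi subset_rfl
  have h4 := H.peakMass_mono hi (A := Set.Ioo 0 (b + δ)) Set.Ioo_subset_Ioi_self measurableSet_Ioi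
    subset_rfl
  have hC0 : 0 ≤ C := by positivity
  have h5 : 0 < (b + ε) ^ (2 * i) := by positivity
  have h6 : 0 < (b + δ) ^ (2 * i) := by positivity
  calc peakMass u n i (Set.Ioi (b + ε))
      ≤ ((b + ε) ^ (2 * i))⁻¹ * peakMass u n 0 (Set.Ioi (b + ε)) := h1
    _ ≤ ((b + ε) ^ (2 * i))⁻¹ * (C * peakMass u n 0 (Set.Ioo 0 (b + δ))) := by
        gcongr
        exact h3.trans hn
    _ = C * ((b + δ) / (b + ε)) ^ (2 * i) *
          (((b + δ) ^ (2 * i))⁻¹ * peakMass u n 0 (Set.Ioo 0 (b + δ))) := by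
        rw [div_pow]; field_simp
    _ ≤ C * ((b + δ) / (b + ε)) ^ (2 * i) * peakMass u n i (Set.Ioi 0) := by
        gcongr
        exact h2.trans h4
    _ = _ := by rw [pow_mul]

lemma norm_peakMoment_le {n i : ℕ} (hi : i < n) {φ : ℝ → ℂ} (hφ : ∀ r, ‖φ r‖ ≤ 1) :
    ‖peakMoment u n i φ‖ ≤ peakMass u n i (Set.Ioi 0) := by
  refine norm_integral_le_of_norm_le (H.integrableOn hi) ?_
  filter_upwards [ae_restrict_mem measurableSet_Ioi] with r hr
  have := H.integrand_nonneg (n := n) (i := i) hr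
  rw [norm_mul, Complex.norm_real, Real.norm_of_nonneg this]
  exact mul_le_of_le_one_left this (hφ r)

lemma norm_peakMoment_ratio_le_one {n i : ℕ} (hi : i < n) {φ : ℝ → ℂ} (hφ : ∀ r, ‖φ r‖ ≤ 1) :
    ‖peakMoment u n i φ / peakMoment u n i (fun _ => 1)‖ ≤ 1 := by
  have hp := H.peakMass_pos hi
  rw [peakMoment_one, norm_div, Complex.norm_real, Real.norm_of_nonneg hp.le, div_le_one hp]
  exact H.norm_peakMoment_le hi hφ

/-- The factor of degree `n - 1 - i` differs from `1` only through the mass where `φ ≠ 1`. -/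
lemma norm_peakMoment_ratio_sub_one_le {n i : ℕ} (hi : i < n) {φ : ℝ → ℂ} (hφm : Measurable φ)
    (hφ : ∀ r, ‖φ r‖ ≤ 1) {A B : ℝ} (hB : 0 ≤ B) (hφ1 : ∀ r, A < r → r ≤ B → φ r = 1) :
    ‖peakMoment u n i φ / peakMoment u n i (fun _ => 1) - 1‖ ≤
      2 * (peakMass u n i (Set.Ioc 0 A) + peakMass u n i (Set.Ioi B)) /
        peakMass u n i (Set.Ioi 0) := by
  have hp := H.peakMass_pos hi
  have hint := H.integrableOn hi
  have hne : peakMoment u n i (fun _ => 1) ≠ 0 := by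
    rw [peakMoment_one]; exact_mod_cast hp.ne'
  rw [div_sub_one hne, norm_div]
  nth_rw 2 [peakMoment_one]
  rw [Complex.norm_real, Real.norm_of_nonneg hp.le]
  refine div_le_div_of_nonneg_right ?_ hp.le
  rw [peakMoment, peakMoment, ← integral_sub (H.integrableOn_mul hi hφm hφ)
    (H.integrableOn_mul hi measurable_const (C := 1) (by simp))]
  set k : ℝ → ℝ := fun r => (r ^ (2 * i + 1))⁻¹ * u r ^ n with hk
  have hi1 : IntegrableOn ((Set.Ioc 0 A).indicator k) (Set.Ioi 0) :=
    hint.indicator measurableSet_Ioc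
  have hi2 : IntegrableOn ((Set.Ioi B).indicator k) (Set.Ioi 0) :=
    hint.indicator measurableSet_Ioi
  have hm : ∫ r in Set.Ioi (0 : ℝ),
      2 * ((Set.Ioc 0 A).indicator k r + (Set.Ioi B).indicator k r) =
      2 * (peakMass u n i (Set.Ioc 0 A) + peakMass u n i (Set.Ioi B)) := by
    rw [integral_const_mul, integral_add hi1 hi2, setIntegral_indicator measurableSet_Ioc,
      setIntegral_indicator measurableSet_Ioi,
      Set.inter_eq_right.2 (Set.Ioc_subset_Ioi_self), Set.inter_eq_right.2
        (Set.Ioi_subset_Ioi hB)]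
    rfl
  rw [← hm]
  refine norm_integral_le_of_norm_le ((hi1.add hi2).const_mul 2) ?_
  filter_upwards [ae_restrict_mem measurableSet_Ioi] with r hr
  have hr0 : (0 : ℝ) < r := hr
  have hk0 : 0 ≤ k r := H.integrand_nonneg hr0
  have h2 : ‖φ r - 1‖ ≤ 2 := (norm_sub_le _ _).trans (by simpa using by linarith [hφ r])
  have hI1 : 0 ≤ (Set.Ioc 0 A).indicator k r := Set.indicator_apply_nonneg fun _ => hk0
  have hI2 : 0 ≤ (Set.Ioi B).indicator k r := Set.indicator_apply_nonneg fun _ => hk0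
  rw [← sub_mul, norm_mul, Complex.norm_real, Real.norm_of_nonneg hk0]
  rcases le_or_gt r A with hrA | hrA
  · rw [Set.indicator_of_mem (show r ∈ Set.Ioc 0 A from ⟨hr0, hrA⟩)]
    nlinarith
  rcases le_or_gt r B with hrB | hrB
  · rw [hφ1 r hrA hrB, sub_self, norm_zero, zero_mul]
    positivity
  · rw [Set.indicator_of_mem (s := Set.Ioi B) hrB]
    nlinarith

/-- The fixed-index limit of the moment ratios. -/
lemma tendsto_peakMoment_ratio (i : ℕ) {φ : ℝ → ℂ} (hφm : Measurable φ)
    (hφ : ∀ r, ‖φ r‖ ≤ 1) (hφb : ContinuousAt φ b) (hφt : ContinuousAt φ t) (hb1 : φ b = 1) :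
    Tendsto (fun n => peakMoment u n i φ / peakMoment u n i (fun _ => 1)) atTop
      (𝓝 (1 + ((√(κb / κt) * (b / t) * ((b / t) ^ 2) ^ i /
        (1 + √(κb / κt) * (b / t) * ((b / t) ^ 2) ^ i) : ℝ) : ℂ) * (φ t - 1))) := by
  have hb := H.b_pos
  have ht := hb.trans H.b_lt_t
  have hκb := H.peak_b.1
  have hκt := H.peak_t.1
  have h1 := H.tendsto_peakMoment i hφm hφ hφb hφt
  have h2 := H.tendsto_peakMoment i (φ := fun _ => 1) measurable_const (C := 1) (by simp)
    continuousAt_const continuousAt_const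
  set X := (b ^ (2 * i + 1))⁻¹ * √(2 * Real.pi / κb) with hX
  set T := (t ^ (2 * i + 1))⁻¹ * √(2 * Real.pi / κt) with hT
  have hX0 : 0 < X := by positivity
  have hT0 : 0 < T := by positivity
  have hodds : √(κb / κt) * (b / t) * ((b / t) ^ 2) ^ i = T / X := by
    have hs : √(2 * Real.pi / κt) = √(κb / κt) * √(2 * Real.pi / κb) := by
      rw [← Real.sqrt_mul (by positivity)]
      congr 1
      field_simp
    have hs0 : √(2 * Real.pi / κb) ≠ 0 := by positivity
    rw [hX, hT, hs, ← pow_mul, mul_assoc, ← pow_succ', div_pow]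
    field_simp
  have hden : (1 : ℂ) * (X : ℂ) + 1 * (T : ℂ) ≠ 0 := by
    rw [one_mul, one_mul]
    exact_mod_cast (add_pos hX0 hT0).ne'
  have hval : (φ b * (X : ℂ) + φ t * (T : ℂ)) / (1 * (X : ℂ) + 1 * (T : ℂ)) =
      1 + ((√(κb / κt) * (b / t) * ((b / t) ^ 2) ^ i /
        (1 + √(κb / κt) * (b / t) * ((b / t) ^ 2) ^ i) : ℝ) : ℂ) * (φ t - 1) := by
    rw [hodds, hb1]
    have hX1 : (X : ℂ) ≠ 0 := by exact_mod_cast hX0.ne'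
    have hXT : (X : ℂ) + T ≠ 0 := by exact_mod_cast (add_pos hX0 hT0).ne'
    push_cast
    field_simp
    ring
  rw [← hval]
  refine (h1.div h2 hden).congr' ?_
  filter_upwards [eventually_gt_atTop 0] with n hn
  have hs : (√(n : ℝ) : ℂ) ≠ 0 := by
    exact_mod_cast (Real.sqrt_pos.2 (by exact_mod_cast hn : (0 : ℝ) < n)).ne'
  rw [Pi.div_apply, mul_div_mul_left _ _ hs]

end IsTwoPeaked

/-! ### The number of particles near the outpost -/

/-- The moment of degree `j = n - 1 - i` of the gas is a moment of the relative weight. -/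
lemma pow_mul_weight_pow (Q : ℂ → EReal) (m : ℝ) {n i : ℕ} (hi : i < n) {r : ℝ} (hr : 0 < r) :
    r ^ (2 * (n - 1 - i) + 1) * weight Q (r : ℂ) ^ n =
      Real.exp (-m) ^ n * ((r ^ (2 * i + 1))⁻¹ * relativeWeight Q m r ^ n) := by
  obtain ⟨j, rfl⟩ : ∃ j, n = i + j + 1 := ⟨n - i - 1, by lia⟩
  have h1 : i + j + 1 - 1 - i = j := by lia
  rw [h1, relativeWeight, mul_pow, mul_pow, Real.exp_neg, inv_pow]
  have h2 : (r ^ 2) ^ (i + j + 1) = r ^ (2 * i + 1) * r ^ (2 * j + 1) := by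
    rw [← pow_mul, ← pow_add]; congr 1; ring
  rw [h2]
  field_simp

lemma radialMoment_eq_peakMoment (Q : ℂ → EReal) (m : ℝ) {n i : ℕ} (hi : i < n) (φ : ℝ → ℂ) :
    radialMoment (fun r => weight Q (r : ℂ)) n (n - 1 - i) φ =
      ((Real.exp (-m) ^ n : ℝ) : ℂ) * peakMoment (relativeWeight Q m) n i φ := by
  rw [radialMoment, peakMoment, ← integral_const_mul]
  refine setIntegral_congr_fun measurableSet_Ioi fun r hr => ?_
  rw [pow_mul_weight_pow Q m hi hr]
  push_cast
  ring

/-- A radial function vanishing near the annulus vanishes for radii close to `[a, b]`. -/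
lemma exists_radius_of_eventually_eq_zero {h : ℂ → ℝ} {a b : ℝ} (ha : 0 ≤ a) (hab : a < b)
    (h_zero : ∀ᶠ z in 𝓝ˢ (closedAnnulus a b), h z = 0) :
    ∃ ε > 0, ∀ r : ℝ, 0 < r → a - ε < r → r ≤ b + ε → h (r : ℂ) = 0 := by
  have hev : ∀ c : ℝ, a ≤ c → c ≤ b → ∀ᶠ r : ℝ in 𝓝 c, h (r : ℂ) = 0 := fun c hac hcb => by
    have hc : (c : ℂ) ∈ closedAnnulus a b := by
      have : ‖(c : ℂ)‖ = c := by simp [ha.trans hac]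
      exact ⟨by rw [this]; exact hac, by rw [this]; exact hcb⟩
    exact Complex.continuous_ofReal.continuousAt.eventually
      (eventually_nhdsSet_iff_forall.1 h_zero _ hc)
  obtain ⟨ε₁, hε₁, h1⟩ := Metric.eventually_nhds_iff.1 (hev a le_rfl hab.le)
  obtain ⟨ε₂, hε₂, h2⟩ := Metric.eventually_nhds_iff.1 (hev b hab.le le_rfl)
  refine ⟨min ε₁ ε₂ / 2, by positivity, fun r hr hra hrb => ?_⟩
  have hm := lt_min hε₁ hε₂
  have hm1 := min_le_left ε₁ ε₂
  have hm2 := min_le_right ε₁ ε₂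
  rcases lt_or_ge r a with h3 | h3
  · exact h1 (by rw [Real.dist_eq, abs_lt]; constructor <;> linarith)
  rcases lt_or_ge b r with h4 | h4
  · exact h2 (by rw [Real.dist_eq, abs_lt]; constructor <;> linarith)
  · exact (hev r h3 h4).self_of_nhds

section Outpost

variable {Q : ℂ → EReal} (hQ : IsExternalPotential Q) {a b t : ℝ} (ha : 0 ≤ a) (hab : a < b)
  (hbt : b < t) (hS : coincidenceSet Q = closedAnnulus a b ∪ {z : ℂ | ‖z‖ = t})
  (hreg : IsRegularNear Q (coincidenceSet Q))

include hQ ha hab hbt hS hreg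

/-- The mass in the hole of the droplet decays exponentially in `n`, uniformly in the index. -/
lemma exists_peakMass_inner_le {m κb κt : ℝ} (H : IsTwoPeaked (relativeWeight Q m) b t κb κt)
    {ε : ℝ} (hε : 0 < ε) (hεa : a ≠ 0 → ε < a) : ∃ C η : ℝ, 0 ≤ C ∧ 0 ≤ η ∧ η < 1 ∧
    ∀ n i : ℕ, i < n → peakMass (relativeWeight Q m) n i (Set.Ioc 0 (a - ε)) ≤
      C * η ^ n * peakMass (relativeWeight Q m) n i (Set.Ioi 0) := by
  rcases eq_or_ne a 0 with rfl | ha0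
  · refine ⟨0, 0, le_rfl, le_rfl, one_pos, fun n i _ => ?_⟩
    rw [Set.Ioc_eq_empty (by linarith)]
    simp [peakMass]
  have hεa' := hεa ha0
  obtain ⟨η, δ, hη0, hη1, hδ, hδε, hle⟩ :=
    exists_weight_le_mul_weight hQ ha hab hbt hS hreg hε hεa'
  refine ⟨(a - ε) / δ, η, div_nonneg (by linarith) hδ.le, hη0, hη1, fun n i hi => ?_⟩
  set k : ℝ → ℝ := fun r => (r ^ (2 * i + 1))⁻¹ * relativeWeight Q m r ^ n with hk
  -- `r^{2j+1} e^{-nQ(r)}` is pointwise smaller in the hole than near the inner boundary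
  have hpt : ∀ r r' : ℝ, 0 < r → r ≤ a - ε → a - δ < r' → r' < a → k r ≤ η ^ n * k r' := by
    intro r r' hr hra hr1 hr2
    have hr' : 0 < r' := by linarith
    have h1 := hle r r' hr hra hr1 hr2
    have hE : 0 < Real.exp (-m) ^ n := by positivity
    refine le_of_mul_le_mul_left ?_ hE
    calc Real.exp (-m) ^ n * k r = r ^ (2 * (n - 1 - i) + 1) * weight Q (r : ℂ) ^ n :=
          (pow_mul_weight_pow Q m hi hr).symm
      _ ≤ r' ^ (2 * (n - 1 - i) + 1) * (η * weight Q (r' : ℂ)) ^ n := by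
          have := weight_nonneg Q (r : ℂ)
          have hrr : r ≤ r' := by linarith
          gcongr
      _ = η ^ n * (r' ^ (2 * (n - 1 - i) + 1) * weight Q (r' : ℂ) ^ n) := by ring
      _ = Real.exp (-m) ^ n * (η ^ n * k r') := by
          rw [pow_mul_weight_pow Q m hi hr']; ring
  have hint := H.integrableOn hi
  have hvol : ∀ r', a - δ < r' → r' < a →
      peakMass (relativeWeight Q m) n i (Set.Ioc 0 (a - ε)) ≤ (a - ε) * (η ^ n * k r') := by
    intro r' h1 h2
    have h3 : ∫ r in Set.Ioc 0 (a - ε), k r ≤ ∫ _ in Set.Ioc 0 (a - ε), η ^ n * k r' :=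
      setIntegral_mono_on (hint.mono_set Set.Ioc_subset_Ioi_self)
        (integrableOn_const (by simp)) measurableSet_Ioc
        fun r hr => hpt r r' hr.1 hr.2 h1 h2
    rw [setIntegral_const, smul_eq_mul, Real.volume_real_Ioc_of_le (by linarith), sub_zero] at h3
    exact h3
  set M := peakMass (relativeWeight Q m) n i (Set.Ioc 0 (a - ε)) with hM
  have hsub : Set.Ioo (a - δ) a ⊆ Set.Ioi (0 : ℝ) := fun r hr => by
    have := hr.1
    show 0 < r
    linarith
  have h4 : δ * M ≤ (a - ε) * (η ^ n * peakMass (relativeWeight Q m) n i (Set.Ioo (a - δ) a)) := by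
    have h5 : ∫ _ in Set.Ioo (a - δ) a, M ≤ ∫ r in Set.Ioo (a - δ) a, (a - ε) * (η ^ n * k r) :=
      setIntegral_mono_on (integrableOn_const (by simp))
        (((hint.mono_set hsub).const_mul _).const_mul _) measurableSet_Ioo
        fun r hr => hvol r hr.1 hr.2
    rw [setIntegral_const, smul_eq_mul, Real.volume_real_Ioo_of_le (by linarith),
      integral_const_mul, integral_const_mul, sub_sub_cancel] at h5
    exact h5
  have h6 := H.peakMass_mono hi hsub measurableSet_Ioi subset_rfl
  have h7 : 0 ≤ a - ε := by linarith
  rw [div_mul_eq_mul_div, div_mul_eq_mul_div, le_div_iff₀ hδ]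
  calc M * δ = δ * M := mul_comm _ _
    _ ≤ (a - ε) * (η ^ n * peakMass (relativeWeight Q m) n i (Set.Ioo (a - δ) a)) := h4
    _ ≤ (a - ε) * (η ^ n * peakMass (relativeWeight Q m) n i (Set.Ioi 0)) := by gcongr
    _ = _ := by ring

lemma radial_gas_hypotheses : Measurable (fun r : ℝ => weight Q (r : ℂ)) ∧
    (∀ z, weight Q z = weight Q (‖z‖ : ℂ)) ∧
    (∀ n : ℕ, ∀ j < n, IntegrableOn (fun r : ℝ => r ^ (2 * j + 1) * weight Q (r : ℂ) ^ n)
      (Set.Ioi 0)) ∧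
    ∀ n : ℕ, ∀ j < n, radialMoment (fun r => weight Q (r : ℂ)) n j (fun _ => 1) ≠ 0 := by
  obtain ⟨m, H⟩ := exists_isTwoPeaked hQ ha hab hbt hS hreg
  have hj : ∀ n j : ℕ, j < n → n - 1 - j < n ∧ n - 1 - (n - 1 - j) = j := fun n j hj => by lia
  refine ⟨?_, fun z => by rw [weight, hQ.radial z]; rfl, fun n j hjn => ?_, fun n j hjn => ?_⟩
  · have := hQ.measurable_weight
    fun_prop
  · obtain ⟨h1, h2⟩ := hj n j hjn
    refine IntegrableOn.congr_fun ((H.integrableOn h1).const_mul (Real.exp (-m) ^ n))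
      (fun r hr => ?_) measurableSet_Ioi
    rw [← pow_mul_weight_pow Q m h1 hr, h2]
  · obtain ⟨h1, h2⟩ := hj n j hjn
    have h3 := radialMoment_eq_peakMoment Q m h1 (fun _ => 1)
    rw [h2] at h3
    rw [h3, IsTwoPeaked.peakMoment_one]
    have h4 := (H.peakMass_pos h1).ne'
    have h5 : Real.exp (-m) ^ n ≠ 0 := by positivity
    exact mul_ne_zero (by exact_mod_cast h5) (by exact_mod_cast h4)

lemma isProbabilityMeasure_gibbsMeasure_of_outpost (n : ℕ) :
    IsProbabilityMeasure (gibbsMeasure Q n) := by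
  obtain ⟨h1, h2, h3, h4⟩ := radial_gas_hypotheses hQ ha hab hbt hS hreg
  exact isProbabilityMeasure_gibbsMeasure hQ.ne_bot (w := fun r => weight Q (r : ℂ)) h1 h2 (h3 n)
    (h4 n)

/-- Convergence of the characteristic functions of the number of particles near the outpost. -/
lemma tendsto_charFun_linearStatistic {h : ℂ → ℝ} (h_cont : Continuous h)
    (h_radial : ∀ z : ℂ, h z = h (‖z‖ : ℂ))
    (h_zero : ∀ᶠ z in 𝓝ˢ (closedAnnulus a b), h z = 0) (h_one : h (t : ℂ) = 1) (s : ℝ) :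
    Tendsto (fun n : ℕ => charFun ((gibbsMeasure Q n).map fun z => ∑ j, h (z j)) s) atTop
      (𝓝 (charFun ((heine (√(quarterLaplacian Q (b : ℂ) / quarterLaplacian Q (t : ℂ)) * (b / t))
        ((b / t) ^ 2)).map (fun k : ℕ => (k : ℝ))) s)) := by
  obtain ⟨m, H⟩ := exists_isTwoPeaked hQ ha hab hbt hS hreg
  obtain ⟨hwm, hwr, hint, hpos⟩ := radial_gas_hypotheses hQ ha hab hbt hS hreg
  have hb := H.b_pos
  have ht := hb.trans hbt
  obtain ⟨ε₀, hε₀, hzero₀⟩ := exists_radius_of_eventually_eq_zero ha hab h_zero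
  obtain ⟨ε, hε, hεε, hεa⟩ : ∃ ε > 0, ε ≤ ε₀ ∧ (a ≠ 0 → ε < a) := by
    rcases eq_or_ne a 0 with h0 | h0
    · exact ⟨ε₀, hε₀, le_rfl, fun h => absurd h0 h⟩
    · have ha0 : 0 < a := lt_of_le_of_ne ha h0.symm
      exact ⟨min ε₀ (a / 2), by positivity, min_le_left _ _,
        fun _ => (min_le_right _ _).trans_lt (by linarith)⟩
  set u := relativeWeight Q m with hu
  set φ : ℝ → ℂ := fun r => Complex.exp (s * h (r : ℂ) * Complex.I) with hφ
  have hφc : Continuous φ := by fun_prop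
  have hφ1 : ∀ r, ‖φ r‖ ≤ 1 := fun r => by
    simp only [hφ]
    rw [← Complex.ofReal_mul, Complex.norm_exp_ofReal_mul_I]
  have hφz : ∀ r : ℝ, 0 < r → a - ε < r → r ≤ b + ε → φ r = 1 := fun r hr h1 h2 => by
    simp [hφ, hzero₀ r hr (by linarith) (by linarith)]
  have hφb : φ b = 1 := hφz b hb (by linarith) (by linarith)
  have hφt : φ t = Complex.exp (s * Complex.I) := by simp [hφ, h_one]
  obtain ⟨C₁, κ, hC₁, hκ0, hκ1, houter⟩ := H.exists_peakMass_outer_le hε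
  obtain ⟨C₂, η, hC₂, hη0, hη1, hinner⟩ :=
    exists_peakMass_inner_le hQ ha hab hbt hS hreg H hε hεa
  have hcf : ∀ n : ℕ, charFun ((gibbsMeasure Q n).map fun z => ∑ j, h (z j)) s =
      ∏ i ∈ Finset.range n, (peakMoment u n i φ / peakMoment u n i (fun _ => 1)) := by
    intro n
    rw [charFun_linearStatistic hQ.ne_bot (w := fun r => weight Q (r : ℂ)) hwm hwr (hint n)
      (hpos n) h_cont.measurable h_radial s, ← Finset.prod_range_reflect]
    refine Finset.prod_congr rfl fun i hi => ?_
    have hi' := Finset.mem_range.1 hi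
    rw [radialMoment_eq_peakMoment Q m hi', radialMoment_eq_peakMoment Q m hi',
      mul_div_mul_left _ _ (by
        have : Real.exp (-m) ^ n ≠ 0 := by positivity
        exact_mod_cast this)]
  simp only [hcf]
  have hΔb : 0 < quarterLaplacian Q (b : ℂ) := by linarith [H.peak_b.1]
  have hΔt : 0 < quarterLaplacian Q (t : ℂ) := by linarith [H.peak_t.1]
  have hρ0 : 0 < b / t := by positivity
  have hρ1 : b / t < 1 := (div_lt_one ht).2 hbt
  set ϑ := √(quarterLaplacian Q (b : ℂ) / quarterLaplacian Q (t : ℂ)) * (b / t) with hϑ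
  have hϑ0 : 0 < ϑ := by positivity
  have hq : 4 * quarterLaplacian Q (b : ℂ) / (4 * quarterLaplacian Q (t : ℂ)) =
      quarterLaplacian Q (b : ℂ) / quarterLaplacian Q (t : ℂ) := by
    rw [mul_div_mul_left _ _ (by norm_num)]
  have hlimit := tendsto_prod_charFun_heine hϑ0 (q := (b / t) ^ 2) (by positivity)
    (pow_lt_one₀ hρ0.le hρ1 two_ne_zero) s
  refine tendsto_prod_of_dominated (B := fun i => 2 * (C₂ * η ^ i + C₁ * κ ^ i)) ?_
    (fun n i hi => H.norm_peakMoment_ratio_le_one hi hφ1) (fun i => ?_) (fun i => ?_) ?_ hlimit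
  · exact (((summable_geometric_of_lt_one hη0 hη1).mul_left C₂).add
      ((summable_geometric_of_lt_one hκ0 hκ1).mul_left C₁)).mul_left 2
  · -- a Bernoulli characteristic function is a convex combination of `1` and `e^{is}`
    set p : ℝ := ϑ * ((b / t) ^ 2) ^ i / (1 + ϑ * ((b / t) ^ 2) ^ i) with hp
    have hx : 0 < ϑ * ((b / t) ^ 2) ^ i := by positivity
    have hp0 : 0 ≤ p := by positivity
    have hp1 : p ≤ 1 := (div_le_one (by positivity)).2 (by linarith)
    calc ‖1 + (p : ℂ) * (Complex.exp (s * Complex.I) - 1)‖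
        = ‖((1 - p : ℝ) : ℂ) + (p : ℂ) * Complex.exp (s * Complex.I)‖ := by
          congr 1; push_cast; ring
      _ ≤ (1 - p) + p * 1 := by
          refine (norm_add_le _ _).trans ?_
          rw [norm_mul, Complex.norm_exp_ofReal_mul_I, Complex.norm_real, Complex.norm_real,
            Real.norm_of_nonneg hp0, Real.norm_of_nonneg (by linarith)]
      _ = 1 := by ring
  · have := H.tendsto_peakMoment_ratio i hφc.measurable hφ1 hφc.continuousAt hφc.continuousAt hφb
    rwa [hφt, hq] at this
  · filter_upwards [houter] with n hn i hi
    have hp := H.peakMass_pos hi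
    -- the bound compares `φ` with `1` only on the positive half-line
    have hmod : peakMoment u n i φ = peakMoment u n i ((Set.Ioi 0).piecewise φ fun _ => 1) := by
      refine setIntegral_congr_fun measurableSet_Ioi fun r hr => ?_
      rw [Set.piecewise_eq_of_mem _ _ _ hr]
    rw [hmod]
    refine (H.norm_peakMoment_ratio_sub_one_le hi
      (hφc.measurable.piecewise measurableSet_Ioi measurable_const) (fun r => ?_) (A := a - ε)
      (B := b + ε) (by linarith) fun r h1 h2 => ?_).trans ?_
    · by_cases hr : r ∈ Set.Ioi (0 : ℝ)
      · rw [Set.piecewise_eq_of_mem _ _ _ hr]; exact hφ1 r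
      · rw [Set.piecewise_eq_of_notMem _ _ _ hr]; simp
    · by_cases hr : r ∈ Set.Ioi (0 : ℝ)
      · rw [Set.piecewise_eq_of_mem _ _ _ hr]; exact hφz r hr h1 h2
      · rw [Set.piecewise_eq_of_notMem _ _ _ hr]
    · rw [div_le_iff₀ hp]
      have h1 := hn i hi
      have h2 := hinner n i hi
      have h3 : η ^ n ≤ η ^ i := pow_le_pow_of_le_one hη0 hη1.le hi.le
      have h4 : C₂ * η ^ n * peakMass u n i (Set.Ioi 0) ≤ C₂ * η ^ i * peakMass u n i (Set.Ioi 0) := by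
        gcongr
      linarith

end Outpost

/-- A function vanishing near the support of `σ` has `σ`-integral zero. -/
lemma integral_eq_zero_of_eventually_nhdsSet {σ : Measure ℂ} {h : ℂ → ℝ} {S : Set ℂ}
    (hS : σ.support = S) (h_zero : ∀ᶠ z in 𝓝ˢ S, h z = 0) : ∫ w, h w ∂σ = 0 := by
  refine integral_eq_zero_of_ae ?_
  filter_upwards [Measure.support_mem_ae (μ := σ)] with z hz
  exact h_zero.self_of_nhdsSet z (hS ▸ hz)

end CoulombGas

end

theorem mainTheorem11
    (Q : ℂ → EReal) (hQ : CoulombGas.IsExternalPotential Q)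
    (σ : Measure ℂ) (hσ : CoulombGas.IsEquilibriumMeasure Q σ)
    (a b t : ℝ) (ha : 0 ≤ a) (hab : a < b) (hbt : b < t)
    (hS : σ.support = CoulombGas.closedAnnulus a b)
    (hSstar : CoulombGas.coincidenceSet Q = CoulombGas.closedAnnulus a b ∪ {z : ℂ | ‖z‖ = t})
    (hreg : CoulombGas.IsRegularNear Q (CoulombGas.coincidenceSet Q))
    (h : ℂ → ℝ) (h_cont : Continuous h) (h_bdd : ∃ C : ℝ, ∀ z, |h z| ≤ C)
    (h_radial : ∀ z : ℂ, h z = h (‖z‖ : ℂ))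
    (h_zero : ∀ᶠ z in 𝓝ˢ (CoulombGas.closedAnnulus a b), h z = 0)
    (h_one : ∀ᶠ z in 𝓝ˢ {z : ℂ | ‖z‖ = t}, h z = 1)
    (ρ θ : ℝ) (hρ : ρ = b / t)
    (hθ : θ = Real.sqrt
      (CoulombGas.quarterLaplacian Q (b : ℂ) / CoulombGas.quarterLaplacian Q (t : ℂ))) :
    (∀ (n : ℕ) (z : Fin n → ℂ), CoulombGas.fluct σ h z = ∑ j, h (z j)) ∧
    ∃ (_ : ∀ n : ℕ, IsProbabilityMeasure (CoulombGas.gibbsMeasure Q n))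
      (_ : IsProbabilityMeasure (CoulombGas.heine (θ * ρ) (ρ ^ 2))),
      TendstoInDistribution
        (fun (n : ℕ) (z : Fin n → ℂ) => ∑ j, h (z j)) atTop
        (fun k : ℕ => (k : ℝ))
        (fun n : ℕ => CoulombGas.gibbsMeasure Q n)
        (CoulombGas.heine (θ * ρ) (ρ ^ 2)) := by
  have ht : 0 < t := (ha.trans_lt hab).trans hbt
  have hρ0 : 0 < ρ := by rw [hρ]; exact div_pos (ha.trans_lt hab) ht
  have hρ1 : ρ < 1 := by rw [hρ]; exact (div_lt_one ht).2 hbt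
  have hθ0 : 0 < θ := by
    obtain ⟨U, -, hSU, -, -, hΔ⟩ := hreg
    have hmem : ∀ c : ℝ, 0 ≤ c → c = b ∨ c = t → (c : ℂ) ∈ U := fun c hc h => hSU <| by
      have hn : ‖(c : ℂ)‖ = c := by simp [hc]
      rw [hSstar]
      rcases h with rfl | rfl
      · exact Or.inl ⟨by rw [hn]; exact hab.le, hn.le⟩
      · exact Or.inr hn
    rw [hθ]
    exact Real.sqrt_pos.2 (div_pos (hΔ _ (hmem b (ha.trans hab.le) (Or.inl rfl)))
      (hΔ _ (hmem t ht.le (Or.inr rfl))))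
  have hfluct : ∀ (n : ℕ) (z : Fin n → ℂ), CoulombGas.fluct σ h z = ∑ j, h (z j) := fun n z => by
    rw [CoulombGas.fluct, CoulombGas.integral_eq_zero_of_eventually_nhdsSet hS h_zero, mul_zero,
      sub_zero]
  have hgibbs := CoulombGas.isProbabilityMeasure_gibbsMeasure_of_outpost hQ ha hab hbt hSstar hreg
  have hheine : IsProbabilityMeasure (CoulombGas.heine (θ * ρ) (ρ ^ 2)) :=
    CoulombGas.isProbabilityMeasure_heine (by positivity) (by positivity)
      (pow_lt_one₀ hρ0.le hρ1 two_ne_zero)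
  have hmeas : ∀ n : ℕ, Measurable fun z : Fin n → ℂ => ∑ j, h (z j) := fun n =>
    Finset.measurable_fun_sum _ fun j _ => h_cont.measurable.comp (measurable_pi_apply j)
  refine ⟨hfluct, hgibbs, hheine, ⟨fun n => (hmeas n).aemeasurable, by fun_prop, ?_⟩⟩
  refine ProbabilityMeasure.tendsto_of_tendsto_charFun fun s => ?_
  have h_one_t : h (t : ℂ) = 1 :=
    h_one.self_of_nhdsSet (t : ℂ) (show ‖(t : ℂ)‖ = t by simp [ht.le])
  subst hρ hθ
  exact CoulombGas.tendsto_charFun_linearStatistic hQ ha hab hbt hSstar hreg h_cont h_radial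
    h_zero h_one_t s
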